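/- Work in $\mathbb R^{3+1}$ with points $(t,x)$, $r=|x|$, $\Box=-\partial_t^2+\Delta_x$. For $s>0$ let $\mathcal H_s=\{t>0,\ t^2-r^2=s^2\}$, parametrized by $x\in\mathbb R^3$, and let $L^2(\mathcal H_s)$ be taken with respect to $dx=dx^1dx^2dx^3$. On a hyperboloid, and on the region between two hyperboloids, $s$ also denotes $\sqrt{t^2-r^2}$. Put $\langle y\rangle=(1+y^2)^{1/2}$, $\tau_-=\langle t-r\rangle$, $\tau_+=\langle t+r\rangle$, $\tau_0=\tau_- /\tau_+$, and $w_a=1+a\,\tau_+^a\tau_0^{\max(a,1/2)}$. Let $\underline\partial_i=\partial_i+\frac{x^i}{t}\partial_t$, $\underline\partial_x=(\underline\partial_1,\underline\partial_2,\underline\partial_3)$, $L_i=t\partial_i+x^i\partial_t$, $\partial^B_r=\partial_t+\partial_r$, and let $\nabla\!\!\!\!/$ be the angular part of the spatial gradient (tangent to the spheres of constant $t$ and $r$). For $a\in[0,1]$ define $$\|\phi\|_{E_W}=\big\|\tfrac st\partial_t\phi\big\|_{L^2(\mathcal H_s)}+\|\underline\partial_x\phi\|_{L^2(\mathcal H_s)},$$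 $$\|\phi\|_{E_W^a}=\big\|w_a\tfrac st\partial_t\phi\big\|_{L^2(\mathcal H_s)}+\|s^a\underline\partial_x\phi\|_{L^2(\mathcal H_s)}+a\big\|\tfrac{s^a}{t}\phi\big\|_{L^2(\mathcal H_s)},$$ $$\|r\phi\|_{E_I^a}=\Big\|w_a\Big(\tfrac st\tfrac{\partial_t(r\phi)}{r},\nabla\!\!\!\!/\,\phi\Big)\Big\|_{L^2(\mathcal H_s)}+\Big\|\tau_+^a\Big(\tfrac{\partial^B_r(r\phi)}{r},\tfrac st\nabla\!\!\!\!/\,\phi\Big)\Big\|_{L^2(\mathcal H_s)},$$ $$\|s^2\phi\|_{E_{II}^a}=\Big\|(1+s^{a-1}\tau_-)\Big(\tfrac st\tfrac{\partial_t(s^2\phi)}{s^2},\nabla\!\!\!\!/\,\phi\Big)\Big\|_{L^2(\mathcal H_s)}+\Big\|s^{a-1}\tau_+\Big(\tfrac{\partial^B_r(s^2\phi)}{s^2},\tfrac st\nabla\!\!\!\!/\,\phi\Big)\Big\|_{L^2(\mathcal H_s)},$$ $$\|F\|_{N_W^a[s_0,s_1]}=\int_{s_0}^{s_1}\|\tau_+^aF\|_{L^2(\mathcal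 H_s)}\,ds.$$ For multi-indices $I=(I_0,\dots,I_3)$, $J=(J_1,J_2,J_3)$ put $\partial^I=\partial_0^{I_0}\partial_1^{I_1}\partial_2^{I_2}\partial_3^{I_3}$ (with $\partial_0=\partial_t$) and $L^J=L_1^{J_1}L_2^{J_2}L_3^{J_3}$. The order-$k$ version of each norm (superscript $k$) is the sum, over $|I|+|J|\le k$, of that norm applied to $\partial^IL^J\phi$ (resp. $\partial^IL^JF$) in place of $\phi$ (resp. $F$); write $\|\phi(s)\|_{E_I^{a,k}}=\sum_{|I|+|J|\le k}\|r\,\partial^IL^J\phi\|_{E_I^a}$ and $\|\phi(s)\|_{E_{II}^{a,k}}=\sum_{|I|+|J|\le k}\|s^2\partial^IL^J\phi\|_{E_{II}^a}$ on $\mathcal H_s$. **Statement.** Let $s_0>1$, $a\in[0,1]$ and let $k\ge0$ be an integer. There is a constant $C$, depending only on $s_0,a,k$, such that for every $s_1>s_0$ and every compactly supported solution $\phi$ of $$\Box\phi=F,\qquad(\phi,\partial_t\phi)|_{\mathcal H_{s_0}}=(\phi_0,\phi_1)$$ in the region $\{t>0,\ s_0^2\le t^2-r^2\le s_1^2\}$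 the following holds. 1. (Weighted energy estimate.) If $\phi$ is of class $C^{k+2}$, then $$\sup_{s_0\le s\le s_1}\|\phi(s)\|_{E_W^{a,k}}\le C\Big(\|\phi(s_0)\|_{E_I^{a,k}}+\|\phi(s_0)\|_{E_{II}^{a,k}}+\|\phi(s_0)\|_{E_W^k}+\|F\|_{N_W^{a,k}[s_0,s_1]}\Big).$$ 2. (Weighted pointwise decay.) If $\phi$ is of class $C^{k+4}$, then $$\sup_{s_0\le s\le s_1}\sum_{|I|+|J|\le k}\big\|s^a\tau_+^{1/2}\partial^IL^J\phi\big\|_{L^\infty(\mathcal H_s)}\le C\Big(\|\phi(s_0)\|_{E_I^{a,k+2}}+\|\phi(s_0)\|_{E_{II}^{a,k+2}}+\|\phi(s_0)\|_{E_W^{k+2}}+\|F\|_{N_W^{a,k+2}[s_0,s_1]}\Big).$$ -/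

import Mathlib

open MeasureTheory
open scoped ENNReal NNReal

noncomputable section

namespace Hyperboloidal

/-- Space `ℝ³` with its Euclidean norm. -/
abbrev Space : Type := EuclideanSpace ℝ (Fin 3)

/-- Minkowski space `ℝ³⁺¹`; a point is `p = (t, x)`. -/
abbrev Spacetime : Type := ℝ × Space

/-- The `i`-th unit vector of `ℝ³`. -/
def unitVec (i : Fin 3) : Space := EuclideanSpace.single i 1

/-! ### Vector fields, acting on scalar functions -/

/-- `∂_t φ`. -/
def dt (φ : Spacetime → ℝ) (p : Spacetime) : ℝ := fderiv ℝ φ p (1, 0)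

/-- `∂_i φ`. -/
def dx (i : Fin 3) (φ : Spacetime → ℝ) (p : Spacetime) : ℝ := fderiv ℝ φ p (0, unitVec i)

/-- `∂_α φ`, where `α = 0` is time. -/
def partialD (α : Fin 4) : (Spacetime → ℝ) → Spacetime → ℝ :=
  Fin.cases dt dx α

/-- The Lorentz boost `L_i = t ∂_i + x^i ∂_t`. -/
def boost (i : Fin 3) (φ : Spacetime → ℝ) (p : Spacetime) : ℝ :=
  p.1 * dx i φ p + p.2 i * dt φ p

/-- The wave operator `□ = - ∂_t² + Δ_x`. -/
def box (φ : Spacetime → ℝ) (p : Spacetime) : ℝ :=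
  -dt (dt φ) p + ∑ i, dx i (dx i φ) p

/-- The semi-hyperboloidal derivatives `∂̲_i = ∂_i + (x^i / t) ∂_t`, as a vector. -/
def tangentialGrad (φ : Spacetime → ℝ) (p : Spacetime) : Space :=
  WithLp.toLp 2 fun i => dx i φ p + p.2 i / p.1 * dt φ p

/-- The radial derivative `∂_r = (x^i / r) ∂_i` (its value on the axis `r = 0` is irrelevant). -/
def dr (φ : Spacetime → ℝ) (p : Spacetime) : ℝ := fderiv ℝ φ p (0, ‖p.2‖⁻¹ • p.2)

/-- The Bondi derivative `∂_u^B = ∂_t`. -/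
def bondiU (φ : Spacetime → ℝ) : Spacetime → ℝ := dt φ

/-- The Bondi derivative `∂_r^B = ∂_t + ∂_r`. -/
def bondiR (φ : Spacetime → ℝ) (p : Spacetime) : ℝ := dt φ p + dr φ p

/-- The angular gradient: the part of the spatial gradient that is tangent to the spheres on which
`t` and `r` (equivalently `t - r` and `r`) are constant. -/
def angularGrad (φ : Spacetime → ℝ) (p : Spacetime) : Space :=
  WithLp.toLp 2 fun i => dx i φ p - ‖p.2‖⁻¹ * p.2 i * dr φ p

/-- `∂^I = ∂_0^{I_0} ∂_1^{I_1} ∂_2^{I_2} ∂_3^{I_3}`. -/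
def partialPow (I : Fin 4 → ℕ) (φ : Spacetime → ℝ) : Spacetime → ℝ :=
  (partialD 0)^[I 0] ((partialD 1)^[I 1] ((partialD 2)^[I 2] ((partialD 3)^[I 3] φ)))

/-- `L^J = L_1^{J_1} L_2^{J_2} L_3^{J_3}`. -/
def boostPow (J : Fin 3 → ℕ) (φ : Spacetime → ℝ) : Spacetime → ℝ :=
  (boost 0)^[J 0] ((boost 1)^[J 1] ((boost 2)^[J 2] φ))

/-- The pairs of multi-indices `(I, J)` with `|I| + |J| ≤ k`. -/
def multiIndices (k : ℕ) : Finset ((Fin 4 → ℕ) × (Fin 3 → ℕ)) :=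
  (Finset.Iic (fun _ => k) ×ˢ Finset.Iic (fun _ => k)).filter
    fun IJ => ∑ α, IJ.1 α + ∑ i, IJ.2 i ≤ k

theorem mem_multiIndices (k : ℕ) (I : Fin 4 → ℕ) (J : Fin 3 → ℕ) :
    (I, J) ∈ multiIndices k ↔ ∑ α, I α + ∑ i, J i ≤ k := by
  simp only [multiIndices, Finset.mem_filter, Finset.mem_product, Finset.mem_Iic,
    and_iff_right_iff_imp]
  intro h
  constructor
  · intro α
    have := Finset.single_le_sum (f := I) (fun _ _ => Nat.zero_le _) (Finset.mem_univ α)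
    simp only
    omega
  · intro i
    have := Finset.single_le_sum (f := J) (fun _ _ => Nat.zero_le _) (Finset.mem_univ i)
    simp only
    omega

/-! ### Weights -/

/-- The Japanese bracket `⟨y⟩ = (1 + y²)^{1/2}`. -/
def bracket (y : ℝ) : ℝ := Real.sqrt (1 + y ^ 2)

/-- `τ₋ = ⟨t - r⟩`. -/
def tauMinus (p : Spacetime) : ℝ := bracket (p.1 - ‖p.2‖)

/-- `τ₊ = ⟨t + r⟩`. -/
def tauPlus (p : Spacetime) : ℝ := bracket (p.1 + ‖p.2‖)

/-- `τ₀ = τ₋ / τ₊`. -/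
def tauZero (p : Spacetime) : ℝ := tauMinus p / tauPlus p

/-- The weight `1 + a τ₊^a τ₀^{max(a, 1/2)}`. -/
def morawetzWeight (a : ℝ) (p : Spacetime) : ℝ :=
  1 + a * tauPlus p ^ a * tauZero p ^ max a (1 / 2)

/-- The function `r = |x|`. -/
def radius (p : Spacetime) : ℝ := ‖p.2‖

/-- The function `s² = t² - r²`. -/
def hypSq (p : Spacetime) : ℝ := p.1 ^ 2 - ‖p.2‖ ^ 2

/-! ### Hyperboloids and norms on them -/

/-- The point `(√(s² + |x|²), x)` of the hyperboloid `H_s = {t > 0, t² - r² = s²}` above `x`. -/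
def hypPoint (s : ℝ) (x : Space) : Spacetime := (Real.sqrt (s ^ 2 + ‖x‖ ^ 2), x)

/-- The region `{t > 0, s₀² ≤ t² - r² ≤ s₁²}` between two hyperboloids. -/
def slab (s₀ s₁ : ℝ) : Set Spacetime :=
  {p | 0 < p.1 ∧ s₀ ^ 2 ≤ hypSq p ∧ hypSq p ≤ s₁ ^ 2}

/-- The norm of `L²(H_s)` with respect to the flat measure `dx` (a value in `[0, ∞]`). -/
def normL2 {V : Type*} [NormedAddCommGroup V] (s : ℝ) (f : Spacetime → V) : ℝ≥0∞ :=
  eLpNorm (fun x : Space => f (hypPoint s x)) 2 volume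

/-- The norm of `L^∞(H_s)` (a value in `[0, ∞]`). -/
def normLinf (s : ℝ) (f : Spacetime → ℝ) : ℝ≥0∞ :=
  eLpNorm (fun x : Space => f (hypPoint s x)) ∞ volume

/-- The standard hyperboloidal energy norm `E_W` on `H_s`. -/
def energyW (s : ℝ) (φ : Spacetime → ℝ) : ℝ≥0∞ :=
  normL2 s (fun p => s / p.1 * dt φ p) + normL2 s (tangentialGrad φ)

/-- The weighted hyperboloidal energy norm `E_W^a` on `H_s`. -/
def energyWa (a s : ℝ) (φ : Spacetime → ℝ) : ℝ≥0∞ :=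
  normL2 s (fun p => morawetzWeight a p * (s / p.1 * dt φ p))
    + normL2 s (fun p => s ^ a • tangentialGrad φ p)
    + ENNReal.ofReal a * normL2 s (fun p => s ^ a / p.1 * φ p)

/-- A scalar and a vector put together in one Euclidean vector. -/
def pair (y : ℝ) (v : Space) : WithLp 2 (ℝ × Space) := WithLp.toLp 2 (y, v)

/-- The conformal energy norm of `r φ` on `H_s` (conformal weight `Ω = r`). -/
def energyI (a s : ℝ) (φ : Spacetime → ℝ) : ℝ≥0∞ :=
  normL2 s (fun p => morawetzWeight a p •
      pair (s / p.1 * (bondiU (fun q => radius q * φ q) p / radius p)) (angularGrad φ p))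
    + normL2 s (fun p => tauPlus p ^ a •
      pair (bondiR (fun q => radius q * φ q) p / radius p) ((s / p.1) • angularGrad φ p))

/-- The conformal energy norm of `s² φ` on `H_s` (conformal weight `Ω = s²`). -/
def energyII (a s : ℝ) (φ : Spacetime → ℝ) : ℝ≥0∞ :=
  normL2 s (fun p => (1 + s ^ (a - 1) * tauMinus p) •
      pair (s / p.1 * (bondiU (fun q => hypSq q * φ q) p / hypSq p)) (angularGrad φ p))
    + normL2 s (fun p => (s ^ (a - 1) * tauPlus p) •
      pair (bondiR (fun q => hypSq q * φ q) p / hypSq p) ((s / p.1) • angularGrad φ p))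

/-- The source norm `N_W^a[s₀, s₁]`: the integral over `s ∈ [s₀, s₁]` of `‖τ₊^a F‖_{L²(H_s)}`. -/
def sourceNorm (a s₀ s₁ : ℝ) (F : Spacetime → ℝ) : ℝ≥0∞ :=
  ∫⁻ s in Set.Icc s₀ s₁, normL2 s (fun p => tauPlus p ^ a * F p)

/-- The order-`k` version `∑_{|I|+|J| ≤ k} ν(∂^I L^J φ)` of a norm `ν`. -/
def highOrder (k : ℕ) (ν : (Spacetime → ℝ) → ℝ≥0∞) (φ : Spacetime → ℝ) : ℝ≥0∞ :=
  ∑ IJ ∈ multiIndices k, ν (partialPow IJ.1 (boostPow IJ.2 φ))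

/-! ### The Cauchy problem -/

/-- `φ` is a compactly supported solution, of class `C^n` (up to and across the two bounding
hyperboloids), of `□ φ = F` in the region between `H_{s₀}` and `H_{s₁}`, with data
`(φ, ∂_t φ) = (φ₀, φ₁)` on `H_{s₀}`, the hyperboloid being parametrized by `x`. -/
structure IsCauchySolution (n : ℕ) (s₀ s₁ : ℝ) (φ F : Spacetime → ℝ) (φ₀ φ₁ : Space → ℝ) :
    Prop where
  regular : ∀ p ∈ slab s₀ s₁, ContDiffAt ℝ n φ p
  wave : ∀ p ∈ slab s₀ s₁, box φ p = F p
  initial : ∀ x, φ (hypPoint s₀ x) = φ₀ x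
  initial_dt : ∀ x, dt φ (hypPoint s₀ x) = φ₁ x
  compact : ∃ K : Set Spacetime, IsCompact K ∧ ∀ p ∈ slab s₀ s₁, p ∉ K → φ p = 0

end Hyperboloidal

end

/-! In the coordinates (s, x), where t = √(s² + |x|²), hyperboloids become slices with the flat
measure. For u = `pull φ` one has ∂_s u = (s/t) ∂_t φ and ∂_i u = ∂̲_i φ, and the equation reads
-∂_s² u - (2/s) x·∂∂_s u + Δu - (3/s) ∂_s u = F (`hypWave_pull`). The energy estimate rests on two
divergence identities.

Conformal energy: let N = s ∂_s u + 2 x·∂u + 2u, so that tN = Kφ + 2tφ for the Morawetz field K =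
(t² + r²)∂_t + 2tr ∂_r. Then E = ∫ N² + s²|∂u|² satisfies E' = -2s ∫ N F
(`hasDerivAt_conformalEnergy`). With the Hardy inequality, E also dominates the square integral of
(s²/t) ∂_s u (`integral_retarded_dt_le`).

Weighted energy: let W = (s²/t)^{2a} and R = ∫ W(|∂_s u|² + |∂u|²). Apart from the source, R grows
at most at the rate 366 a s^{2a-3} E (`hasDerivAt_weightedEnergy`, `retardedEnergy_deriv_le`).
Taking a = 0 gives the standard energy.

For a < 1 neither quantity suffices alone. In H = s^{2a-2} E + (1-a)/200 · R, the derivative of the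
power of s is -2(1-a) s^{2a-3} E, which absorbs the growth of R. So (√H)' ≤ 2 s^a ‖F‖
(`sqrt_combinedEnergy_le_add`), and s ≤ τ₊ bounds the integral of the right side by the source norm.
At a = 1 the term R drops out and E itself controls (s²/t) ∂_s u. Since t - r ≤ s²/t, the standard
energy and H together dominate the norm E_W^a (`energyWa_le`). Initially, E is bounded by the E_II
and E_W norms, because N is an explicit combination of the Bondi derivatives of s²φ
(`conformalField_pull`).

Higher orders follow because ∂_α and L_i commute with □ (`box_fieldPow`).

Pointwise decay comes from `agmon`: t f(x₀)² is bounded by the Dirichlet integrals of f and of the t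
∂_j f. Since t ∂̲_j = L_j, this costs one boost. The operators L_j ∂^I L^J are rewritten through the
ordered ones with bounded coefficients (`comb_boost_fieldPow`).

All this is done for compactly supported functions inside the light cone. A solution on the slab is
replaced by such a function through a cutoff, which changes no norm in use
(`exists_admissible_slabEq`, `SlabEq.fderiv_eq`). -/

noncomputable section

namespace Hyperboloidal

/-! ### Calculus with the coordinate derivatives -/

section Calculus

variable {f g : Spacetime → ℝ} {p : Spacetime} {n : ℕ} (i j : Fin 3)

theorem dt_add (hf : DifferentiableAt ℝ f p) (hg : DifferentiableAt ℝ g p) :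
    dt (fun q => f q + g q) p = dt f p + dt g p := by
  simp only [dt]; rw [fderiv_fun_add hf hg]; rfl

theorem dx_add (hf : DifferentiableAt ℝ f p) (hg : DifferentiableAt ℝ g p) :
    dx i (fun q => f q + g q) p = dx i f p + dx i g p := by
  simp only [dx]; rw [fderiv_fun_add hf hg]; rfl

theorem dt_sub (hf : DifferentiableAt ℝ f p) (hg : DifferentiableAt ℝ g p) :
    dt (fun q => f q - g q) p = dt f p - dt g p := by
  simp only [dt]; rw [fderiv_fun_sub hf hg]; rfl

theorem dx_sub (hf : DifferentiableAt ℝ f p) (hg : DifferentiableAt ℝ g p) :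
    dx i (fun q => f q - g q) p = dx i f p - dx i g p := by
  simp only [dx]; rw [fderiv_fun_sub hf hg]; rfl

theorem dt_mul (hf : DifferentiableAt ℝ f p) (hg : DifferentiableAt ℝ g p) :
    dt (fun q => f q * g q) p = dt f p * g p + f p * dt g p := by
  simp only [dt]; rw [fderiv_fun_mul hf hg]; simp; ring

theorem dx_mul (hf : DifferentiableAt ℝ f p) (hg : DifferentiableAt ℝ g p) :
    dx i (fun q => f q * g q) p = dx i f p * g p + f p * dx i g p := by
  simp only [dx]; rw [fderiv_fun_mul hf hg]; simp; ring

theorem dt_sq (hf : DifferentiableAt ℝ f p) :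
    dt (fun q => f q ^ 2) p = 2 * f p * dt f p := by
  have : (fun q => f q ^ 2) = fun q => f q * f q := by ext; ring
  rw [this, dt_mul hf hf]; ring

theorem dx_sq (hf : DifferentiableAt ℝ f p) :
    dx i (fun q => f q ^ 2) p = 2 * f p * dx i f p := by
  have : (fun q => f q ^ 2) = fun q => f q * f q := by ext; ring
  rw [this, dx_mul i hf hf]; ring

@[simp] theorem dt_const (c : ℝ) : dt (fun _ => c) p = 0 := by simp [dt]

@[simp] theorem dx_const (c : ℝ) : dx i (fun _ => c) p = 0 := by simp [dx]

theorem hasFDerivAt_time : HasFDerivAt (fun q : Spacetime => q.1)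
    (ContinuousLinearMap.fst ℝ ℝ Space) p := hasFDerivAt_fst

theorem hasFDerivAt_coord : HasFDerivAt (fun q : Spacetime => q.2 j)
    ((EuclideanSpace.proj j).comp (ContinuousLinearMap.snd ℝ ℝ Space)) p :=
  ((EuclideanSpace.proj j : Space →L[ℝ] ℝ).comp
    (ContinuousLinearMap.snd ℝ ℝ Space)).hasFDerivAt

@[fun_prop] theorem contDiff_coord {m : WithTop ℕ∞} :
    ContDiff ℝ m (fun q : Spacetime => q.2 j) :=
  ((EuclideanSpace.proj j : Space →L[ℝ] ℝ).comp
    (ContinuousLinearMap.snd ℝ ℝ Space)).contDiff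

@[simp] theorem dt_time : dt (fun q => q.1) p = 1 := by
  simp [dt, hasFDerivAt_time.fderiv]

@[simp] theorem dx_time : dx i (fun q => q.1) p = 0 := by
  simp [dx, hasFDerivAt_time.fderiv]

@[simp] theorem dt_coord : dt (fun q => q.2 j) p = 0 := by
  simp [dt, (hasFDerivAt_coord j).fderiv]

@[simp] theorem dx_coord : dx i (fun q => q.2 j) p = if i = j then 1 else 0 := by
  simp [dx, (hasFDerivAt_coord j).fderiv, unitVec, PiLp.single_apply, eq_comm]

theorem dt_comp {h : ℝ → ℝ} {h' : ℝ} (hh : HasDerivAt h h' (f p)) (hf : DifferentiableAt ℝ f p) :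
    dt (fun q => h (f q)) p = h' * dt f p := by
  have := (hh.comp_hasFDerivAt p hf.hasFDerivAt).fderiv
  simp only [Function.comp_def] at this
  simp [dt, this]

theorem dx_comp {h : ℝ → ℝ} {h' : ℝ} (hh : HasDerivAt h h' (f p)) (hf : DifferentiableAt ℝ f p) :
    dx i (fun q => h (f q)) p = h' * dx i f p := by
  have := (hh.comp_hasFDerivAt p hf.hasFDerivAt).fderiv
  simp only [Function.comp_def] at this
  simp [dx, this]

theorem contDiff_dt (hf : ContDiff ℝ (n + 1 : ℕ) f) : ContDiff ℝ n (dt f) :=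
  (hf.fderiv_right (m := n) (by norm_cast)).clm_apply contDiff_const

theorem contDiff_dx (hf : ContDiff ℝ (n + 1 : ℕ) f) : ContDiff ℝ n (dx i f) :=
  (hf.fderiv_right (m := n) (by norm_cast)).clm_apply contDiff_const

theorem contDiffAt_dt (hf : ContDiffAt ℝ (n + 1 : ℕ) f p) : ContDiffAt ℝ n (dt f) p :=
  (hf.fderiv_right (m := n) (by norm_cast)).clm_apply contDiffAt_const

theorem contDiffAt_dx (hf : ContDiffAt ℝ (n + 1 : ℕ) f p) : ContDiffAt ℝ n (dx i f) p :=
  (hf.fderiv_right (m := n) (by norm_cast)).clm_apply contDiffAt_const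

theorem fderiv_fderiv_comm (hf : ContDiffAt ℝ 2 f p) (v w : Spacetime) :
    fderiv ℝ (fun q => fderiv ℝ f q v) p w = fderiv ℝ (fun q => fderiv ℝ f q w) p v := by
  have h1 : DifferentiableAt ℝ (fderiv ℝ f) p :=
    (hf.fderiv_right (m := 1) (by norm_num)).differentiableAt (by norm_num)
  have h2 := (hf.isSymmSndFDerivAt (by simp)).eq v w
  have e : ∀ z w, fderiv ℝ (fun q => fderiv ℝ f q z) p w = fderiv ℝ (fderiv ℝ f) p w z := by
    intro z w
    rw [fderiv_clm_apply h1 (differentiableAt_const z)]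
    simp
  rw [e, e, h2]

theorem dx_dt_comm (hf : ContDiffAt ℝ 2 f p) : dx i (dt f) p = dt (dx i f) p :=
  fderiv_fderiv_comm hf _ _

theorem dx_dx_comm (hf : ContDiffAt ℝ 2 f p) : dx i (dx j f) p = dx j (dx i f) p :=
  fderiv_fderiv_comm hf _ _

theorem hasCompactSupport_dt (hf : HasCompactSupport f) : HasCompactSupport (dt f) :=
  hf.fderiv_apply ℝ _

theorem hasCompactSupport_dx (hf : HasCompactSupport f) : HasCompactSupport (dx i f) :=
  hf.fderiv_apply ℝ _

theorem tsupport_dt_subset : tsupport (dt f) ⊆ tsupport f := tsupport_fderiv_apply_subset ℝ _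

theorem tsupport_dx_subset : tsupport (dx i f) ⊆ tsupport f := tsupport_fderiv_apply_subset ℝ _

theorem fderiv_apply_eq (v : Spacetime) :
    fderiv ℝ f p v = v.1 * dt f p + ∑ i, v.2 i * dx i f p := by
  have hv : v = v.1 • ((1, 0) : Spacetime) + ∑ i, v.2 i • ((0, unitVec i) : Spacetime) := by
    refine Prod.ext ?_ ?_
    · simp [Prod.fst_sum]
    · ext j
      simp [Prod.snd_sum, unitVec, Pi.single_apply]
  conv_lhs => rw [hv]
  simp only [map_add, map_smul, map_sum, smul_eq_mul, dt, dx]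

end Calculus

/-! ### Integration on `ℝ³` -/

section Space

/-- The partial derivative `∂_i` of a function on `ℝ³`. -/
def sd (i : Fin 3) (h : Space → ℝ) (x : Space) : ℝ := fderiv ℝ h x (unitVec i)

theorem norm_sq_eq_sum (x : Space) : ‖x‖ ^ 2 = x 0 ^ 2 + x 1 ^ 2 + x 2 ^ 2 := by
  rw [EuclideanSpace.real_norm_sq_eq, Fin.sum_univ_three]

variable {h : Space → ℝ} (i : Fin 3)

theorem dx_eq_sd {f : Spacetime → ℝ} {s : ℝ} {x : Space} (hf : DifferentiableAt ℝ f (s, x)) :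
    dx i f (s, x) = sd i (fun y => f (s, y)) x := by
  have h1 : HasFDerivAt (fun y : Space => ((s, y) : Spacetime))
    (ContinuousLinearMap.inr ℝ ℝ Space) x := hasFDerivAt_prodMk_right s x
  have := (HasFDerivAt.comp x (f := fun y : Space => ((s, y) : Spacetime)) hf.hasFDerivAt h1).fderiv
  simp only [Function.comp_def] at this
  simp [sd, dx, this]

theorem continuous_sd (hh : ContDiff ℝ 1 h) : Continuous (sd i h) :=
  (hh.continuous_fderiv (by norm_num)).clm_apply continuous_const

theorem hasCompactSupport_sd (hh : HasCompactSupport h) : HasCompactSupport (sd i h) :=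
  hh.fderiv_apply ℝ _

theorem integral_sd_eq_zero (h1 : ContDiff ℝ 1 h) (h2 : HasCompactSupport h) :
    ∫ x, sd i h x = 0 := by
  have i1 := (continuous_sd i h1).integrable_of_hasCompactSupport (μ := volume)
    (hasCompactSupport_sd i h2)
  unfold sd at i1 ⊢
  have := integral_mul_fderiv_eq_neg_fderiv_mul_of_integrable (μ := (volume : Measure Space))
    (f := fun _ : Space => (1 : ℝ)) (g := h) (v := unitVec i) (by simp)
    (by simpa using i1)
    (by simpa using h1.continuous.integrable_of_hasCompactSupport (μ := volume) h2)
    (by fun_prop) (fun x _ => h1.differentiable (by norm_num) x)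
  simpa using this

end Space

/-! ### Slices at constant first coordinate -/

section Slices

variable {f g : Spacetime → ℝ} (s : ℝ) (i : Fin 3)

theorem HasCompactSupport.slice {V : Type*} [Zero V] {f : Spacetime → V}
    (hf : HasCompactSupport f) (s : ℝ) :
    HasCompactSupport (fun x : Space => f (s, x)) := by
  refine HasCompactSupport.intro (hf.isCompact.image continuous_snd) (fun x hx => ?_)
  by_contra h
  exact hx ⟨(s, x), subset_tsupport _ h, rfl⟩

theorem integrable_slice (h1 : Continuous f) (h2 : HasCompactSupport f) :
    Integrable (fun x : Space => f (s, x)) :=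
  (h1.comp (by fun_prop : Continuous fun x : Space => (s, x))).integrable_of_hasCompactSupport
    (HasCompactSupport.slice h2 s)

theorem integral_dx_eq_zero (h1 : ContDiff ℝ 1 f) (h2 : HasCompactSupport f) :
    ∫ x, dx i f (s, x) = 0 := by
  simp only [fun x => dx_eq_sd (s := s) (x := x) i (h1.differentiable (by norm_num) _)]
  exact integral_sd_eq_zero i (h1.comp (by fun_prop : ContDiff ℝ 1 fun x : Space => (s, x)))
    (HasCompactSupport.slice h2 s)

theorem hasDerivAt_integral_slice (h1 : ContDiff ℝ 1 f) (h2 : HasCompactSupport f) :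
    HasDerivAt (fun s => ∫ x, f (s, x)) (∫ x, dt f (s, x)) s := by
  have hc : Continuous (dt f) := (contDiff_dt (n := 0) h1).continuous
  obtain ⟨M, hM⟩ := hc.bounded_above_of_compact_support (hasCompactSupport_dt h2)
  set K : Set Space := Prod.snd '' tsupport f with hK
  have hKc : IsCompact K := h2.isCompact.image continuous_snd
  have hz : ∀ s x, x ∉ K → dt f (s, x) = 0 := by
    intro s x hx
    by_contra h
    exact hx ⟨(s, x), tsupport_dt_subset (subset_tsupport _ h), rfl⟩
  refine (hasDerivAt_integral_of_dominated_loc_of_deriv_le (μ := volume)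
    (F := fun s x => f (s, x)) (F' := fun s x => dt f (s, x))
    (bound := K.indicator fun _ => M) (s := Set.univ) Filter.univ_mem ?_ ?_ ?_ ?_ ?_ ?_).2
  · exact Filter.Eventually.of_forall fun s =>
      (integrable_slice s h1.continuous h2).aestronglyMeasurable
  · exact integrable_slice s h1.continuous h2
  · exact (integrable_slice s hc (hasCompactSupport_dt h2)).aestronglyMeasurable
  · refine Filter.Eventually.of_forall fun x s _ => ?_
    by_cases hx : x ∈ K
    · simpa [hx] using hM (s, x)
    · simp [hx, hz s x hx]
  · exact (integrable_indicator_iff hKc.measurableSet).2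
      (integrableOn_const hKc.measure_lt_top.ne)
  · refine Filter.Eventually.of_forall fun x s _ => ?_
    have e : HasFDerivAt (fun s : ℝ => ((s, x) : Spacetime)) (ContinuousLinearMap.inl ℝ ℝ Space) s :=
      hasFDerivAt_prodMk_left s x
    have := (HasFDerivAt.comp s (f := fun s : ℝ => ((s, x) : Spacetime))
      (h1.differentiable (by norm_num) (s, x)).hasFDerivAt e).hasDerivAt
    simpa [dt, Function.comp_def] using this

theorem continuous_integral_slice (h1 : Continuous f) (h2 : HasCompactSupport f) :
    Continuous (fun s => ∫ x, f (s, x)) := by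
  have hKc : IsCompact (Prod.snd '' tsupport f) := h2.isCompact.image continuous_snd
  rw [← continuousOn_univ]
  refine continuousOn_integral_of_compact_support hKc (f := fun s x => f (s, x))
    (by simpa [Function.uncurry_def] using h1) ?_
  intro s x _ hx
  by_contra h
  exact hx ⟨(s, x), subset_tsupport _ h, rfl⟩

end Slices

/-! ### The Hardy inequality and a weighted Agmon inequality -/

section Sobolev

/-- The regularized distance `√(δ² + |x - x₀|²)`. -/
def regDist (δ : ℝ) (x₀ : Space) (q : Spacetime) : ℝ := Real.sqrt (δ ^ 2 + ‖q.2 - x₀‖ ^ 2)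

variable {f : Spacetime → ℝ} {δ : ℝ} (x₀ : Space) (i : Fin 3)

theorem regDist_pos (hδ : 0 < δ) (q : Spacetime) : 0 < regDist δ x₀ q := Real.sqrt_pos.2 (by positivity)

theorem regDist_sq (q : Spacetime) : regDist δ x₀ q ^ 2 = δ ^ 2 + ‖q.2 - x₀‖ ^ 2 :=
  Real.sq_sqrt (by positivity)

theorem contDiff_regDist (hδ : 0 < δ) {m : WithTop ℕ∞} : ContDiff ℝ m (regDist δ x₀) := by
  unfold regDist
  refine ContDiff.sqrt ?_ (fun q => by positivity)
  exact contDiff_const.add (ContDiff.norm_sq ℝ (contDiff_snd.sub contDiff_const))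

theorem dx_regDist (hδ : 0 < δ) (q : Spacetime) : dx i (regDist δ x₀) q = (q.2 i - x₀ i) / regDist δ x₀ q := by
  have h0 := regDist_pos x₀ hδ q
  have hd : DifferentiableAt ℝ (regDist δ x₀) q :=
    (contDiff_regDist x₀ hδ (m := 1)).differentiable (by norm_num) q
  have h1 := dx_sq i hd
  have h2 : (fun q => regDist δ x₀ q ^ 2) = fun q => δ ^ 2 +
      ((q.2 0 - x₀ 0) ^ 2 + (q.2 1 - x₀ 1) ^ 2 + (q.2 2 - x₀ 2) ^ 2) := by
    funext q; rw [regDist_sq, norm_sq_eq_sum]; simp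
  have h3 : dx i (fun q => regDist δ x₀ q ^ 2) q = 2 * (q.2 i - x₀ i) := by
    rw [h2]
    simp (disch := fun_prop) only [dx_add, dx_sq, dx_sub, dx_const, dx_coord]
    fin_cases i <;> simp
  rw [h3] at h1
  field_simp
  linarith

/-- The squared length of the gradient in `x`. -/
def gradSq (f : Spacetime → ℝ) (q : Spacetime) : ℝ := ∑ i, dx i f q ^ 2

theorem gradSq_nonneg (q : Spacetime) : 0 ≤ gradSq f q := Finset.sum_nonneg fun _ _ => sq_nonneg _

theorem continuous_gradSq (h1 : ContDiff ℝ 1 f) : Continuous (gradSq f) :=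
  continuous_finsetSum _ fun i _ => (contDiff_dx (n := 0) i h1).continuous.pow 2

theorem hasCompactSupport_gradSq (h2 : HasCompactSupport f) : HasCompactSupport (gradSq f) := by
  have e : gradSq f = fun q => dx 0 f q * dx 0 f q + dx 1 f q * dx 1 f q + dx 2 f q * dx 2 f q := by
    funext q; simp only [gradSq, Fin.sum_univ_three]; ring
  rw [e]
  exact (((hasCompactSupport_dx 0 h2).mul_left).add (hasCompactSupport_dx 1 h2).mul_left).add
    (hasCompactSupport_dx 2 h2).mul_left

theorem sum_mul_le (y z : Fin 3 → ℝ) (w : Space) (hy : ∀ i, y i = w i) :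
    (∑ i, y i * z i) ^ 2 ≤ ‖w‖ ^ 2 * ∑ i, z i ^ 2 := by
  have := Finset.sum_mul_sq_le_sq_mul_sq Finset.univ y z
  rwa [show ∑ i, y i ^ 2 = ‖w‖ ^ 2 by simp [EuclideanSpace.real_norm_sq_eq, hy]] at this

/-- With y = x - x₀ and ρ the regularized distance, 4|∂f|² + 2 div(f² y/ρ²) - f²/ρ² is nonnegative
pointwise by completing a square, and the divergence integrates to zero. The parameter δ removes the
singularity at x₀; the choice δ = s, x₀ = 0 turns ρ into t. -/
theorem hardy (hδ : 0 < δ) (h1 : ContDiff ℝ 1 f) (h2 : HasCompactSupport f) (s : ℝ) :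
    ∫ x, f (s, x) ^ 2 / regDist δ x₀ (s, x) ^ 2 ≤ 4 * ∫ x, gradSq f (s, x) := by
  set ρ := regDist δ x₀ with hρ
  have hρ0 : ∀ q, 0 < ρ q := regDist_pos x₀ hδ
  have hρc : ContDiff ℝ 1 ρ := contDiff_regDist x₀ hδ
  have hfc := h1.continuous
  have hne : ∀ q, ρ q ≠ 0 := fun q => (hρ0 q).ne'
  set k : Fin 3 → Spacetime → ℝ := fun i q => f q * (f q * ((q.2 i - x₀ i) * (ρ q ^ 2)⁻¹)) with hk
  have hkc : ∀ i, ContDiff ℝ 1 (k i) := fun i => h1.mul (h1.mul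
    ((ContDiff.sub (contDiff_coord i) contDiff_const).mul ((hρc.pow 2).inv (by simp [hne]))))
  have hks : ∀ i, HasCompactSupport (k i) := fun i => h2.mul_right
  have hdk : ∀ i q, dx i (k i) q = 2 * f q * dx i f q * (q.2 i - x₀ i) / ρ q ^ 2
      + f q ^ 2 * (1 / ρ q ^ 2 - 2 * (q.2 i - x₀ i) ^ 2 / ρ q ^ 4) := by
    intro i q
    have d1 : DifferentiableAt ℝ f q := h1.differentiable (by norm_num) q
    have d2 : DifferentiableAt ℝ ρ q := hρc.differentiable (by norm_num) q
    have d3 : dx i (fun q => (ρ q ^ 2)⁻¹) q = - 2 * (q.2 i - x₀ i) / ρ q ^ 4 := by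
      rw [dx_comp i (h := fun y => (y ^ 2)⁻¹) (h' := -(2 * ρ q) / (ρ q ^ 2) ^ 2) _ d2,
        dx_regDist x₀ i hδ, ← hρ]
      · have := hne q
        field_simp
      · simpa [Pi.inv_def] using (hasDerivAt_pow 2 (ρ q)).fun_inv (by simp [hne])
    have d4 : DifferentiableAt ℝ (fun q => (ρ q ^ 2)⁻¹) q :=
      (d2.pow 2).inv (by simp [hne])
    simp only [hk]
    rw [dx_mul i d1 (by fun_prop), dx_mul i d1 (by fun_prop), dx_mul i (by fun_prop) d4, d3]
    simp (disch := fun_prop) only [dx_sub, dx_const, dx_coord]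
    have := hne q
    simp
    field_simp
    ring
  have key : ∀ q, f q ^ 2 / ρ q ^ 2 ≤ 4 * gradSq f q + 2 * ∑ i, dx i (k i) q := by
    intro q
    have hpos := hρ0 q
    have hsq : ρ q ^ 2 = δ ^ 2 + ‖q.2 - x₀‖ ^ 2 := regDist_sq x₀ q
    have hn := norm_sq_eq_sum (q.2 - x₀)
    have hcs := sum_mul_le (fun i => q.2 i - x₀ i) (fun i => dx i f q) (q.2 - x₀) (by simp)
    change _ ≤ _ * gradSq f q at hcs
    have hg := gradSq_nonneg (f := f) q
    simp only [PiLp.sub_apply] at hn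
    simp only [hdk, Fin.sum_univ_three] at hcs ⊢
    set A := (q.2 0 - x₀ 0) * dx 0 f q + (q.2 1 - x₀ 1) * dx 1 f q + (q.2 2 - x₀ 2) * dx 2 f q
    set G := gradSq f q
    set R := ρ q
    set N := ‖q.2 - x₀‖ ^ 2
    have e : 4 * G + 2 * ((2 * f q * dx 0 f q * (q.2 0 - x₀ 0) / R ^ 2
      + f q ^ 2 * (1 / R ^ 2 - 2 * (q.2 0 - x₀ 0) ^ 2 / R ^ 4)) +
      (2 * f q * dx 1 f q * (q.2 1 - x₀ 1) / R ^ 2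
      + f q ^ 2 * (1 / R ^ 2 - 2 * (q.2 1 - x₀ 1) ^ 2 / R ^ 4)) +
      (2 * f q * dx 2 f q * (q.2 2 - x₀ 2) / R ^ 2
      + f q ^ 2 * (1 / R ^ 2 - 2 * (q.2 2 - x₀ 2) ^ 2 / R ^ 4))) - f q ^ 2 / R ^ 2
      = (4 * G * R ^ 4 + 4 * f q * A * R ^ 2 + f q ^ 2 * (5 * R ^ 2 - 4 * N)) / R ^ 4 := by
      rw [hn]
      field_simp
      ring
    have hN : N ≤ R ^ 2 := by rw [hsq]; nlinarith [sq_nonneg δ]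
    have h5 : A ^ 2 ≤ R ^ 2 * G := hcs.trans (mul_le_mul_of_nonneg_right hN hg)
    have : 0 ≤ 4 * G * R ^ 4 + 4 * f q * A * R ^ 2 + f q ^ 2 * (5 * R ^ 2 - 4 * N) := by
      -- Since N ≤ R², the factor 5R² - 4N is at least R²; what then remains is exactly this square
      -- plus a Cauchy–Schwarz defect.
      have h6 : 0 ≤ R ^ 2 * (4 * (R ^ 2 * G - A ^ 2) + (2 * A + f q) ^ 2) := by
        have : 0 ≤ R ^ 2 * G - A ^ 2 := by linarith
        positivity
      have h7 : 0 ≤ f q ^ 2 * (R ^ 2 - N) := mul_nonneg (sq_nonneg _) (by linarith)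
      nlinarith
    have : 0 ≤ (4 * G * R ^ 4 + 4 * f q * A * R ^ 2 + f q ^ 2 * (5 * R ^ 2 - 4 * N)) / R ^ 4 := by
      positivity
    linarith
  have i1 := integrable_slice s (continuous_gradSq h1) (hasCompactSupport_gradSq h2)
  have i2 : ∀ i, Integrable fun x => dx i (k i) (s, x) := fun i =>
    integrable_slice s (contDiff_dx (n := 0) i (hkc i)).continuous (hasCompactSupport_dx i (hks i))
  calc ∫ x, f (s, x) ^ 2 / ρ (s, x) ^ 2
      ≤ ∫ x, (4 * gradSq f (s, x) + 2 * ∑ i, dx i (k i) (s, x)) := by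
        refine integral_mono ?_ ((i1.const_mul 4).add
          ((integrable_finsetSum _ fun i _ => i2 i).const_mul 2)) fun x => key _
        exact integrable_slice s (f := fun q => f q ^ 2 / ρ q ^ 2)
          ((hfc.pow 2).div (hρc.continuous.pow 2) (by simp [hne]))
          (by
            have : (fun q => f q ^ 2 / ρ q ^ 2) = fun q => f q * (f q / ρ q ^ 2) := by
              funext q; ring
            rw [this]
            exact h2.mul_right)
    _ = 4 * ∫ x, gradSq f (s, x) := by
        rw [integral_add (i1.const_mul 4) ((integrable_finsetSum _ fun i _ => i2 i).const_mul 2),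
          integral_const_mul, integral_const_mul, integral_finsetSum _ fun i _ => i2 i]
        simp [integral_dx_eq_zero s _ (hkc _) (hks _)]

/-- The time `√(s² + |x|²)` of the point of `H_s` above `x`. -/
def hypTime (q : Spacetime) : ℝ := Real.sqrt (q.1 ^ 2 + ‖q.2‖ ^ 2)

theorem hypTime_sq (q : Spacetime) : hypTime q ^ 2 = q.1 ^ 2 + ‖q.2‖ ^ 2 :=
  Real.sq_sqrt (by positivity)

theorem hypTime_pos {q : Spacetime} (hq : q.1 ≠ 0) : 0 < hypTime q := Real.sqrt_pos.2 (by positivity)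

theorem continuous_hypTime : Continuous hypTime := by unfold hypTime; fun_prop

theorem contDiffAt_hypTime {m : WithTop ℕ∞} {q : Spacetime} (hq : q.1 ≠ 0) :
    ContDiffAt ℝ m hypTime q := by
  unfold hypTime
  refine ContDiffAt.sqrt (ContDiffAt.add (contDiff_fst.contDiffAt.pow 2)
    (ContDiffAt.norm_sq ℝ contDiff_snd.contDiffAt)) (by positivity)

theorem dx_hypTime {q : Spacetime} (hq : q.1 ≠ 0) : dx i hypTime q = q.2 i / hypTime q := by
  have h0 := hypTime_pos hq
  have h1 := dx_sq i ((contDiffAt_hypTime (m := 1) hq).differentiableAt (by norm_num))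
  have h2 : (fun q => hypTime q ^ 2) = fun q => q.1 ^ 2 + (q.2 0 ^ 2 + q.2 1 ^ 2 + q.2 2 ^ 2) := by
    funext q; rw [hypTime_sq, norm_sq_eq_sum]
  have h3 : dx i (fun q => hypTime q ^ 2) q = 2 * q.2 i := by
    rw [h2]
    simp (disch := fun_prop) only [dx_add, dx_sq, dx_time, dx_coord]
    fin_cases i <;> simp
  rw [h3] at h1
  field_simp
  linarith

theorem dt_hypTime {q : Spacetime} (hq : q.1 ≠ 0) : dt hypTime q = q.1 / hypTime q := by
  have h0 := hypTime_pos hq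
  have h1 := dt_sq ((contDiffAt_hypTime (m := 1) hq).differentiableAt (by norm_num))
  have h2 : (fun q => hypTime q ^ 2) = fun q => q.1 ^ 2 + (q.2 0 ^ 2 + q.2 1 ^ 2 + q.2 2 ^ 2) := by
    funext q; rw [hypTime_sq, norm_sq_eq_sum]
  have h3 : dt (fun q => hypTime q ^ 2) q = 2 * q.1 := by
    rw [h2]
    simp (disch := fun_prop) only [dt_add, dt_sq, dt_time, dt_coord]
    simp
  rw [h3] at h1
  field_simp
  linarith

theorem contDiff_of_tsupport {m : WithTop ℕ∞} {g : Spacetime → ℝ}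
    (h : ∀ q ∈ tsupport g, ContDiffAt ℝ m g q) : ContDiff ℝ m g := by
  refine contDiff_iff_contDiffAt.2 fun q => ?_
  by_cases hq : q ∈ tsupport g
  · exact h q hq
  · exact contDiffAt_const.congr_of_eventuallyEq (notMem_tsupport_iff_eventuallyEq.1 hq)

/-- Multiplying by a function that is smooth off the locus `s = 0` keeps a function that is
supported away from this locus smooth. -/
theorem ContDiff.mul_of_tsupport {m : WithTop ℕ∞} {w g : Spacetime → ℝ}
    (hw : ∀ q : Spacetime, q.1 ≠ 0 → ContDiffAt ℝ m w q) (hg : ContDiff ℝ m g)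
    (hs : ∀ q ∈ tsupport g, q.1 ≠ 0) : ContDiff ℝ m (fun q => w q * g q) := by
  refine contDiff_of_tsupport fun q hq => ?_
  exact (hw q (hs q (tsupport_mul_subset_right hq))).mul hg.contDiffAt

/-- The kernel 3δ²/ρ⁵ is the divergence of (x - x₀)/ρ³ and approximates a multiple of the Dirac mass
at x₀. Integration by parts moves the derivative to t f², whose gradient f·((x/t) f + 2t ∂f) costs
only f²/ρ² and (t ∂_j f)²/ρ². Both are covered by `hardy`, whose factor 4 produces the constants 12
and 4. -/
theorem agmon_kernel_integral (hδ : 0 < δ) (h1 : ContDiff ℝ 2 f) (h2 : HasCompactSupport f)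
    (hs : ∀ q ∈ tsupport f, q.1 ≠ 0) {s : ℝ} (hs0 : 0 < s) :
    ∫ x, hypTime (s, x) * f (s, x) ^ 2 * (3 * δ ^ 2 / regDist δ x₀ (s, x) ^ 5) ≤
      12 * (∫ x, gradSq f (s, x))
        + 4 * ∑ j, ∫ x, gradSq (fun q => hypTime q * dx j f q) (s, x) := by
  set ρ := regDist δ x₀ with hρ
  have hρ0 : ∀ q, 0 < ρ q := regDist_pos x₀ hδ
  have hρc : ContDiff ℝ 1 ρ := contDiff_regDist x₀ hδ
  have hne : ∀ q, ρ q ≠ 0 := fun q => (hρ0 q).ne'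
  have hf1 : ContDiff ℝ 1 f := h1.of_le (by norm_num)
  have hfc := h1.continuous
  set k : Fin 3 → Spacetime → ℝ :=
    fun i q => (hypTime q * f q) * (f q * ((q.2 i - x₀ i) * (ρ q ^ 3)⁻¹)) with hk
  have htf : ContDiff ℝ 1 fun q => hypTime q * f q :=
    ContDiff.mul_of_tsupport (fun q hq => contDiffAt_hypTime hq) hf1 hs
  have hkc : ∀ i, ContDiff ℝ 1 (k i) := fun i => htf.mul (hf1.mul
    ((ContDiff.sub (contDiff_coord i) contDiff_const).mul ((hρc.pow 3).inv (by simp [hne]))))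
  have hks : ∀ i, HasCompactSupport (k i) := fun i => h2.mul_left.mul_right
  have hdk : ∀ i q, q.1 = s → dx i (k i) q =
      (q.2 i / hypTime q * f q ^ 2 + hypTime q * 2 * f q * dx i f q) * (q.2 i - x₀ i) / ρ q ^ 3
      + hypTime q * f q ^ 2 * (1 / ρ q ^ 3 - 3 * (q.2 i - x₀ i) ^ 2 / ρ q ^ 5) := by
    intro i q hq
    have hq0 : q.1 ≠ 0 := by rw [hq]; exact hs0.ne'
    have d1 : DifferentiableAt ℝ f q := hf1.differentiable (by norm_num) q
    have d2 : DifferentiableAt ℝ ρ q := hρc.differentiable (by norm_num) q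
    have d5 : DifferentiableAt ℝ hypTime q :=
      (contDiffAt_hypTime (m := 1) hq0).differentiableAt (by norm_num)
    have d3 : dx i (fun q => (ρ q ^ 3)⁻¹) q = - 3 * (q.2 i - x₀ i) / ρ q ^ 5 := by
      rw [dx_comp i (h := fun y => (y ^ 3)⁻¹) (h' := -(3 * ρ q ^ 2) / (ρ q ^ 3) ^ 2) _ d2,
        dx_regDist x₀ i hδ, ← hρ]
      · have := hne q
        field_simp
      · simpa [Pi.inv_def] using (hasDerivAt_pow 3 (ρ q)).fun_inv (by simp [hne])
    have d4 : DifferentiableAt ℝ (fun q => (ρ q ^ 3)⁻¹) q :=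
      (d2.pow 3).inv (by simp [hne])
    simp only [hk]
    rw [dx_mul i (by fun_prop) (by fun_prop), dx_mul i d5 d1, dx_mul i d1 (by fun_prop),
      dx_mul i (by fun_prop) d4, d3, dx_hypTime i hq0]
    simp (disch := fun_prop) only [dx_sub, dx_const, dx_coord]
    have := hne q
    have := (hypTime_pos hq0).ne'
    simp
    field_simp
    ring
  have key : ∀ q, q.1 = s → hypTime q * f q ^ 2 * (3 * δ ^ 2 / ρ q ^ 5) ≤
      3 * (f q ^ 2 / ρ q ^ 2) + ∑ j, (hypTime q * dx j f q) ^ 2 / ρ q ^ 2 + ∑ i, dx i (k i) q := by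
    intro q hq
    have hq0 : q.1 ≠ 0 := by rw [hq]; exact hs0.ne'
    have hpos := hρ0 q
    have hT := hypTime_pos hq0
    have hsq : ρ q ^ 2 = δ ^ 2 + ‖q.2 - x₀‖ ^ 2 := regDist_sq x₀ q
    have hn := norm_sq_eq_sum (q.2 - x₀)
    have hcs := sum_mul_le (fun i => q.2 i - x₀ i)
      (fun i => q.2 i / hypTime q * f q + 2 * (hypTime q * dx i f q)) (q.2 - x₀) (by simp)
    have hT2 : q.2 0 ^ 2 + q.2 1 ^ 2 + q.2 2 ^ 2 ≤ hypTime q ^ 2 := by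
      rw [hypTime_sq, norm_sq_eq_sum]; nlinarith [sq_nonneg q.1]
    simp only [PiLp.sub_apply] at hn
    set B := ∑ i, (q.2 i - x₀ i) * (q.2 i / hypTime q * f q + 2 * (hypTime q * dx i f q)) with hB
    set S := ∑ j, (hypTime q * dx j f q) ^ 2 with hS
    have hV : ∑ i, (q.2 i / hypTime q * f q + 2 * (hypTime q * dx i f q)) ^ 2
        ≤ 2 * f q ^ 2 + 8 * S := by
      have e1 : ∑ i, (q.2 i / hypTime q * f q) ^ 2 ≤ f q ^ 2 := by
        have : ∑ i, (q.2 i / hypTime q * f q) ^ 2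
            = f q ^ 2 * ((q.2 0 ^ 2 + q.2 1 ^ 2 + q.2 2 ^ 2) / hypTime q ^ 2) := by
          rw [Fin.sum_univ_three]; field_simp
        rw [this]
        exact mul_le_of_le_one_right (sq_nonneg _) ((div_le_one (by positivity)).2 hT2)
      have e2 : ∑ i, (q.2 i / hypTime q * f q + 2 * (hypTime q * dx i f q)) ^ 2
          ≤ ∑ i, (2 * (q.2 i / hypTime q * f q) ^ 2 + 8 * (hypTime q * dx i f q) ^ 2) :=
        Finset.sum_le_sum fun i _ => by
          nlinarith [sq_nonneg (q.2 i / hypTime q * f q - 2 * (hypTime q * dx i f q))]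
      rw [Finset.sum_add_distrib, ← Finset.mul_sum, ← Finset.mul_sum] at e2
      linarith
    have hS0 : 0 ≤ S := Finset.sum_nonneg fun _ _ => sq_nonneg _
    have hB2 : B ^ 2 ≤ ρ q ^ 2 * (2 * f q ^ 2 + 8 * S) :=
      hcs.trans (mul_le_mul (by rw [hsq]; nlinarith [sq_nonneg δ]) hV
        (Finset.sum_nonneg fun _ _ => sq_nonneg _) (sq_nonneg _))
    have e : 3 * (f q ^ 2 / ρ q ^ 2) + ∑ j, (hypTime q * dx j f q) ^ 2 / ρ q ^ 2
        + ∑ i, dx i (k i) q - hypTime q * f q ^ 2 * (3 * δ ^ 2 / ρ q ^ 5)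
        = (3 * f q ^ 2 * ρ q ^ 2 + S * ρ q ^ 2 + f q * B * ρ q) / ρ q ^ 4 := by
      have hd2 : δ ^ 2 = ρ q ^ 2 - ((q.2 0 - x₀ 0) ^ 2 + (q.2 1 - x₀ 1) ^ 2 + (q.2 2 - x₀ 2) ^ 2) := by
        rw [← hn]; linarith
      simp only [hdk _ q hq, hB, hS, Fin.sum_univ_three]
      rw [hd2]
      field_simp
      ring
    -- The square gives f B ρ ≥ -B²/8 - 2f²ρ², and B²/8 ≤ ρ²(f²/4 + S); in total 9/4 of the
    -- available 3f²ρ² is used, and all of Sρ².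
    have : 0 ≤ 3 * f q ^ 2 * ρ q ^ 2 + S * ρ q ^ 2 + f q * B * ρ q := by
      nlinarith [sq_nonneg (B + 4 * (f q * ρ q)), mul_nonneg (sq_nonneg (f q)) (sq_nonneg (ρ q))]
    have : 0 ≤ (3 * f q ^ 2 * ρ q ^ 2 + S * ρ q ^ 2 + f q * B * ρ q) / ρ q ^ 4 := by positivity
    linarith
  have hgj : ∀ j, ContDiff ℝ 1 fun q => hypTime q * dx j f q := fun j =>
    ContDiff.mul_of_tsupport (fun q hq => contDiffAt_hypTime hq) (contDiff_dx (n := 1) j h1)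
      (fun q hq => hs q (tsupport_dx_subset j hq))
  have hsj : ∀ j, HasCompactSupport fun q => hypTime q * dx j f q := fun j =>
    (hasCompactSupport_dx j h2).mul_left
  have hint : ∀ g : Spacetime → ℝ, Continuous g → HasCompactSupport g →
      Integrable fun x => g (s, x) ^ 2 / ρ (s, x) ^ 2 := fun g hg hg2 =>
    integrable_slice s (f := fun q => g q ^ 2 / ρ q ^ 2)
      ((hg.pow 2).div (hρc.continuous.pow 2) (by simp [hne])) (by
        have : (fun q => g q ^ 2 / ρ q ^ 2) = fun q => g q * (g q / ρ q ^ 2) := by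
          funext q; ring
        rw [this]
        exact hg2.mul_right)
  have i1 := (hint f hfc h2).const_mul 3
  have i2 : Integrable fun x => ∑ j, (hypTime (s, x) * dx j f (s, x)) ^ 2 / ρ (s, x) ^ 2 :=
    integrable_finsetSum _ fun j _ => hint _ (hgj j).continuous (hsj j)
  have i3 : ∀ i, Integrable fun x => dx i (k i) (s, x) := fun i =>
    integrable_slice s (contDiff_dx (n := 0) i (hkc i)).continuous (hasCompactSupport_dx i (hks i))
  have i4 : Integrable fun x => ∑ i, dx i (k i) (s, x) := integrable_finsetSum _ fun i _ => i3 i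
  calc ∫ x, hypTime (s, x) * f (s, x) ^ 2 * (3 * δ ^ 2 / ρ (s, x) ^ 5)
      ≤ ∫ x, (3 * (f (s, x) ^ 2 / ρ (s, x) ^ 2)
          + ∑ j, (hypTime (s, x) * dx j f (s, x)) ^ 2 / ρ (s, x) ^ 2
          + ∑ i, dx i (k i) (s, x)) := by
        refine integral_mono ?_ ((i1.add i2).add i4) fun x => key _ rfl
        refine integrable_slice s (f := fun q => hypTime q * f q ^ 2 * (3 * δ ^ 2 / ρ q ^ 5)) ?_ ?_
        · exact (continuous_hypTime.mul (hfc.pow 2)).mul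
            (continuous_const.div (hρc.continuous.pow 5) (by simp [hne]))
        · have : (fun q => hypTime q * f q ^ 2 * (3 * δ ^ 2 / ρ q ^ 5))
              = fun q => f q * (f q * hypTime q * (3 * δ ^ 2 / ρ q ^ 5)) := by funext q; ring
          rw [this]
          exact h2.mul_right
    _ = 3 * (∫ x, f (s, x) ^ 2 / ρ (s, x) ^ 2)
        + ∑ j, ∫ x, (hypTime (s, x) * dx j f (s, x)) ^ 2 / ρ (s, x) ^ 2 := by
        have i12 := i1.add i2
        simp only [Pi.add_def] at i12
        rw [integral_add i12 i4, integral_add i1 i2, integral_const_mul,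
          integral_finsetSum _ fun i _ => i3 i,
          integral_finsetSum _ fun j _ => hint _ (hgj j).continuous (hsj j)]
        simp [integral_dx_eq_zero s _ (hkc _) (hks _)]
    _ ≤ 12 * (∫ x, gradSq f (s, x))
        + 4 * ∑ j, ∫ x, gradSq (fun q => hypTime q * dx j f q) (s, x) := by
        have a1 := hardy x₀ hδ hf1 h2 s
        have a2 : ∑ j, ∫ x, (hypTime (s, x) * dx j f (s, x)) ^ 2 / ρ (s, x) ^ 2 ≤
            ∑ j, 4 * ∫ x, gradSq (fun q => hypTime q * dx j f q) (s, x) :=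
          Finset.sum_le_sum fun j _ => hardy x₀ hδ (hgj j) (hsj j) s
        rw [← Finset.mul_sum] at a2
        linarith

/-- By continuity t f² stays above half of its value at x₀ on a ball of some radius δ. On that ball
the kernel of `agmon_kernel_integral` is at least 1/(2δ³), which compensates the volume 4πδ³/3, so
the bound is independent of δ. -/
theorem agmon (h1 : ContDiff ℝ 2 f) (h2 : HasCompactSupport f)
    (hs : ∀ q ∈ tsupport f, q.1 ≠ 0) {s : ℝ} (hs0 : 0 < s) :
    hypTime (s, x₀) * f (s, x₀) ^ 2 ≤
      256 * ((∫ x, gradSq f (s, x)) + ∑ j, ∫ x, gradSq (fun q => hypTime q * dx j f q) (s, x)) := by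
  set v : Space → ℝ := fun x => hypTime (s, x) * f (s, x) ^ 2 with hv
  have hvc : Continuous v :=
    ((continuous_hypTime.mul (h1.continuous.pow 2)).comp (by fun_prop : Continuous fun x => (s, x)))
  have hv0 : ∀ x, 0 ≤ v x := fun x => mul_nonneg (Real.sqrt_nonneg _) (sq_nonneg _)
  set Q := (∫ x, gradSq f (s, x)) + ∑ j, ∫ x, gradSq (fun q => hypTime q * dx j f q) (s, x) with hQ
  have hQ0 : 0 ≤ Q := add_nonneg (integral_nonneg fun x => gradSq_nonneg _)
    (Finset.sum_nonneg fun j _ => integral_nonneg fun x => gradSq_nonneg _)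
  change v x₀ ≤ _
  by_cases hx : v x₀ = 0
  · rw [hx]; positivity
  have hpos : 0 < v x₀ := lt_of_le_of_ne (hv0 _) (Ne.symm hx)
  obtain ⟨δ, hδ, hball⟩ := Metric.mem_nhds_iff.1
    ((hvc.tendsto x₀).eventually (lt_mem_nhds (half_lt_self hpos)))
  have hk := agmon_kernel_integral x₀ hδ h1 h2 hs hs0
  have hQle : 12 * (∫ x, gradSq f (s, x))
        + 4 * ∑ j, ∫ x, gradSq (fun q => hypTime q * dx j f q) (s, x) ≤ 12 * Q := by
    have : 0 ≤ ∑ j, ∫ x, gradSq (fun q => hypTime q * dx j f q) (s, x) :=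
      Finset.sum_nonneg fun j _ => integral_nonneg fun x => gradSq_nonneg _
    rw [hQ]; linarith
  set w : Space → ℝ := fun x => v x * (3 * δ ^ 2 / regDist δ x₀ (s, x) ^ 5) with hw
  have hw0 : ∀ x, 0 ≤ w x := fun x => mul_nonneg (hv0 x)
    (div_nonneg (by positivity) (pow_nonneg (regDist_pos x₀ hδ _).le _))
  have hwi : Integrable w := by
    refine integrable_slice s
      (f := fun q => hypTime q * f q ^ 2 * (3 * δ ^ 2 / regDist δ x₀ q ^ 5)) ?_ ?_
    · exact (continuous_hypTime.mul (h1.continuous.pow 2)).mul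
        (continuous_const.div ((contDiff_regDist x₀ hδ (m := 1)).continuous.pow 5)
          fun q => pow_ne_zero _ (regDist_pos x₀ hδ q).ne')
    · have : (fun q => hypTime q * f q ^ 2 * (3 * δ ^ 2 / regDist δ x₀ q ^ 5))
          = fun q => f q * (f q * hypTime q * (3 * δ ^ 2 / regDist δ x₀ q ^ 5)) := by
        funext q; ring
      rw [this]
      exact h2.mul_right
  have hlow : ∀ x ∈ Metric.ball x₀ δ, v x₀ / 2 * (3 / (6 * δ ^ 3)) ≤ w x := by
    intro x hxb
    have hr0 := regDist_pos x₀ hδ (s, x)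
    have hr : regDist δ x₀ (s, x) ^ 2 ≤ 2 * δ ^ 2 := by
      rw [regDist_sq]
      have : ‖x - x₀‖ < δ := by rwa [mem_ball_iff_norm] at hxb
      nlinarith [norm_nonneg (x - x₀)]
    -- Here ρ ≤ √2 δ, and 2^{5/2} < 6; the comparison is made after squaring to keep integer powers.
    have hr5 : regDist δ x₀ (s, x) ^ 5 ≤ 6 * δ ^ 5 := by
      refine le_of_sq_le_sq ?_ (by positivity)
      calc (regDist δ x₀ (s, x) ^ 5) ^ 2 = (regDist δ x₀ (s, x) ^ 2) ^ 5 := by ring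
        _ ≤ (2 * δ ^ 2) ^ 5 := pow_le_pow_left₀ (sq_nonneg _) hr 5
        _ ≤ (6 * δ ^ 5) ^ 2 := by nlinarith [pow_pos hδ 10]
    have h3 : 3 / (6 * δ ^ 3) ≤ 3 * δ ^ 2 / regDist δ x₀ (s, x) ^ 5 := by
      rw [div_le_div_iff₀ (by positivity) (by positivity)]
      nlinarith [pow_pos hδ 3]
    exact mul_le_mul (hball hxb).le h3 (by positivity) (hv0 x)
  have hvol : (volume (Metric.ball x₀ δ)).toReal = δ ^ 3 * (Real.pi * 4 / 3) := by
    rw [EuclideanSpace.volume_ball_fin_three]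
    rw [ENNReal.toReal_mul, ENNReal.toReal_pow, ENNReal.toReal_ofReal hδ.le,
      ENNReal.toReal_ofReal (by positivity)]
  have hint : v x₀ / 2 * (3 / (6 * δ ^ 3)) * (δ ^ 3 * (Real.pi * 4 / 3)) ≤ ∫ x, w x := by
    calc v x₀ / 2 * (3 / (6 * δ ^ 3)) * (δ ^ 3 * (Real.pi * 4 / 3))
        = ∫ x in Metric.ball x₀ δ, v x₀ / 2 * (3 / (6 * δ ^ 3)) := by
          rw [setIntegral_const, measureReal_def, hvol, smul_eq_mul]; ring
      _ ≤ ∫ x in Metric.ball x₀ δ, w x :=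
          setIntegral_mono_on (integrableOn_const measure_ball_lt_top.ne)
            hwi.integrableOn measurableSet_ball hlow
      _ ≤ ∫ x, w x := setIntegral_le_integral hwi (Filter.Eventually.of_forall hw0)
  have e : v x₀ / 2 * (3 / (6 * δ ^ 3)) * (δ ^ 3 * (Real.pi * 4 / 3)) = v x₀ * (Real.pi / 3) := by
    field_simp; ring
  rw [e] at hint
  have hpi := Real.pi_gt_three
  nlinarith

end Sobolev

/-! ### The wave equation in the coordinates `(s, x)` and its energy identities -/

/-- `u` is a compactly supported solution of the wave equation with source `f`, written in the
hyperboloidal coordinates `(s, x)`. -/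
structure HypWave (u f : Spacetime → ℝ) : Prop where
  contDiff : ContDiff ℝ 2 u
  compact : HasCompactSupport u
  supp : ∀ q ∈ tsupport u, q.1 ≠ 0
  source_continuous : Continuous f
  source_compact : HasCompactSupport f
  wave : ∀ q : Spacetime, 0 < q.1 →
    -dt (dt u) q - 2 / q.1 * ∑ i, q.2 i * dx i (dt u) q + ∑ i, dx i (dx i u) q
      - 3 / q.1 * dt u q = f q

/-- The radial flux `s ∂_s u + 2 x · ∂̲ u + 2 u` of the conformal energy. -/
def conformalField (u : Spacetime → ℝ) (q : Spacetime) : ℝ :=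
  q.1 * dt u q + 2 * ∑ i, q.2 i * dx i u q + 2 * u q

/-- The weight `s^{4a} t^{-2a}`, comparable to `(t - r)^{2a}`. -/
def retardedWeight (a : ℝ) (q : Spacetime) : ℝ := q.1 ^ (4 * a) * hypTime q ^ (-(2 * a))

/-! ### Derivatives of the energy densities and of the weight. -/

section Derivatives

variable {u : Spacetime → ℝ} {q : Spacetime} (i : Fin 3)

theorem differentiable_dt (hu : ContDiff ℝ 2 u) : Differentiable ℝ (dt u) :=
  (contDiff_dt (n := 1) hu).differentiable (by norm_num)

theorem differentiable_dx (hu : ContDiff ℝ 2 u) : Differentiable ℝ (dx i u) :=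
  (contDiff_dx (n := 1) i hu).differentiable (by norm_num)

theorem gradSq_eq (u : Spacetime → ℝ) :
    gradSq u = fun q => dx 0 u q ^ 2 + dx 1 u q ^ 2 + dx 2 u q ^ 2 := by
  funext q; simp [gradSq, Fin.sum_univ_three]

theorem contDiff_gradSq (hu : ContDiff ℝ 2 u) : ContDiff ℝ 1 (gradSq u) := by
  rw [gradSq_eq]
  exact (((contDiff_dx (n := 1) 0 hu).pow 2).add ((contDiff_dx (n := 1) 1 hu).pow 2)).add
    ((contDiff_dx (n := 1) 2 hu).pow 2)

theorem dt_gradSq (hu : ContDiff ℝ 2 u) :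
    dt (gradSq u) q = 2 * (dx 0 u q * dx 0 (dt u) q + dx 1 u q * dx 1 (dt u) q
      + dx 2 u q * dx 2 (dt u) q) := by
  have h := fun i => (differentiable_dx i hu) q
  have h0 := h 0
  have h1 := h 1
  have h2 := h 2
  rw [gradSq_eq]
  simp (disch := fun_prop) only [dt_add, dt_sq]
  simp only [dx_dt_comm _ hu.contDiffAt]
  ring

theorem dx_gradSq (hu : ContDiff ℝ 2 u) :
    dx i (gradSq u) q = 2 * (dx 0 u q * dx i (dx 0 u) q + dx 1 u q * dx i (dx 1 u) q
      + dx 2 u q * dx i (dx 2 u) q) := by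
  have h := fun i => (differentiable_dx i hu) q
  have h0 := h 0
  have h1 := h 1
  have h2 := h 2
  rw [gradSq_eq]
  simp (disch := fun_prop) only [dx_add, dx_sq]
  ring

theorem conformalField_eq (u : Spacetime → ℝ) :
    conformalField u = fun q => q.1 * dt u q
      + 2 * (q.2 0 * dx 0 u q + q.2 1 * dx 1 u q + q.2 2 * dx 2 u q) + 2 * u q := by
  funext q; simp [conformalField, Fin.sum_univ_three]

theorem contDiff_conformalField (hu : ContDiff ℝ 2 u) : ContDiff ℝ 1 (conformalField u) := by
  rw [conformalField_eq]
  have h0 := contDiff_dt (n := 1) hu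
  have h1 := fun i => contDiff_dx (n := 1) i hu
  have h2 : ContDiff ℝ 1 u := hu.of_le (by norm_num)
  simp only [Nat.cast_one] at h0 h1
  have h10 := h1 0
  have h11 := h1 1
  have h12 := h1 2
  fun_prop

theorem hasCompactSupport_conformalField (hu : HasCompactSupport u) :
    HasCompactSupport (conformalField u) := by
  refine HasCompactSupport.of_support_subset_isCompact hu.isCompact fun q hq => ?_
  by_contra h
  refine hq ?_
  have h0 : u q = 0 := image_eq_zero_of_notMem_tsupport h
  have h1 : dt u q = 0 := image_eq_zero_of_notMem_tsupport fun h' => h (tsupport_dt_subset h')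
  have h2 : ∀ i, dx i u q = 0 := fun i =>
    image_eq_zero_of_notMem_tsupport fun h' => h (tsupport_dx_subset i h')
  simp [conformalField, h0, h1, h2]

theorem dt_conformalField (hu : ContDiff ℝ 2 u) :
    dt (conformalField u) q = 3 * dt u q + q.1 * dt (dt u) q
      + 2 * (q.2 0 * dx 0 (dt u) q + q.2 1 * dx 1 (dt u) q + q.2 2 * dx 2 (dt u) q) := by
  have h := fun i => (differentiable_dx i hu) q
  have h0 := h 0
  have h1 := h 1
  have h2 := h 2
  have ht := differentiable_dt hu q
  have hu1 : DifferentiableAt ℝ u q := hu.differentiable (by norm_num) q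
  rw [conformalField_eq]
  simp (disch := fun_prop) only [dt_add, dt_mul, dt_const, dt_coord, dt_time,
    dx_dt_comm _ hu.contDiffAt]
  ring

theorem dx_conformalField (hu : ContDiff ℝ 2 u) :
    dx i (conformalField u) q = q.1 * dx i (dt u) q + 4 * dx i u q
      + 2 * (q.2 0 * dx i (dx 0 u) q + q.2 1 * dx i (dx 1 u) q + q.2 2 * dx i (dx 2 u) q) := by
  have h := fun i => (differentiable_dx i hu) q
  have h0 := h 0
  have h1 := h 1
  have h2 := h 2
  have ht := differentiable_dt hu q
  have hu1 : DifferentiableAt ℝ u q := hu.differentiable (by norm_num) q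
  rw [conformalField_eq]
  simp (disch := fun_prop) only [dx_add, dx_mul, dx_const, dx_coord, dx_time]
  fin_cases i <;> simp <;> ring

variable {a : ℝ}

theorem contDiffAt_retardedWeight {m : WithTop ℕ∞} (hq : q.1 ≠ 0) :
    ContDiffAt ℝ m (retardedWeight a) q :=
  (contDiff_fst.contDiffAt.rpow_const_of_ne hq).mul
    ((contDiffAt_hypTime hq).rpow_const_of_ne (hypTime_pos hq).ne')

theorem dt_retardedWeight (hq : q.1 ≠ 0) :
    dt (retardedWeight a) q = retardedWeight a q * (4 * a / q.1 - 2 * a * q.1 / hypTime q ^ 2) := by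
  have hT := hypTime_pos hq
  have d1 : DifferentiableAt ℝ (fun q : Spacetime => q.1) q := by fun_prop
  have d2 : DifferentiableAt ℝ hypTime q :=
    (contDiffAt_hypTime (m := 1) hq).differentiableAt (by norm_num)
  unfold retardedWeight
  rw [dt_mul (d1.rpow_const (Or.inl hq)) (d2.rpow_const (Or.inl hT.ne')),
    dt_comp (h := fun y => y ^ (4 * a)) (Real.hasDerivAt_rpow_const (Or.inl hq)) d1,
    dt_comp (h := fun y => y ^ (-(2 * a))) (Real.hasDerivAt_rpow_const (Or.inl hT.ne')) d2,
    dt_hypTime hq, dt_time, Real.rpow_sub_one hq, Real.rpow_sub_one hT.ne']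
  field_simp
  ring

theorem dx_retardedWeight (hq : q.1 ≠ 0) :
    dx i (retardedWeight a) q = -(2 * a * retardedWeight a q * q.2 i / hypTime q ^ 2) := by
  have hT := hypTime_pos hq
  have d1 : DifferentiableAt ℝ (fun q : Spacetime => q.1) q := by fun_prop
  have d2 : DifferentiableAt ℝ hypTime q :=
    (contDiffAt_hypTime (m := 1) hq).differentiableAt (by norm_num)
  unfold retardedWeight
  rw [dx_mul i (d1.rpow_const (Or.inl hq)) (d2.rpow_const (Or.inl hT.ne')),
    dx_comp i (h := fun y => y ^ (4 * a)) (Real.hasDerivAt_rpow_const (Or.inl hq)) d1,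
    dx_comp i (h := fun y => y ^ (-(2 * a))) (Real.hasDerivAt_rpow_const (Or.inl hT.ne')) d2,
    dx_hypTime i hq, dx_time, Real.rpow_sub_one hT.ne']
  field_simp
  ring

end Derivatives

/-! ### The conformal and the weighted energy identities. -/

section Identities

variable {u f : Spacetime → ℝ} {a s : ℝ}

/-- The common pattern of the energy identities: the spatial fluxes `k i` have compact support and
disappear after integration in x, so only the remainder `r` is left. -/
theorem hasDerivAt_integral_of_divergence {e : Spacetime → ℝ} {k : Fin 3 → Spacetime → ℝ}
    {r : Space → ℝ} (he : ContDiff ℝ 1 e) (hes : HasCompactSupport e)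
    (hk : ∀ i, ContDiff ℝ 1 (k i)) (hks : ∀ i, HasCompactSupport (k i))
    (h : ∀ x, dt e (s, x) = ∑ i, dx i (k i) (s, x) + r x) :
    HasDerivAt (fun s => ∫ x, e (s, x)) (∫ x, r x) s := by
  convert! hasDerivAt_integral_slice s he hes using 1
  have i1 := integrable_slice s (contDiff_dt (n := 0) he).continuous (hasCompactSupport_dt hes)
  have i3 : ∀ i, Integrable fun x => dx i (k i) (s, x) := fun i =>
    integrable_slice s (contDiff_dx (n := 0) i (hk i)).continuous (hasCompactSupport_dx i (hks i))
  have e1 : r = fun x => dt e (s, x) - ∑ i, dx i (k i) (s, x) := by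
    funext x; rw [h]; ring
  rw [e1, integral_sub i1 (integrable_finsetSum _ fun i _ => i3 i),
    integral_finsetSum _ fun i _ => i3 i]
  simp [integral_dx_eq_zero s _ (hk _) (hks _)]

/-- The multiplier is 2sN. All quadratic terms free of f form the divergence of 2sN ∂_i u - 2s x_i
|∂u|², so the energy is conserved exactly when f = 0. -/
theorem hasDerivAt_conformalEnergy (h : HypWave u f) (hs : 0 < s) :
    HasDerivAt (fun s => ∫ x, (conformalField u (s, x) ^ 2 + s ^ 2 * gradSq u (s, x)))
      (∫ x, -(2 * s * (conformalField u (s, x) * f (s, x)))) s := by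
  have hu := h.contDiff
  have hN := contDiff_conformalField hu
  have hG := contDiff_gradSq hu
  have hNs := hasCompactSupport_conformalField h.compact
  have hGs := hasCompactSupport_gradSq h.compact
  have hD := fun i => contDiff_dx (n := 1) i hu
  simp only [Nat.cast_one] at hD
  refine hasDerivAt_integral_of_divergence
    (e := fun q => conformalField u q ^ 2 + q.1 ^ 2 * gradSq u q)
    (k := fun i q => q.1 * 2 * (conformalField u q * dx i u q) - q.1 * 2 * q.2 i * gradSq u q)
    (by fun_prop) ?_ (fun i => ?_) (fun i => ?_) fun x => ?_
  · simp only [pow_two]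
    exact hNs.mul_left.add hGs.mul_left
  · have := hD i
    fun_prop
  · exact (hNs.mul_right.mul_left).sub hGs.mul_left
  · set q : Spacetime := (s, x)
    have dN : DifferentiableAt ℝ (conformalField u) q := hN.differentiable (by norm_num) q
    have dG : DifferentiableAt ℝ (gradSq u) q := hG.differentiable (by norm_num) q
    have dD : ∀ i, DifferentiableAt ℝ (dx i u) q := fun i => differentiable_dx i hu q
    have d0 := dD 0
    have d1 := dD 1
    have d2 := dD 2
    have hw := h.wave q hs
    rw [Fin.sum_univ_three, Fin.sum_univ_three] at hw
    rw [Fin.sum_univ_three]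
    simp (disch := fun_prop) only [dt_add, dt_mul, dt_sq, dt_time, dx_sub, dx_mul, dx_time,
      dx_const, dx_coord, dt_gradSq hu, dx_gradSq _ hu, dt_conformalField hu,
      dx_conformalField _ hu]
    rw [dx_dx_comm 1 0 hu.contDiffAt, dx_dx_comm 2 0 hu.contDiffAt, dx_dx_comm 2 1 hu.contDiffAt]
    have hq : q.1 = s := rfl
    rw [hq] at hw ⊢
    rw [← hw]
    simp only [gradSq_eq]
    field_simp
    simp
    ring

/-- The multiplier is 2W ∂_s u, with flux 2W ∂_s u ∂_i u - (2/s) W x_i (∂_s u)². Every bulk term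
other than the source comes from differentiating W, hence carries a factor a. -/
theorem hasDerivAt_weightedEnergy (h : HypWave u f) (hs : 0 < s) :
    HasDerivAt (fun s => ∫ x, retardedWeight a (s, x) * (dt u (s, x) ^ 2 + gradSq u (s, x)))
      (∫ x, retardedWeight a (s, x) *
        (2 * a * s / hypTime (s, x) ^ 2 * dt u (s, x) ^ 2
          + (4 * a / s - 2 * a * s / hypTime (s, x) ^ 2) * gradSq u (s, x)
          + 4 * a / hypTime (s, x) ^ 2 * (dt u (s, x) * ∑ i, x i * dx i u (s, x))
          - 2 * (dt u (s, x) * f (s, x)))) s := by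
  have hu := h.contDiff
  have hT := contDiff_dt (n := 1) hu
  have hG := contDiff_gradSq hu
  have hTs := hasCompactSupport_dt h.compact
  have hGs := hasCompactSupport_gradSq h.compact
  have hD := fun i => contDiff_dx (n := 1) i hu
  simp only [Nat.cast_one] at hD hT
  have hsT : ∀ q ∈ tsupport (dt u), q.1 ≠ 0 := fun q hq => h.supp q (tsupport_dt_subset hq)
  have hsG : ∀ q ∈ tsupport (gradSq u), q.1 ≠ 0 := by
    intro q hq
    refine h.supp q (closure_minimal ?_ (isClosed_tsupport u) hq)
    intro p hp
    by_contra hn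
    exact hp (by simp [gradSq, fun i => image_eq_zero_of_notMem_tsupport
      fun h' => hn (tsupport_dx_subset (f := u) i h')])
  refine hasDerivAt_integral_of_divergence
    (e := fun q => retardedWeight a q * (dt u q ^ 2 + gradSq u q))
    (k := fun i q => (retardedWeight a q * 2) * (dt u q * dx i u q)
      - (retardedWeight a q * (2 / q.1) * q.2 i) * (dt u q * dt u q))
    ?_ ?_ (fun i => ?_) (fun i => ?_) fun x => ?_
  · refine ContDiff.mul_of_tsupport (fun q hq => contDiffAt_retardedWeight hq)
      (by fun_prop) fun q hq => ?_
    rcases tsupport_add _ _ hq with h' | h'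
    · simp only [pow_two] at h'
      exact hsT q (tsupport_mul_subset_left h')
    · exact hsG q h'
  · simp only [pow_two]
    exact (hTs.mul_left.add hGs).mul_left
  · have := hD i
    refine ContDiff.sub (ContDiff.mul_of_tsupport
      (fun q hq => (contDiffAt_retardedWeight hq).mul contDiffAt_const)
      (by fun_prop) fun q hq => hsT q (tsupport_mul_subset_left hq))
      (ContDiff.mul_of_tsupport (fun q hq => ((contDiffAt_retardedWeight hq).mul
        (contDiffAt_const.div contDiff_fst.contDiffAt hq)).mul (contDiff_coord i).contDiffAt)
      (by fun_prop) fun q hq => hsT q (tsupport_mul_subset_left hq))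
  · exact (hTs.mul_right.mul_left).sub hTs.mul_right.mul_left
  · have hs' : s ≠ 0 := hs.ne'
    set q : Spacetime := (s, x)
    have hq : q.1 = s := rfl
    have hx : x = q.2 := rfl
    have hq0 : q.1 ≠ 0 := hs.ne'
    have dW : DifferentiableAt ℝ (retardedWeight a) q :=
      (contDiffAt_retardedWeight (m := 1) hq0).differentiableAt (by norm_num)
    have dT : DifferentiableAt ℝ (dt u) q := differentiable_dt hu q
    have dG : DifferentiableAt ℝ (gradSq u) q := hG.differentiable (by norm_num) q
    have dD : ∀ i, DifferentiableAt ℝ (dx i u) q := fun i => differentiable_dx i hu q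
    have dI : DifferentiableAt ℝ (fun q : Spacetime => 2 / q.1) q := by
      fun_prop (disch := exact hq0)
    have eI : ∀ i, dx i (fun q : Spacetime => 2 / q.1) q = 0 := by
      intro i
      have := dx_comp (f := fun q : Spacetime => q.1) (p := q) i (h := fun y => 2 / y)
        ((hasDerivAt_const q.1 (2 : ℝ)).fun_div (hasDerivAt_id q.1) hq0) (by fun_prop)
      rw [this, dx_time, mul_zero]
    have d0 := dD 0
    have d1 := dD 1
    have d2 := dD 2
    have hw := h.wave q hs
    rw [Fin.sum_univ_three, Fin.sum_univ_three] at hw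
    rw [Fin.sum_univ_three, Fin.sum_univ_three]
    have hT2 : hypTime q ^ 2 = s ^ 2 + (q.2 0 ^ 2 + q.2 1 ^ 2 + q.2 2 ^ 2) := by
      rw [hypTime_sq, norm_sq_eq_sum]
    have hT0 : hypTime q ^ 2 ≠ 0 := pow_ne_zero _ (hypTime_pos hq0).ne'
    simp (disch := fun_prop) only [dt_add, dt_mul, dt_sq, dx_sub, dx_mul,
      dx_const, dx_coord, dt_gradSq hu, eI, dt_retardedWeight hq0, dx_retardedWeight _ hq0]
    rw [hq, hx] at *
    rw [← hw]
    simp only [gradSq_eq]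
    rw [hT2] at hT0 ⊢
    generalize retardedWeight a q = W
    simp only [↓reduceIte]
    field_simp
    ring

end Identities

/-! ### The weighted energy estimate in hyperboloidal coordinates -/

/-- Cauchy–Schwarz, from the discriminant of the nonnegative quadratic polynomial c ↦ ∫ (c f + g)².
-/
theorem abs_integral_mul_le_sqrt {f g : Space → ℝ} (hf : Integrable fun x => f x ^ 2)
    (hg : Integrable fun x => g x ^ 2) (hfg : Integrable fun x => f x * g x) :
    |∫ x, f x * g x| ≤ √(∫ x, f x ^ 2) * √(∫ x, g x ^ 2) := by
  have hf0 : 0 ≤ ∫ x, f x ^ 2 := integral_nonneg fun x => sq_nonneg _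
  have key : ∀ c : ℝ, 0 ≤ (∫ x, f x ^ 2) * (c * c) + (2 * ∫ x, f x * g x) * c
      + ∫ x, g x ^ 2 := by
    intro c
    have : ∫ x, (c * f x + g x) ^ 2 = (∫ x, f x ^ 2) * (c * c) + (2 * ∫ x, f x * g x) * c
        + ∫ x, g x ^ 2 := by
      have e : (fun x => (c * f x + g x) ^ 2)
          = fun x => (c * c * f x ^ 2 + 2 * c * (f x * g x)) + g x ^ 2 := by
        funext x; ring
      have i1 := (hf.const_mul (c * c)).add (hfg.const_mul (2 * c))
      simp only [Pi.add_def] at i1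
      rw [e, integral_add i1 hg, integral_add (hf.const_mul _) (hfg.const_mul _),
        integral_const_mul, integral_const_mul]
      ring
    rw [← this]
    exact integral_nonneg fun x => sq_nonneg _
  have := discrim_le_zero key
  rw [discrim] at this
  rw [← Real.sqrt_mul hf0]
  exact Real.abs_le_sqrt (by nlinarith)

theorem abs_integral_weight_mul_le_sqrt {w f g : Space → ℝ} (hw : ∀ x, 0 ≤ w x)
    (hf : Integrable fun x => w x * f x ^ 2) (hg : Integrable fun x => w x * g x ^ 2)
    (hfg : Integrable fun x => w x * (f x * g x)) :
    |∫ x, w x * (f x * g x)| ≤ √(∫ x, w x * f x ^ 2) * √(∫ x, w x * g x ^ 2) := by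
  have e1 : ∀ h : Space → ℝ, (fun x => w x * h x ^ 2) = fun x => (√(w x) * h x) ^ 2 := fun h => by
    funext x; rw [mul_pow, Real.sq_sqrt (hw x)]
  have e2 : (fun x => w x * (f x * g x)) = fun x => (√(w x) * f x) * (√(w x) * g x) := by
    funext x
    rw [mul_mul_mul_comm, Real.mul_self_sqrt (hw x)]
  rw [e1] at hf hg
  rw [e2] at hfg
  rw [e2, e1, e1]
  exact abs_integral_mul_le_sqrt hf hg hfg

/-- Formally (√H)' ≤ b. As H may vanish, √(H + ε²) minus the primitive of b is shown to be antitone,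
and ε is arbitrary. -/
theorem sqrt_le_sqrt_add_integral {H H' b : ℝ → ℝ} {s₀ s₁ : ℝ} (hs : s₀ ≤ s₁)
    (hH : ∀ s ∈ Set.Icc s₀ s₁, HasDerivAt H (H' s) s) (hH0 : ∀ s ∈ Set.Icc s₀ s₁, 0 ≤ H s)
    (hb : ContinuousOn b (Set.Icc s₀ s₁)) (hb0 : ∀ s ∈ Set.Icc s₀ s₁, 0 ≤ b s)
    (hle : ∀ s ∈ Set.Icc s₀ s₁, H' s ≤ 2 * b s * √(H s)) :
    √(H s₁) ≤ √(H s₀) + ∫ s in s₀..s₁, b s := by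
  refine le_of_forall_pos_le_add fun ε hε => ?_
  have hbi : ∀ s ∈ Set.Icc s₀ s₁, IntervalIntegrable b volume s₀ s := fun s h =>
    (hb.mono (by rw [Set.uIcc_of_le h.1]; exact Set.Icc_subset_Icc_right h.2)).intervalIntegrable
  have hpos : ∀ s ∈ Set.Icc s₀ s₁, 0 < H s + ε ^ 2 := fun s h => by
    have := hH0 s h
    positivity
  have hanti : AntitoneOn (fun s => √(H s + ε ^ 2) - ∫ r in s₀..s, b r) (Set.Icc s₀ s₁) := by
    refine antitoneOn_of_hasDerivWithinAt_nonpos (convex_Icc _ _)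
      (f' := fun s => H' s / (2 * √(H s + ε ^ 2)) - b s) ?_ ?_ ?_
    · refine ContinuousOn.sub (ContinuousOn.sqrt ?_) ?_
      · exact (fun s h => (hH s h).continuousAt.continuousWithinAt.add continuousWithinAt_const)
      · have := intervalIntegral.continuousOn_primitive_interval (μ := volume) (f := b)
          (a := s₀) (b := s₁) (by
            rw [Set.uIcc_of_le hs]; exact hb.integrableOn_Icc)
        rwa [Set.uIcc_of_le hs] at this
    · intro s h
      rw [interior_Icc] at h
      have h' := Set.Ioo_subset_Icc_self h
      refine (HasDerivAt.sub ?_ ?_).hasDerivWithinAt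
      · exact ((hH s h').add_const _).sqrt (hpos s h').ne'
      · exact intervalIntegral.integral_hasDerivAt_right (hbi s h')
          (ContinuousAt.stronglyMeasurableAtFilter isOpen_Ioo
            (fun r hr => hb.continuousAt (Icc_mem_nhds hr.1 hr.2)) s h)
          (hb.continuousAt (Icc_mem_nhds h.1 h.2))
    · intro s h
      rw [interior_Icc] at h
      have h' := Set.Ioo_subset_Icc_self h
      have hp := Real.sqrt_pos.2 (hpos s h')
      rw [sub_nonpos, div_le_iff₀ (by positivity)]
      have : √(H s) ≤ √(H s + ε ^ 2) := Real.sqrt_le_sqrt (by nlinarith [sq_nonneg ε])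
      have := mul_le_mul_of_nonneg_left this (mul_nonneg zero_le_two (hb0 s h'))
      linarith [hle s h']
  have h1 := hanti (Set.left_mem_Icc.2 hs) (Set.right_mem_Icc.2 hs) hs
  simp only [intervalIntegral.integral_same, sub_zero] at h1
  have h2 : √(H s₁) ≤ √(H s₁ + ε ^ 2) := Real.sqrt_le_sqrt (by nlinarith [sq_nonneg ε])
  have h3 : √(H s₀ + ε ^ 2) ≤ √(H s₀) + ε := by
    have h := hH0 s₀ (Set.left_mem_Icc.2 hs)
    refine Real.sqrt_le_iff.2 ⟨by positivity, ?_⟩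
    nlinarith [Real.sq_sqrt h, Real.sqrt_nonneg (H s₀)]
  linarith

/-- The energy `∫ |∂_s u|² + |∂̲ u|²` on the slice `s`. -/
def flatEnergy (u : Spacetime → ℝ) (s : ℝ) : ℝ := ∫ x, (dt u (s, x) ^ 2 + gradSq u (s, x))

/-- The conformal energy on the slice `s`. -/
def conformalEnergy (u : Spacetime → ℝ) (s : ℝ) : ℝ :=
  ∫ x, (conformalField u (s, x) ^ 2 + s ^ 2 * gradSq u (s, x))

/-- The energy with the weight `s^{4a} t^{-2a}` on the slice `s`. -/
def retardedEnergy (a : ℝ) (u : Spacetime → ℝ) (s : ℝ) : ℝ :=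
  ∫ x, retardedWeight a (s, x) * (dt u (s, x) ^ 2 + gradSq u (s, x))

/-- The `L²` norm on the slice `s`. -/
def sliceNorm (f : Spacetime → ℝ) (s : ℝ) : ℝ := √(∫ x, f (s, x) ^ 2)

/-! ### Bounds for the bulk and source terms. -/

section Estimates

variable {u f : Spacetime → ℝ} {a s : ℝ}

theorem hypTime_regDist (s : ℝ) (x : Space) : regDist s 0 (s, x) = hypTime (s, x) := by
  simp [regDist, hypTime]

theorem le_hypTime (s : ℝ) (x : Space) : s ≤ hypTime (s, x) :=
  Real.le_sqrt_of_sq_le (by simp)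

theorem norm_le_hypTime (s : ℝ) (x : Space) : ‖x‖ ≤ hypTime (s, x) :=
  Real.le_sqrt_of_sq_le (by simp [sq_nonneg])

theorem retardedWeight_nonneg (hs : 0 < s) (x : Space) : 0 ≤ retardedWeight a (s, x) :=
  mul_nonneg (Real.rpow_nonneg hs.le _) (Real.rpow_nonneg (Real.sqrt_nonneg _) _)

theorem retardedWeight_le (hs : 0 < s) (ha : 0 ≤ a) (x : Space) :
    retardedWeight a (s, x) ≤ s ^ (2 * a) := by
  have h1 : hypTime (s, x) ^ (-(2 * a)) ≤ s ^ (-(2 * a)) :=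
    Real.rpow_le_rpow_of_nonpos hs (le_hypTime s x) (by linarith)
  calc retardedWeight a (s, x) ≤ s ^ (4 * a) * s ^ (-(2 * a)) :=
        mul_le_mul_of_nonneg_left h1 (Real.rpow_nonneg hs.le _)
    _ = s ^ (2 * a) := by rw [← Real.rpow_add hs]; ring_nf

theorem HasCompactSupport.sq {g : Spacetime → ℝ} (hg : HasCompactSupport g) :
    HasCompactSupport fun q => g q ^ 2 := by
  simp only [pow_two]; exact hg.mul_left

theorem integrable_slice_sq {g : Spacetime → ℝ} (hg : Continuous g) (hs : HasCompactSupport g)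
    (s : ℝ) : Integrable fun x => g (s, x) ^ 2 :=
  integrable_slice s (f := fun q => g q ^ 2) (hg.pow 2) (HasCompactSupport.sq hs)

theorem integrable_slice_weight {w : Space → ℝ} {g : Spacetime → ℝ} (hw : Continuous w)
    (hg : Continuous g) (hs : HasCompactSupport g) (s : ℝ) :
    Integrable fun x => w x * g (s, x) :=
  (hw.mul (hg.comp (by fun_prop : Continuous fun x => (s, x)))).integrable_of_hasCompactSupport
    (HasCompactSupport.slice hs s).mul_left

theorem continuous_retardedWeight (hs : 0 < s) :
    Continuous fun x : Space => retardedWeight a (s, x) :=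
  continuous_iff_continuousAt.2 fun x =>
    ContinuousAt.comp (f := fun x : Space => ((s, x) : Spacetime)) (g := retardedWeight a)
      (contDiffAt_retardedWeight (m := 0) (q := (s, x)) hs.ne').continuousAt
      (by fun_prop : Continuous fun x : Space => ((s, x) : Spacetime)).continuousAt

theorem continuous_slice_hypTime (s : ℝ) : Continuous fun x : Space => hypTime (s, x) :=
  continuous_hypTime.comp (by fun_prop : Continuous fun x : Space => ((s, x) : Spacetime))

theorem conformalEnergy_nonneg : 0 ≤ conformalEnergy u s :=
  integral_nonneg fun _ => add_nonneg (sq_nonneg _) (mul_nonneg (sq_nonneg _) (gradSq_nonneg _))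

theorem flatEnergy_nonneg : 0 ≤ flatEnergy u s :=
  integral_nonneg fun _ => add_nonneg (sq_nonneg _) (gradSq_nonneg _)

theorem retardedEnergy_nonneg (hs : 0 < s) : 0 ≤ retardedEnergy a u s :=
  integral_nonneg fun x => mul_nonneg (retardedWeight_nonneg hs x)
    (add_nonneg (sq_nonneg _) (gradSq_nonneg _))

theorem integrable_gradSq (hu : ContDiff ℝ 2 u) (hc : HasCompactSupport u) (s : ℝ) :
    Integrable fun x => gradSq u (s, x) :=
  integrable_slice s (contDiff_gradSq hu).continuous (hasCompactSupport_gradSq hc)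

theorem integrable_dt_sq (hu : ContDiff ℝ 2 u) (hc : HasCompactSupport u) (s : ℝ) :
    Integrable fun x => dt u (s, x) ^ 2 :=
  integrable_slice_sq (contDiff_dt (n := 1) hu).continuous (hasCompactSupport_dt hc) s

theorem integrable_conformalField_sq (hu : ContDiff ℝ 2 u) (hc : HasCompactSupport u) (s : ℝ) :
    Integrable fun x => conformalField u (s, x) ^ 2 :=
  integrable_slice_sq (contDiff_conformalField hu).continuous (hasCompactSupport_conformalField hc) s

theorem integral_gradSq_le (hu : ContDiff ℝ 2 u) (hc : HasCompactSupport u) (s : ℝ) :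
    s ^ 2 * ∫ x, gradSq u (s, x) ≤ conformalEnergy u s := by
  rw [conformalEnergy, integral_add (integrable_conformalField_sq hu hc s)
    ((integrable_gradSq hu hc s).const_mul _), integral_const_mul]
  have : 0 ≤ ∫ x, conformalField u (s, x) ^ 2 := integral_nonneg fun x => sq_nonneg _
  linarith

theorem integral_conformalField_le (hu : ContDiff ℝ 2 u) (hc : HasCompactSupport u) (s : ℝ) :
    ∫ x, conformalField u (s, x) ^ 2 ≤ conformalEnergy u s := by
  rw [conformalEnergy]
  refine integral_mono (integrable_conformalField_sq hu hc s)
    ((integrable_conformalField_sq hu hc s).add ((integrable_gradSq hu hc s).const_mul _)) fun x => ?_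
  have := mul_nonneg (sq_nonneg s) (gradSq_nonneg (f := u) (s, x))
  simp only
  linarith

theorem integrable_sq_div_hypTime (hu : ContDiff ℝ 2 u) (hc : HasCompactSupport u) (hs : 0 < s) :
    Integrable fun x => u (s, x) ^ 2 / hypTime (s, x) ^ 2 := by
  have := integrable_slice_weight (w := fun x => 1 / hypTime (s, x) ^ 2)
    (continuous_const.div ((continuous_slice_hypTime s).pow 2)
      fun x => pow_ne_zero _ (hypTime_pos (q := (s, x)) hs.ne').ne')
    (hu.continuous.pow 2) (HasCompactSupport.sq hc) s
  refine this.congr (Filter.Eventually.of_forall fun x => ?_)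
  simp only [Pi.pow_apply]
  ring

theorem hardy_hypTime (hu : ContDiff ℝ 2 u) (hc : HasCompactSupport u) (hs : 0 < s) :
    ∫ x, u (s, x) ^ 2 / hypTime (s, x) ^ 2 ≤ 4 * ∫ x, gradSq u (s, x) := by
  simpa only [hypTime_regDist] using hardy 0 hs (hu.of_le (by norm_num)) hc s

theorem sum_coord_mul_sq_le (u : Spacetime → ℝ) (s : ℝ) (x : Space) :
    (∑ i, x i * dx i u (s, x)) ^ 2 ≤ hypTime (s, x) ^ 2 * gradSq u (s, x) :=
  (sum_mul_le (fun i => x i) (fun i => dx i u (s, x)) x fun _ => rfl).trans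
    (mul_le_mul_of_nonneg_right (pow_le_pow_left₀ (norm_nonneg _) (norm_le_hypTime s x) 2)
      (gradSq_nonneg _))

/-- Solving the definition of N for the time derivative gives (s²/t) ∂_s u = (s/t) N - 2s (x·∂u)/t -
2s u/t. The coefficient s/t is at most 1, |x|/t ≤ 1, and u/t is controlled by the Hardy inequality;
the constant is 12 + 12 · 4 = 60. -/
theorem integral_retarded_dt_le (hu : ContDiff ℝ 2 u) (hc : HasCompactSupport u) (hs : 0 < s) :
    ∫ x, (s ^ 2 / hypTime (s, x) * dt u (s, x)) ^ 2 ≤ 60 * conformalEnergy u s := by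
  have i1 := integrable_conformalField_sq hu hc s
  have i2 := integrable_gradSq hu hc s
  have i3 := integrable_sq_div_hypTime hu hc hs
  have i12 := (i1.const_mul 3).add (i2.const_mul (12 * s ^ 2))
  simp only [Pi.add_def] at i12
  have i123 := i12.add (i3.const_mul (12 * s ^ 2))
  calc ∫ x, (s ^ 2 / hypTime (s, x) * dt u (s, x)) ^ 2
      ≤ ∫ x, (3 * conformalField u (s, x) ^ 2 + 12 * s ^ 2 * gradSq u (s, x)
          + 12 * s ^ 2 * (u (s, x) ^ 2 / hypTime (s, x) ^ 2)) := by
        refine integral_mono ?_ i123 fun x => ?_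
        · refine (integrable_slice_weight (w := fun x => (s ^ 2 / hypTime (s, x)) ^ 2) ?_
            ((contDiff_dt (n := 1) hu).continuous.pow 2)
            (HasCompactSupport.sq (hasCompactSupport_dt hc)) s).congr
            (Filter.Eventually.of_forall fun x => ?_)
          · exact (continuous_const.div (continuous_slice_hypTime s)
              fun x => (hypTime_pos (q := (s, x)) hs.ne').ne').pow 2
          · simp only [Pi.pow_apply]
            ring
        · have hT := hypTime_pos (q := (s, x)) hs.ne'
          have hsT := le_hypTime s x
          have hX := sum_coord_mul_sq_le u s x
          set T := hypTime (s, x)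
          have hN : conformalField u (s, x) = s * dt u (s, x)
            + 2 * ∑ i, x i * dx i u (s, x) + 2 * u (s, x) := rfl
          set X := ∑ i, x i * dx i u (s, x)
          set N := conformalField u (s, x)
          have e : s ^ 2 / T * dt u (s, x) = s / T * N - s * (2 * (X / T)) - s * (2 * (u (s, x) / T)) := by
            rw [hN]; field_simp; ring
          have h1 : (s / T * N) ^ 2 ≤ N ^ 2 := by
            rw [mul_pow]
            exact mul_le_of_le_one_left (sq_nonneg _)
              (pow_le_one₀ (by positivity) ((div_le_one hT).2 hsT))
          have h2 : (X / T) ^ 2 ≤ gradSq u (s, x) := by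
            rw [div_pow, div_le_iff₀ (by positivity)]; linarith
          have h3 : u (s, x) ^ 2 / T ^ 2 = (u (s, x) / T) ^ 2 := by rw [div_pow]
          simp only
          rw [h3, e]
          have h4 := mul_le_mul_of_nonneg_left h2 (sq_nonneg s)
          set A := s / T * N
          set B := X / T
          set D := u (s, x) / T
          nlinarith [sq_nonneg (A + s * (2 * B)), sq_nonneg (A + s * (2 * D)),
            sq_nonneg (s * (2 * B) - s * (2 * D))]
    _ = 3 * (∫ x, conformalField u (s, x) ^ 2) + 12 * s ^ 2 * (∫ x, gradSq u (s, x))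
          + 12 * s ^ 2 * ∫ x, u (s, x) ^ 2 / hypTime (s, x) ^ 2 := by
        rw [integral_add i12 (i3.const_mul _), integral_add (i1.const_mul _) (i2.const_mul _),
          integral_const_mul, integral_const_mul, integral_const_mul]
    _ ≤ 60 * conformalEnergy u s := by
        have h1 := hardy_hypTime hu hc hs
        have h2 : conformalEnergy u s = (∫ x, conformalField u (s, x) ^ 2)
            + s ^ 2 * ∫ x, gradSq u (s, x) := by
          rw [conformalEnergy, integral_add i1 (i2.const_mul _), integral_const_mul]
        have h3 : 0 ≤ ∫ x, conformalField u (s, x) ^ 2 := integral_nonneg fun x => sq_nonneg _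
        have h4 := mul_le_mul_of_nonneg_left h1 (sq_nonneg s)
        rw [h2]
        linarith

theorem sliceNorm_nonneg (f : Spacetime → ℝ) (s : ℝ) : 0 ≤ sliceNorm f s := Real.sqrt_nonneg _

theorem continuous_sliceNorm (hf : Continuous f) (hc : HasCompactSupport f) :
    Continuous (sliceNorm f) :=
  (continuous_integral_slice (f := fun q => f q ^ 2) (hf.pow 2) (HasCompactSupport.sq hc)).sqrt

theorem weighted_source_le (h : HypWave u f) (hs : 0 < s) (ha : 0 ≤ a) :
    |∫ x, retardedWeight a (s, x) * (dt u (s, x) * f (s, x))| ≤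
    √(retardedEnergy a u s) * (s ^ a * sliceNorm f s) := by
  have hut := (contDiff_dt (n := 1) h.contDiff).continuous
  have hc := h.compact
  have hu := h.contDiff
  have hcW := continuous_retardedWeight (a := a) hs
  have i3 : Integrable fun x => retardedWeight a (s, x) * (dt u (s, x) * f (s, x)) :=
    integrable_slice_weight (g := fun q => dt u q * f q) hcW (hut.mul h.source_continuous)
      h.source_compact.mul_left s
  have hW0 := fun x => retardedWeight_nonneg (a := a) hs x
  have j1 : Integrable fun x => retardedWeight a (s, x) * dt u (s, x) ^ 2 :=
    integrable_slice_weight (g := fun q => dt u q ^ 2) hcW (hut.pow 2)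
      (HasCompactSupport.sq (hasCompactSupport_dt hc)) s
  have j2 : Integrable fun x => retardedWeight a (s, x) * f (s, x) ^ 2 :=
    integrable_slice_weight (g := fun q => f q ^ 2) hcW (h.source_continuous.pow 2)
      (HasCompactSupport.sq h.source_compact) s
  have := abs_integral_weight_mul_le_sqrt hW0 j1 j2 i3
  have hG := (contDiff_gradSq hu).continuous
  have cj : Continuous fun q => dt u q ^ 2 + gradSq u q := by fun_prop
  have sj : HasCompactSupport fun q => dt u q ^ 2 + gradSq u q :=
    HasCompactSupport.add (HasCompactSupport.sq (hasCompactSupport_dt hc))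
      (hasCompactSupport_gradSq hc)
  have j3 : Integrable fun x => retardedWeight a (s, x) * (dt u (s, x) ^ 2 + gradSq u (s, x)) :=
    integrable_slice_weight hcW cj sj s
  have p1 : ∀ x, retardedWeight a (s, x) * dt u (s, x) ^ 2
      ≤ retardedWeight a (s, x) * (dt u (s, x) ^ 2 + gradSq u (s, x)) := fun x =>
    mul_le_mul_of_nonneg_left (le_add_of_nonneg_right (gradSq_nonneg (s, x))) (hW0 x)
  have k1 : ∫ x, retardedWeight a (s, x) * dt u (s, x) ^ 2 ≤ retardedEnergy a u s :=
    integral_mono j1 j3 p1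
  have p2 : ∀ x, retardedWeight a (s, x) * f (s, x) ^ 2 ≤ s ^ (2 * a) * f (s, x) ^ 2 := fun x =>
    mul_le_mul_of_nonneg_right (retardedWeight_le hs ha x) (sq_nonneg (f (s, x)))
  have j4 := (integrable_slice_sq h.source_continuous h.source_compact s).const_mul (s ^ (2 * a))
  have k2 : ∫ x, retardedWeight a (s, x) * f (s, x) ^ 2 ≤ s ^ (2 * a) * ∫ x, f (s, x) ^ 2 := by
    rw [← integral_const_mul]
    exact integral_mono j2 j4 p2
  have k3 : √(s ^ (2 * a) * ∫ x, f (s, x) ^ 2) = s ^ a * sliceNorm f s := by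
    rw [Real.sqrt_mul (Real.rpow_nonneg hs.le _), sliceNorm, mul_comm 2 a, Real.rpow_mul hs.le,
      Real.rpow_two, Real.sqrt_sq (Real.rpow_nonneg hs.le _)]
  rw [← k3]
  exact this.trans (mul_le_mul (Real.sqrt_le_sqrt k1) (Real.sqrt_le_sqrt k2) (Real.sqrt_nonneg _)
    (Real.sqrt_nonneg _))

/-- With y = s ∂_s u/t and z = (x·∂u)/t, where z² ≤ |∂u|², the bulk is at most (a/s) · 6(y² +
|∂u|²). Bounding W by s^{2a} and extracting s² leaves s^{2a-3} times densities controlled by the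
conformal energy. -/
theorem weighted_bulk_le (f : Spacetime → ℝ) (hs : 0 < s) (ha : 0 ≤ a) (x : Space) :
    retardedWeight a (s, x) *
        (2 * a * s / hypTime (s, x) ^ 2 * dt u (s, x) ^ 2
          + (4 * a / s - 2 * a * s / hypTime (s, x) ^ 2) * gradSq u (s, x)
          + 4 * a / hypTime (s, x) ^ 2 * (dt u (s, x) * ∑ i, x i * dx i u (s, x))
          - 2 * (dt u (s, x) * f (s, x))) ≤
      a * (6 * (s ^ (2 * a - 2) / s)) * ((s ^ 2 / hypTime (s, x) * dt u (s, x)) ^ 2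
            + s ^ 2 * gradSq u (s, x))
          - 2 * (retardedWeight a (s, x) * (dt u (s, x) * f (s, x))) := by
  have hT := hypTime_pos (q := (s, x)) hs.ne'
  have hX := sum_coord_mul_sq_le u s x
  have hW := retardedWeight_le hs ha x
  have hW0 := retardedWeight_nonneg (a := a) hs x
  have hG0 := gradSq_nonneg (f := u) (s, x)
  have hP : s ^ (2 * a) = s ^ (2 * a - 2) * s ^ 2 := by
    rw [← Real.rpow_natCast, ← Real.rpow_add hs]; norm_num
  set T := hypTime (s, x)
  set W := retardedWeight a (s, x)
  set X := ∑ i, x i * dx i u (s, x)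
  set G := gradSq u (s, x)
  set v := dt u (s, x)
  set y := s * v / T with hy
  set z := X / T with hz
  have hz2 : z ^ 2 ≤ G := by
    rw [hz, div_pow, div_le_iff₀ (by positivity)]; linarith
  have e1 : 2 * a * s / T ^ 2 * v ^ 2 + (4 * a / s - 2 * a * s / T ^ 2) * G
      + 4 * a / T ^ 2 * (v * X) = a / s * (2 * y ^ 2 + 4 * G + 4 * (y * z))
        - 2 * a * s / T ^ 2 * G := by
    rw [hy, hz]; field_simp; ring
  have e2 : 2 * a * s / T ^ 2 * v ^ 2 + (4 * a / s - 2 * a * s / T ^ 2) * G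
      + 4 * a / T ^ 2 * (v * X) ≤ a / s * (6 * (y ^ 2 + G)) := by
    rw [e1]
    have : 0 ≤ 2 * a * s / T ^ 2 * G := by positivity
    have : a / s * (2 * y ^ 2 + 4 * G + 4 * (y * z)) ≤ a / s * (6 * (y ^ 2 + G)) :=
      mul_le_mul_of_nonneg_left (by nlinarith [sq_nonneg (y - z)]) (by positivity)
    linarith
  have e3 : W * (a / s * (6 * (y ^ 2 + G))) ≤ s ^ (2 * a) * (a / s * (6 * (y ^ 2 + G))) :=
    mul_le_mul_of_nonneg_right hW (by positivity)
  have e4 : s ^ (2 * a) * (a / s * (6 * (y ^ 2 + G))) =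
      a * (6 * (s ^ (2 * a - 2) / s)) * ((s ^ 2 / T * v) ^ 2 + s ^ 2 * G) := by
    rw [hP, hy]; field_simp
  have e5 := mul_le_mul_of_nonneg_left e2 hW0
  linarith

theorem integrable_weighted_bulk (h : HypWave u f) (hs : 0 < s) (a : ℝ) :
    Integrable fun x => retardedWeight a (s, x) *
        (2 * a * s / hypTime (s, x) ^ 2 * dt u (s, x) ^ 2
          + (4 * a / s - 2 * a * s / hypTime (s, x) ^ 2) * gradSq u (s, x)
          + 4 * a / hypTime (s, x) ^ 2 * (dt u (s, x) * ∑ i, x i * dx i u (s, x))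
          - 2 * (dt u (s, x) * f (s, x))) := by
  have hu := h.contDiff
  have hc := h.compact
  have hut := (contDiff_dt (n := 1) hu).continuous
  have hcW := continuous_retardedWeight (a := a) hs
  have hTc := continuous_slice_hypTime s
  have hT0 : ∀ x : Space, hypTime (s, x) ^ 2 ≠ 0 := fun x =>
    pow_ne_zero _ (hypTime_pos (q := (s, x)) hs.ne').ne'
  have hem : Continuous fun x : Space => ((s, x) : Spacetime) := by fun_prop
  refine Continuous.integrable_of_hasCompactSupport ?_ ?_
  · have c1 : Continuous fun x => dt u (s, x) := hut.comp hem
    have c2 : Continuous fun x => gradSq u (s, x) := (contDiff_gradSq hu).continuous.comp hem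
    have c3 : Continuous fun x => ∑ i, x i * dx i u (s, x) :=
      continuous_finsetSum _ fun i _ => (by fun_prop : Continuous fun x : Space => x i).mul
        ((contDiff_dx (n := 1) i hu).continuous.comp hem)
    have c4 : Continuous fun x => f (s, x) := h.source_continuous.comp hem
    refine hcW.mul (((((continuous_const.div (hTc.pow 2) hT0).mul (c1.pow 2)).add
      ((continuous_const.sub (continuous_const.div (hTc.pow 2) hT0)).mul c2)).add
      ((continuous_const.div (hTc.pow 2) hT0).mul (c1.mul c3))).sub
      (continuous_const.mul (c1.mul c4)))
  · refine HasCompactSupport.mul_left ?_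
    refine HasCompactSupport.sub (HasCompactSupport.add (HasCompactSupport.add ?_ ?_) ?_) ?_
    · exact (HasCompactSupport.slice (HasCompactSupport.sq (hasCompactSupport_dt hc)) s).mul_left
    · exact (HasCompactSupport.slice (hasCompactSupport_gradSq hc) s).mul_left
    · exact (HasCompactSupport.slice (hasCompactSupport_dt hc) s).mul_right.mul_left
    · exact (HasCompactSupport.slice (hasCompactSupport_dt hc) s).mul_right.mul_left

/-- The bound for the `s`-derivative of the weighted energy. -/
theorem retardedEnergy_deriv_le (h : HypWave u f) (hs : 0 < s) (ha : a ∈ Set.Icc (0 : ℝ) 1) :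
    ∫ x, retardedWeight a (s, x) *
        (2 * a * s / hypTime (s, x) ^ 2 * dt u (s, x) ^ 2
          + (4 * a / s - 2 * a * s / hypTime (s, x) ^ 2) * gradSq u (s, x)
          + 4 * a / hypTime (s, x) ^ 2 * (dt u (s, x) * ∑ i, x i * dx i u (s, x))
          - 2 * (dt u (s, x) * f (s, x))) ≤
      a * (366 * (s ^ (2 * a - 2) / s * conformalEnergy u s))
        + 2 * (s ^ a * sliceNorm f s) * √(retardedEnergy a u s) := by
  have hu := h.contDiff
  have hc := h.compact
  have hut := (contDiff_dt (n := 1) hu).continuous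
  have hcW := continuous_retardedWeight (a := a) hs
  have i1 : Integrable fun x => (s ^ 2 / hypTime (s, x) * dt u (s, x)) ^ 2 := by
    refine (integrable_slice_weight (w := fun x => (s ^ 2 / hypTime (s, x)) ^ 2) ?_
      (hut.pow 2) (HasCompactSupport.sq (hasCompactSupport_dt hc)) s).congr
      (Filter.Eventually.of_forall fun x => ?_)
    · exact (continuous_const.div (continuous_slice_hypTime s)
        fun x => (hypTime_pos (q := (s, x)) hs.ne').ne').pow 2
    · simp only [Pi.pow_apply]
      ring
  have i2 := integrable_gradSq hu hc s
  have i3 : Integrable fun x => retardedWeight a (s, x) * (dt u (s, x) * f (s, x)) :=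
    integrable_slice_weight (g := fun q => dt u q * f q) hcW (hut.mul h.source_continuous)
      h.source_compact.mul_left s
  have i12 := (i1.add (i2.const_mul (s ^ 2))).const_mul (a * (6 * (s ^ (2 * a - 2) / s)))
  simp only [Pi.add_def] at i12
  have hCS := weighted_source_le h hs ha.1
  calc _ ≤ ∫ x, (a * (6 * (s ^ (2 * a - 2) / s)) * ((s ^ 2 / hypTime (s, x) * dt u (s, x)) ^ 2
            + s ^ 2 * gradSq u (s, x))
          - 2 * (retardedWeight a (s, x) * (dt u (s, x) * f (s, x)))) := by
        refine integral_mono ?_ (i12.sub (i3.const_mul 2)) fun x => ?_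
        · exact integrable_weighted_bulk h hs a
        · exact weighted_bulk_le f hs ha.1 x
    _ = a * (6 * (s ^ (2 * a - 2) / s)) * ((∫ x, (s ^ 2 / hypTime (s, x) * dt u (s, x)) ^ 2)
          + s ^ 2 * ∫ x, gradSq u (s, x))
        - 2 * ∫ x, retardedWeight a (s, x) * (dt u (s, x) * f (s, x)) := by
        rw [integral_sub i12 (i3.const_mul 2), integral_const_mul, integral_const_mul,
          integral_add i1 (i2.const_mul _), integral_const_mul]
    _ ≤ _ := by
        -- The constant is 366 = 6 · (60 + 1): the time derivative costs 60 conformal energies and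
        -- the gradient costs one.
        have h1 := integral_retarded_dt_le hu hc hs
        have h2 := integral_gradSq_le hu hc s
        have h3 : 0 ≤ a * (6 * (s ^ (2 * a - 2) / s)) := by
          have := ha.1
          positivity
        have h4 := mul_le_mul_of_nonneg_left (add_le_add h1 h2) h3
        have h5 := neg_le_of_abs_le hCS
        nlinarith

end Estimates

/-! ### Growth of the standard and combined energies. -/

section MainEstimate

variable {u f : Spacetime → ℝ} {a s₀ s₁ : ℝ}

theorem retardedWeight_zero (s : ℝ) (x : Space) : retardedWeight 0 (s, x) = 1 := by
  simp [retardedWeight]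

theorem retardedEnergy_zero (u : Spacetime → ℝ) (s : ℝ) : retardedEnergy 0 u s = flatEnergy u s := by
  simp only [retardedEnergy, retardedWeight_zero, one_mul, flatEnergy]

/-- This is the weighted identity at a = 0, where W = 1 and the bulk vanishes. -/
theorem sqrt_flatEnergy_le (h : HypWave u f) (hs₀ : 1 ≤ s₀) (hs : s₀ ≤ s₁) :
    √(flatEnergy u s₁) ≤ √(flatEnergy u s₀) + ∫ s in s₀..s₁, sliceNorm f s := by
  have hpos : ∀ s ∈ Set.Icc s₀ s₁, 0 < s := fun s hs' => by linarith [hs'.1]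
  rw [← retardedEnergy_zero, ← retardedEnergy_zero]
  refine sqrt_le_sqrt_add_integral hs (H := retardedEnergy 0 u)
    (fun s hs' => hasDerivAt_weightedEnergy (a := 0) h (hpos s hs'))
    (fun s hs' => retardedEnergy_nonneg (hpos s hs'))
    (continuous_sliceNorm h.source_continuous h.source_compact).continuousOn
    (fun s _ => sliceNorm_nonneg f s) (fun s hs' => ?_)
  simpa using retardedEnergy_deriv_le h (hpos s hs') (a := 0) (by simp)

theorem conformalEnergy_deriv_le (h : HypWave u f) {s : ℝ} (hs : 0 < s) :
    ∫ x, -(2 * s * (conformalField u (s, x) * f (s, x))) ≤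
      2 * s * sliceNorm f s * √(conformalEnergy u s) := by
  have hN := (contDiff_conformalField h.contDiff).continuous
  have hNc := hasCompactSupport_conformalField h.compact
  have h1 := abs_integral_mul_le_sqrt (integrable_slice_sq hN hNc s)
    (integrable_slice_sq h.source_continuous h.source_compact s)
    (integrable_slice s (f := fun q => conformalField u q * f q)
      (hN.mul h.source_continuous) hNc.mul_right)
  have h2 : √(∫ x, conformalField u (s, x) ^ 2) ≤ √(conformalEnergy u s) :=
    Real.sqrt_le_sqrt (integral_conformalField_le h.contDiff h.compact s)
  have h3 := neg_le_of_abs_le h1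
  have h4 : √(∫ x, conformalField u (s, x) ^ 2) * √(∫ x, f (s, x) ^ 2)
      ≤ √(conformalEnergy u s) * sliceNorm f s :=
    mul_le_mul_of_nonneg_right h2 (Real.sqrt_nonneg _)
  rw [integral_neg, integral_const_mul]
  nlinarith

/-- The functional controlling the weighted norms: the rescaled conformal energy plus a small
multiple of the weighted energy. -/
def combinedEnergy (a : ℝ) (u : Spacetime → ℝ) (s : ℝ) : ℝ :=
  s ^ (2 * a - 2) * conformalEnergy u s + (1 - a) / 200 * retardedEnergy a u s

/-- The power s^{2a-2} is nonincreasing, and its derivative pays for the bulk of the weighted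
energy. Each of the two source terms is at most 2 s^a ‖f‖ √H, which explains the factor 2 in the
integral. -/
theorem sqrt_combinedEnergy_le_add (h : HypWave u f) (hs₀ : 1 ≤ s₀) (hs : s₀ ≤ s₁)
    (ha : a ∈ Set.Icc (0 : ℝ) 1) :
    √(combinedEnergy a u s₁) ≤
      √(combinedEnergy a u s₀) + ∫ s in s₀..s₁, 2 * (s ^ a * sliceNorm f s) := by
  have ha0 := ha.1
  have ha1 := ha.2
  have hpos : ∀ s ∈ Set.Icc s₀ s₁, 0 < s := fun s hs' => by linarith [hs'.1]
  refine sqrt_le_sqrt_add_integral hs (H := combinedEnergy a u)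
    (H' := fun s => ((2 * a - 2) * s ^ (2 * a - 2 - 1) * conformalEnergy u s
      + s ^ (2 * a - 2) * ∫ x, -(2 * s * (conformalField u (s, x) * f (s, x))))
      + (1 - a) / 200 * ∫ x, retardedWeight a (s, x) *
        (2 * a * s / hypTime (s, x) ^ 2 * dt u (s, x) ^ 2
          + (4 * a / s - 2 * a * s / hypTime (s, x) ^ 2) * gradSq u (s, x)
          + 4 * a / hypTime (s, x) ^ 2 * (dt u (s, x) * ∑ i, x i * dx i u (s, x))
          - 2 * (dt u (s, x) * f (s, x))))
    (fun s hs' => ?_) (fun s hs' => ?_) ?_ (fun s hs' => ?_) (fun s hs' => ?_)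
  · have hp := hpos s hs'
    exact ((Real.hasDerivAt_rpow_const (Or.inl hp.ne')).mul
      (hasDerivAt_conformalEnergy h hp)).add ((hasDerivAt_weightedEnergy h hp).const_mul _)
  · have hp := hpos s hs'
    have h1 := conformalEnergy_nonneg (u := u) (s := s)
    have h2 := retardedEnergy_nonneg (a := a) (u := u) hp
    have h3 : 0 ≤ 1 - a := by linarith
    unfold combinedEnergy
    positivity
  · refine ContinuousOn.mul continuousOn_const (ContinuousOn.mul ?_
      (continuous_sliceNorm h.source_continuous h.source_compact).continuousOn)
    exact continuousOn_id.rpow_const fun s hs' => Or.inl (hpos s hs').ne'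
  · have := sliceNorm_nonneg f s
    have hp := hpos s hs'
    positivity
  · have hp := hpos s hs'
    have h1 := conformalEnergy_nonneg (u := u) (s := s)
    have h2 := retardedEnergy_nonneg (a := a) (u := u) hp
    have h3 := conformalEnergy_deriv_le h hp
    have h4 := retardedEnergy_deriv_le h hp ha
    set Y := ∫ x, -(2 * s * (conformalField u (s, x) * f (s, x)))
    set Z := ∫ x, retardedWeight a (s, x) *
        (2 * a * s / hypTime (s, x) ^ 2 * dt u (s, x) ^ 2
          + (4 * a / s - 2 * a * s / hypTime (s, x) ^ 2) * gradSq u (s, x)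
          + 4 * a / hypTime (s, x) ^ 2 * (dt u (s, x) * ∑ i, x i * dx i u (s, x))
          - 2 * (dt u (s, x) * f (s, x)))
    set E := conformalEnergy u s
    set R := retardedEnergy a u s
    set n := sliceNorm f s with hn
    have hn0 : 0 ≤ n := sliceNorm_nonneg f s
    have hH : combinedEnergy a u s = s ^ (2 * a - 2) * E + (1 - a) / 200 * R := rfl
    set H := combinedEnergy a u s
    have hp1 : 0 ≤ s ^ (2 * a - 2) := by positivity
    have ha2 : 0 ≤ (1 - a) / 200 := by linarith
    have e1 : s ^ (2 * a - 2) * (2 * s * n * √E) = 2 * (s ^ a * n) * √(s ^ (2 * a - 2) * E) := by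
      rw [Real.sqrt_mul hp1, show 2 * a - 2 = (a - 1) * 2 by ring, Real.rpow_mul hp.le,
        Real.rpow_two, Real.sqrt_sq (by positivity), Real.rpow_sub_one hp.ne']
      field_simp
    have e2 : √(s ^ (2 * a - 2) * E) ≤ √H :=
      Real.sqrt_le_sqrt (by rw [hH]; linarith [mul_nonneg ha2 h2])
    -- As (1-a)/200 ≤ 1, it is at most its square root, which may then enter √H.
    have e3 : (1 - a) / 200 * √R ≤ √H := by
      calc (1 - a) / 200 * √R ≤ √((1 - a) / 200) * √R := by
            refine mul_le_mul_of_nonneg_right ?_ (Real.sqrt_nonneg _)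
            exact Real.le_sqrt_of_sq_le (by nlinarith)
        _ = √((1 - a) / 200 * R) := (Real.sqrt_mul ha2 _).symm
        _ ≤ √H := Real.sqrt_le_sqrt (by rw [hH]; linarith [mul_nonneg hp1 h1])
    have e4 : s ^ (2 * a - 2 - 1) = s ^ (2 * a - 2) / s := Real.rpow_sub_one hp.ne' _
    set P := s ^ (2 * a - 2) / s * E with hP
    have hP0 : 0 ≤ P := by positivity
    have hm : 0 ≤ s ^ a * n := by positivity
    have g1 := mul_le_mul_of_nonneg_left h3 hp1
    rw [e1] at g1
    have g2 := mul_le_mul_of_nonneg_left h4 ha2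
    have g3 := mul_le_mul_of_nonneg_left e2 (mul_nonneg zero_le_two hm)
    have g4 := mul_le_mul_of_nonneg_left e3 (mul_nonneg zero_le_two hm)
    simp only [e4]
    have g5 : (2 * a - 2) * (s ^ (2 * a - 2) / s) * E = -(2 * (1 - a)) * P := by rw [hP]; ring
    -- The number 200 in `combinedEnergy` is chosen so that 366/200 < 2; the factor 1 - a is present
    -- on both sides, so the absorption is uniform up to a = 1.
    have g6 : (1 - a) / 200 * (a * (366 * P)) ≤ 2 * (1 - a) * P := by
      have : (1 - a) * P * (a * 366) ≤ (1 - a) * P * 400 :=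
        mul_le_mul_of_nonneg_left (by linarith) (mul_nonneg (by linarith) hP0)
      nlinarith
    rw [g5]
    nlinarith

theorem retardedEnergy_le_flatEnergy (h : HypWave u f) {s : ℝ} (hs : 0 < s) (ha : 0 ≤ a) :
    retardedEnergy a u s ≤ s ^ (2 * a) * flatEnergy u s := by
  have hu := h.contDiff
  have hG := (contDiff_gradSq hu).continuous
  have hT := (contDiff_dt (n := 1) hu).continuous
  have cj : Continuous fun q => dt u q ^ 2 + gradSq u q := by fun_prop
  have sj : HasCompactSupport fun q => dt u q ^ 2 + gradSq u q :=
    HasCompactSupport.add (HasCompactSupport.sq (hasCompactSupport_dt h.compact))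
      (hasCompactSupport_gradSq h.compact)
  have p : ∀ x, retardedWeight a (s, x) * (dt u (s, x) ^ 2 + gradSq u (s, x))
      ≤ s ^ (2 * a) * (dt u (s, x) ^ 2 + gradSq u (s, x)) := fun x =>
    mul_le_mul_of_nonneg_right (retardedWeight_le hs ha x)
      (add_nonneg (sq_nonneg _) (gradSq_nonneg _))
  rw [flatEnergy, ← integral_const_mul]
  exact integral_mono (integrable_slice_weight (continuous_retardedWeight hs) cj sj s)
    ((integrable_slice s cj sj).const_mul _) p

theorem sqrt_combinedEnergy_le (h : HypWave u f) (hs₀ : 1 ≤ s₀) (ha : a ∈ Set.Icc (0 : ℝ) 1) :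
    √(combinedEnergy a u s₀) ≤ √(conformalEnergy u s₀) + s₀ * √(flatEnergy u s₀) := by
  have ha0 := ha.1
  have ha1 := ha.2
  have hp : 0 < s₀ := by linarith
  have hC := conformalEnergy_nonneg (u := u) (s := s₀)
  have hF := flatEnergy_nonneg (u := u) (s := s₀)
  refine Real.sqrt_le_iff.2 ⟨by positivity, ?_⟩
  have h1 : s₀ ^ (2 * a - 2) ≤ 1 := Real.rpow_le_one_of_one_le_of_nonpos hs₀ (by linarith)
  have h2 : s₀ ^ (2 * a) ≤ s₀ ^ 2 := by
    rw [← Real.rpow_two]; exact Real.rpow_le_rpow_of_exponent_le hs₀ (by linarith)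
  have h3 := retardedEnergy_le_flatEnergy h hp ha0
  have h4 := retardedEnergy_nonneg (a := a) (u := u) hp
  have h5 := Real.sq_sqrt hC
  have h6 := Real.sq_sqrt hF
  have h7 := mul_le_mul_of_nonneg_right h1 hC
  have h8 := mul_le_mul_of_nonneg_right h2 hF
  have h9 : (1 - a) / 200 * retardedEnergy a u s₀ ≤ retardedEnergy a u s₀ := by nlinarith
  have h10 : 0 ≤ √(conformalEnergy u s₀) * (s₀ * √(flatEnergy u s₀)) := by positivity
  unfold combinedEnergy
  nlinarith

/-- The constant in the estimate of the weighted time derivative. -/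
def energyConst (a : ℝ) : ℝ := if a = 1 then 8 else √(200 / (1 - a))

/-- For a < 1 the R-part of H is used, at the price of dividing by (1-a)/200. At a = 1 that part has
coefficient zero, but W (∂_s u)² is then the square of (s²/t) ∂_s u, controlled by the conformal
energy. -/
theorem integral_retardedWeight_dt_le (h : HypWave u f) {s : ℝ} (hs : 0 < s)
    (ha : a ∈ Set.Icc (0 : ℝ) 1) :
    √(∫ x, retardedWeight a (s, x) * dt u (s, x) ^ 2) ≤ energyConst a * √(combinedEnergy a u s) := by
  have hu := h.contDiff
  have hC := conformalEnergy_nonneg (u := u) (s := s)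
  have hR := retardedEnergy_nonneg (a := a) (u := u) hs
  unfold energyConst
  split_ifs with h1
  · subst h1
    refine Real.sqrt_le_iff.2 ⟨by positivity, ?_⟩
    have e1 : combinedEnergy 1 u s = conformalEnergy u s := by simp [combinedEnergy]
    have e2 : ∀ x, retardedWeight 1 (s, x) * dt u (s, x) ^ 2
        = (s ^ 2 / hypTime (s, x) * dt u (s, x)) ^ 2 := fun x => by
      have hT := hypTime_pos (q := (s, x)) hs.ne'
      rw [retardedWeight, mul_one, mul_one, Real.rpow_neg hT.le, Real.rpow_two,
        show (4 : ℝ) = ((4 : ℕ) : ℝ) by norm_num, Real.rpow_natCast]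
      field_simp
    rw [e1, mul_pow, Real.sq_sqrt hC]
    simp only [e2]
    -- The constant 8 comes from 60 ≤ 8².
    have := integral_retarded_dt_le hu h.compact hs
    linarith
  · have ha1 : 0 < 1 - a := by
      have := lt_of_le_of_ne ha.2 h1
      linarith
    rw [← Real.sqrt_mul (by positivity)]
    refine Real.sqrt_le_sqrt ?_
    have hG := (contDiff_gradSq hu).continuous
    have hT := (contDiff_dt (n := 1) hu).continuous
    have hW0 := fun x => retardedWeight_nonneg (a := a) hs x
    have cj : Continuous fun q => dt u q ^ 2 + gradSq u q := by fun_prop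
    have ck : Continuous fun q => dt u q ^ 2 := by fun_prop
    have sk := HasCompactSupport.sq (hasCompactSupport_dt h.compact)
    have sj : HasCompactSupport fun q => dt u q ^ 2 + gradSq u q :=
      HasCompactSupport.add sk (hasCompactSupport_gradSq h.compact)
    have hcW := continuous_retardedWeight (a := a) hs
    have p1 : ∀ x, retardedWeight a (s, x) * dt u (s, x) ^ 2
      ≤ retardedWeight a (s, x) * (dt u (s, x) ^ 2 + gradSq u (s, x)) := fun x =>
      mul_le_mul_of_nonneg_left (le_add_of_nonneg_right (gradSq_nonneg (s, x))) (hW0 x)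
    have k1 : ∫ x, retardedWeight a (s, x) * dt u (s, x) ^ 2 ≤ retardedEnergy a u s :=
      integral_mono (integrable_slice_weight hcW ck sk s) (integrable_slice_weight hcW cj sj s) p1
    refine k1.trans ?_
    have k2 : 200 / (1 - a) * ((1 - a) / 200 * retardedEnergy a u s) = retardedEnergy a u s := by
      field_simp
    rw [combinedEnergy, mul_add, k2]
    have : 0 ≤ 200 / (1 - a) * (s ^ (2 * a - 2) * conformalEnergy u s) := by positivity
    linarith

theorem rpow_mul_sqrt_integral_gradSq_le (h : HypWave u f) {s : ℝ} (hs : 0 < s) (ha : a ≤ 1) :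
    s ^ a * √(∫ x, gradSq u (s, x)) ≤ √(combinedEnergy a u s) := by
  have h1 := integral_gradSq_le h.contDiff h.compact s
  have h2 := retardedEnergy_nonneg (a := a) (u := u) hs
  refine Real.le_sqrt_of_sq_le ?_
  rw [mul_pow, Real.sq_sqrt (integral_nonneg fun x => gradSq_nonneg _), ← Real.rpow_natCast,
    ← Real.rpow_mul hs.le]
  have e : s ^ (a * ((2 : ℕ) : ℝ)) = s ^ (2 * a - 2) * s ^ 2 := by
    rw [← Real.rpow_natCast, ← Real.rpow_add hs]; push_cast; ring_nf
  rw [e, combinedEnergy, mul_assoc]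
  have h3 := mul_le_mul_of_nonneg_left h1 (Real.rpow_nonneg hs.le (2 * a - 2))
  have h4 : 0 ≤ (1 - a) / 200 * retardedEnergy a u s := mul_nonneg (by linarith) h2
  linarith

end MainEstimate

/-! ### Functions on spacetime in hyperboloidal coordinates -/

/-- Functions of class `C^n` with compact support in the future light cone. -/
structure Admissible (n : ℕ) (φ : Spacetime → ℝ) : Prop where
  contDiff : ContDiff ℝ n φ
  compact : HasCompactSupport φ
  future : ∀ p ∈ tsupport φ, ‖p.2‖ < p.1

/-- The function `φ` in the coordinates `(s, x)`. -/
def pull (φ : Spacetime → ℝ) (q : Spacetime) : ℝ := φ (hypPoint q.1 q.2)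

section Pull

variable {φ ψ : Spacetime → ℝ} {n m : ℕ} (i : Fin 3)

theorem Admissible.mono (h : Admissible n φ) (hm : m ≤ n) : Admissible m φ :=
  ⟨h.contDiff.of_le (by exact_mod_cast hm), h.compact, h.future⟩

theorem Admissible.dt (h : Admissible (n + 1) φ) : Admissible n (dt φ) :=
  ⟨contDiff_dt h.contDiff, hasCompactSupport_dt h.compact,
    fun p hp => h.future p (tsupport_dt_subset hp)⟩

theorem Admissible.dx (h : Admissible (n + 1) φ) : Admissible n (dx i φ) :=
  ⟨contDiff_dx i h.contDiff, hasCompactSupport_dx i h.compact,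
    fun p hp => h.future p (tsupport_dx_subset i hp)⟩

theorem Admissible.add (h : Admissible n φ) (h' : Admissible n ψ) :
    Admissible n fun p => φ p + ψ p := by
  refine ⟨h.contDiff.add h'.contDiff, HasCompactSupport.add h.compact h'.compact, fun p hp => ?_⟩
  rcases tsupport_add _ _ hp with hp | hp
  · exact h.future p hp
  · exact h'.future p hp

theorem Admissible.mul_left {w : Spacetime → ℝ} (hw : ContDiff ℝ n w) (h : Admissible n φ) :
    Admissible n fun p => w p * φ p :=
  ⟨hw.mul h.contDiff, HasCompactSupport.mul_left h.compact,
    fun p hp => h.future p (tsupport_mul_subset_right hp)⟩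

theorem Admissible.boost (h : Admissible (n + 1) φ) : Admissible n (boost i φ) :=
  (Admissible.mul_left contDiff_fst (h.dx i)).add (Admissible.mul_left (contDiff_coord i) h.dt)

theorem box_eq (φ : Spacetime → ℝ) : box φ = fun p => (-1) * Hyperboloidal.dt (Hyperboloidal.dt φ) p
    + ((Hyperboloidal.dx 0 (Hyperboloidal.dx 0 φ) p + Hyperboloidal.dx 1 (Hyperboloidal.dx 1 φ) p)
      + Hyperboloidal.dx 2 (Hyperboloidal.dx 2 φ) p) := by
  funext p; simp [box, Fin.sum_univ_three]

theorem Admissible.box (h : Admissible (n + 2) φ) : Admissible n (box φ) := by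
  rw [box_eq]
  exact (Admissible.mul_left contDiff_const h.dt.dt).add
    ((((h.dx 0).dx 0).add ((h.dx 1).dx 1)).add ((h.dx 2).dx 2))

theorem continuous_hypPoint : Continuous fun q : Spacetime => hypPoint q.1 q.2 :=
  continuous_hypTime.prodMk continuous_snd

theorem contDiffAt_hypPoint {m : WithTop ℕ∞} {q : Spacetime} (hq : q.1 ≠ 0) :
    ContDiffAt ℝ m (fun q : Spacetime => hypPoint q.1 q.2) q :=
  (contDiffAt_hypTime hq).prodMk contDiffAt_snd

theorem tsupport_pull_subset (φ : Spacetime → ℝ) :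
    tsupport (pull φ) ⊆ (fun q : Spacetime => hypPoint q.1 q.2) ⁻¹' tsupport φ :=
  closure_minimal (fun _ hq => subset_tsupport _ hq)
    ((isClosed_tsupport φ).preimage continuous_hypPoint)

/-- The value s = 0 corresponds to the light cone t = |x|, which the support of φ avoids. This keeps
`pull φ` away from the origin, where `hypTime` is not smooth, and from the singular coefficients
1/s. -/
theorem Admissible.fst_ne_zero (h : Admissible n φ) : ∀ q ∈ tsupport (pull φ), q.1 ≠ 0 := by
  intro q hq h0
  have := h.future _ (tsupport_pull_subset φ hq)
  simp [hypPoint, h0] at this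

theorem hasCompactSupport_pull (h : HasCompactSupport φ) : HasCompactSupport (pull φ) := by
  obtain ⟨R, hR⟩ := h.isCompact.isBounded.exists_norm_le
  refine HasCompactSupport.of_support_subset_isCompact (isCompact_closedBall (0 : Spacetime) R)
    fun q hq => ?_
  have h1 := hR _ (subset_tsupport φ (show φ (hypPoint q.1 q.2) ≠ 0 from hq))
  have h2 : |hypTime q| ≤ R := (norm_fst_le (hypPoint q.1 q.2)).trans h1
  have h3 : ‖q.2‖ ≤ R := (norm_snd_le (hypPoint q.1 q.2)).trans h1
  have h4 : |q.1| ≤ hypTime q := Real.abs_le_sqrt (by nlinarith [sq_nonneg ‖q.2‖])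
  rw [mem_closedBall_zero_iff]
  exact max_le (h4.trans ((le_abs_self _).trans h2)) h3

theorem Admissible.contDiff_pull (h : Admissible n φ) : ContDiff ℝ n (pull φ) :=
  contDiff_of_tsupport fun q hq =>
    h.contDiff.contDiffAt.comp q (contDiffAt_hypPoint (h.fst_ne_zero q hq))

theorem dt_pull {q : Spacetime} (hφ : DifferentiableAt ℝ φ (hypPoint q.1 q.2)) (hq : q.1 ≠ 0) :
    dt (pull φ) q = q.1 / hypTime q * pull (dt φ) q := by
  have d : DifferentiableAt ℝ hypTime q :=
    (contDiffAt_hypTime (m := 1) hq).differentiableAt (by norm_num)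
  have h1 : HasFDerivAt (fun q : Spacetime => hypPoint q.1 q.2) _ q :=
    d.hasFDerivAt.prodMk hasFDerivAt_snd
  have h2 := (hφ.hasFDerivAt.comp q h1).fderiv
  have h3 := dt_hypTime hq
  simp only [dt] at h3
  change fderiv ℝ (φ ∘ fun q : Spacetime => hypPoint q.1 q.2) q (1, 0) = _
  rw [h2]
  simp only [ContinuousLinearMap.comp_apply, fderiv_apply_eq]
  simp [h3, pull]

theorem dx_pull {q : Spacetime} (hφ : DifferentiableAt ℝ φ (hypPoint q.1 q.2)) (hq : q.1 ≠ 0) :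
    dx i (pull φ) q = pull (dx i φ) q + q.2 i / hypTime q * pull (dt φ) q := by
  have d : DifferentiableAt ℝ hypTime q :=
    (contDiffAt_hypTime (m := 1) hq).differentiableAt (by norm_num)
  have h1 : HasFDerivAt (fun q : Spacetime => hypPoint q.1 q.2) _ q :=
    d.hasFDerivAt.prodMk hasFDerivAt_snd
  have h2 := (hφ.hasFDerivAt.comp q h1).fderiv
  have h3 := dx_hypTime i hq
  simp only [dx] at h3
  change fderiv ℝ (φ ∘ fun q : Spacetime => hypPoint q.1 q.2) q (0, unitVec i) = _
  rw [h2]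
  simp only [ContinuousLinearMap.comp_apply, fderiv_apply_eq]
  simp only [ContinuousLinearMap.prod_apply, h3]
  simp [pull, unitVec]
  ring

theorem dt_congr {f g : Spacetime → ℝ} {q : Spacetime} (h : f =ᶠ[nhds q] g) : dt f q = dt g q := by
  simp only [dt, h.fderiv_eq]

theorem dx_congr {f g : Spacetime → ℝ} {q : Spacetime} (h : f =ᶠ[nhds q] g) :
    dx i f q = dx i g q := by
  simp only [dx, h.fderiv_eq]

theorem eventually_fst_ne_zero {q : Spacetime} (hq : q.1 ≠ 0) : ∀ᶠ p in nhds q, p.1 ≠ 0 :=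
  continuous_fst.continuousAt.eventually_ne hq

/-- The first-order chain rules `dt_pull` and `dx_pull` hold near every point with s ≠ 0, so they
can be differentiated again as identities of germs. -/
theorem hypWave_pull (h : Admissible 2 φ) : HypWave (pull φ) (pull (box φ)) := by
  have hb : Admissible 0 (box φ) := Admissible.box (n := 0) h
  have hd1 : ∀ p, DifferentiableAt ℝ φ p := h.contDiff.differentiable (by norm_num)
  have ht : Admissible 1 (dt φ) := Admissible.dt (n := 1) h
  have hx : ∀ i, Admissible 1 (dx i φ) := fun i => Admissible.dx (n := 1) i h
  have hdt : ∀ p, DifferentiableAt ℝ (dt φ) p := ht.contDiff.differentiable (by norm_num)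
  have hdx : ∀ i p, DifferentiableAt ℝ (dx i φ) p := fun i =>
    (hx i).contDiff.differentiable (by norm_num)
  refine ⟨h.contDiff_pull, hasCompactSupport_pull h.compact, h.fst_ne_zero,
    hb.contDiff_pull.continuous, hasCompactSupport_pull hb.compact, fun q hq => ?_⟩
  have hq0 : q.1 ≠ 0 := hq.ne'
  have hT := hypTime_pos hq0
  have dT : DifferentiableAt ℝ hypTime q :=
    (contDiffAt_hypTime (m := 1) hq0).differentiableAt (by norm_num)
  have dP : DifferentiableAt ℝ (pull (dt φ)) q := ht.contDiff_pull.differentiable (by norm_num) q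
  have dX : ∀ i, DifferentiableAt ℝ (pull (dx i φ)) q := fun i =>
    (hx i).contDiff_pull.differentiable (by norm_num) q
  have dI : DifferentiableAt ℝ (fun q => (hypTime q)⁻¹) q := dT.inv hT.ne'
  have e1 : dt (pull φ) =ᶠ[nhds q] fun q => q.1 * (hypTime q)⁻¹ * pull (dt φ) q := by
    filter_upwards [eventually_fst_ne_zero hq0] with p hp
    rw [dt_pull (hd1 _) hp, div_eq_mul_inv]
  have e2 : ∀ i, dx i (pull φ) =ᶠ[nhds q]
      fun q => pull (dx i φ) q + q.2 i * (hypTime q)⁻¹ * pull (dt φ) q := by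
    intro i
    filter_upwards [eventually_fst_ne_zero hq0] with p hp
    rw [dx_pull i (hd1 _) hp, div_eq_mul_inv]
  have i1 : dt (fun q => (hypTime q)⁻¹) q = -(q.1 / hypTime q ^ 3) := by
    rw [dt_comp (h := fun y => y⁻¹) (hasDerivAt_inv hT.ne') dT, dt_hypTime hq0]
    field_simp
  have i2 : ∀ i, dx i (fun q => (hypTime q)⁻¹) q = -(q.2 i / hypTime q ^ 3) := by
    intro i
    rw [dx_comp i (h := fun y => y⁻¹) (hasDerivAt_inv hT.ne') dT, dx_hypTime i hq0]
    field_simp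
  have g1 := dt_pull (hdt (hypPoint q.1 q.2)) hq0
  have g2 := fun i => dx_pull i (hdt (hypPoint q.1 q.2)) hq0
  have g3 := fun i j => dx_pull i (hdx j (hypPoint q.1 q.2)) hq0
  have c : ∀ i, pull (dt (dx i φ)) q = pull (dx i (dt φ)) q := fun i =>
    (dx_dt_comm i h.contDiff.contDiffAt).symm
  have hb2 : pull (box φ) q = - pull (dt (dt φ)) q + (pull (dx 0 (dx 0 φ)) q
      + pull (dx 1 (dx 1 φ)) q + pull (dx 2 (dx 2 φ)) q) := by
    simp only [pull, box, Fin.sum_univ_three]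
  have hs2 : q.1 ^ 2 = hypTime q ^ 2 - (q.2 0 ^ 2 + q.2 1 ^ 2 + q.2 2 ^ 2) := by
    rw [hypTime_sq, norm_sq_eq_sum]; ring
  simp only [Fin.sum_univ_three, dt_congr e1, fun i => dx_congr i e1, fun i => dx_congr i (e2 i)]
  have dX0 := dX 0
  have dX1 := dX 1
  have dX2 := dX 2
  rw [e1.eq_of_nhds]
  simp (disch := fun_prop) only [dt_mul, dx_mul, dx_add, dt_time, dx_time, dx_coord, i1, i2, g1,
    g2, g3, c, hb2, ↓reduceIte]
  -- After substitution the two sides differ by multiples of s² = t² - |x|², one for the first and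
  -- one for the second time derivative.
  linear_combination (norm := skip) (pull (dt φ) q / hypTime q ^ 3
    - pull (dt (dt φ)) q / hypTime q ^ 2) * hs2
  field_simp
  ring

end Pull

/-! ### The norms on hyperboloids and the zeroth-order estimate -/

section Norms

variable {V : Type*} [NormedAddCommGroup V] {φ : Spacetime → ℝ} {a s s₀ s₁ : ℝ}

theorem eLpNorm_two_eq {f : Space → V} {G : Space → ℝ} (h : ∀ x, ‖f x‖ ^ 2 = G x)
    (hG : Integrable G) : eLpNorm f 2 volume = ENNReal.ofReal √(∫ x, G x) := by
  have hG0 : ∀ x, 0 ≤ G x := fun x => by rw [← h]; positivity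
  rw [eLpNorm_eq_lintegral_rpow_enorm_toReal (by norm_num) (by norm_num)]
  have e : ∀ x, ‖f x‖ₑ ^ (2 : ℝ≥0∞).toReal = ENNReal.ofReal (G x) := fun x => by
    rw [← h, ENNReal.ofReal_pow (norm_nonneg _), ofReal_norm]
    simp
  simp only [e]
  rw [← ofReal_integral_eq_lintegral_ofReal hG (Filter.Eventually.of_forall hG0),
    Real.sqrt_eq_rpow, ENNReal.ofReal_rpow_of_nonneg (integral_nonneg hG0) (by norm_num)]
  norm_num

theorem eLpNorm_two_le {f : Space → V} {G : Space → ℝ} (h : ∀ x, ‖f x‖ ^ 2 ≤ G x)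
    (hG : Integrable G) : eLpNorm f 2 volume ≤ ENNReal.ofReal √(∫ x, G x) := by
  have hG0 : ∀ x, 0 ≤ G x := fun x => (sq_nonneg _).trans (h x)
  rw [← eLpNorm_two_eq (f := fun x => √(G x)) (fun x => ?_) hG]
  · refine eLpNorm_mono fun x => ?_
    rw [Real.norm_of_nonneg (Real.sqrt_nonneg _)]
    exact Real.le_sqrt_of_sq_le (h x)
  · rw [Real.norm_of_nonneg (Real.sqrt_nonneg _), Real.sq_sqrt (hG0 x)]

theorem pull_apply (φ : Spacetime → ℝ) (s : ℝ) (x : Space) : pull φ (s, x) = φ (hypPoint s x) := rfl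

theorem Admissible.differentiable (h : Admissible 2 φ) : Differentiable ℝ φ :=
  h.contDiff.differentiable (by norm_num)

theorem weighted_dt_hypPoint (h : Admissible 2 φ) (hs : 0 < s) (x : Space) :
    s / (hypPoint s x).1 * dt φ (hypPoint s x) = dt (pull φ) (s, x) :=
  (dt_pull (q := (s, x)) (h.differentiable _) hs.ne').symm

theorem norm_tangentialGrad_sq (h : Admissible 2 φ) (hs : 0 < s) (x : Space) :
    ‖tangentialGrad φ (hypPoint s x)‖ ^ 2 = gradSq (pull φ) (s, x) := by
  rw [EuclideanSpace.real_norm_sq_eq]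
  refine Finset.sum_congr rfl fun i _ => ?_
  rw [dx_pull (q := (s, x)) i (h.differentiable _) hs.ne']
  rfl

theorem normL2_weighted_dt (h : Admissible 2 φ) (hs : 0 < s) :
    normL2 s (fun p => s / p.1 * dt φ p) = ENNReal.ofReal √(∫ x, dt (pull φ) (s, x) ^ 2) :=
  eLpNorm_two_eq (fun x => by
    beta_reduce
    rw [weighted_dt_hypPoint h hs, Real.norm_eq_abs, sq_abs])
    (integrable_dt_sq h.contDiff_pull (hasCompactSupport_pull h.compact) s)

theorem normL2_tangentialGrad (h : Admissible 2 φ) (hs : 0 < s) :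
    normL2 s (tangentialGrad φ) = ENNReal.ofReal √(∫ x, gradSq (pull φ) (s, x)) :=
  eLpNorm_two_eq (norm_tangentialGrad_sq h hs)
    (integrable_gradSq h.contDiff_pull (hasCompactSupport_pull h.compact) s)

theorem normL2_smul_tangentialGrad (h : Admissible 2 φ) (hs : 0 < s) (a : ℝ) :
    normL2 s (fun p => s ^ a • tangentialGrad φ p) =
      ENNReal.ofReal (s ^ a * √(∫ x, gradSq (pull φ) (s, x))) := by
  have : normL2 s (fun p => s ^ a • tangentialGrad φ p)
      = ‖s ^ a‖ₑ * normL2 s (tangentialGrad φ) :=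
    eLpNorm_const_smul (s ^ a) (fun x => tangentialGrad φ (hypPoint s x)) 2 volume
  rw [this, normL2_tangentialGrad h hs, Real.enorm_of_nonneg (by positivity),
    ENNReal.ofReal_mul (by positivity)]

theorem sqrt_flatEnergy_le_energyW (h : Admissible 2 φ) (hs : 0 < s) :
    ENNReal.ofReal √(flatEnergy (pull φ) s) ≤ energyW s φ := by
  have hu := h.contDiff_pull
  have hc := hasCompactSupport_pull h.compact
  rw [energyW, normL2_weighted_dt h hs, normL2_tangentialGrad h hs,
    ← ENNReal.ofReal_add (Real.sqrt_nonneg _) (Real.sqrt_nonneg _), flatEnergy,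
    integral_add (integrable_dt_sq hu hc s) (integrable_gradSq hu hc s)]
  refine ENNReal.ofReal_le_ofReal (Real.sqrt_le_iff.2 ⟨by positivity, ?_⟩)
  have h1 : 0 ≤ ∫ x, dt (pull φ) (s, x) ^ 2 := integral_nonneg fun x => sq_nonneg _
  have h2 : 0 ≤ ∫ x, gradSq (pull φ) (s, x) := integral_nonneg fun x => gradSq_nonneg _
  nlinarith [Real.sq_sqrt h1, Real.sq_sqrt h2, Real.sqrt_nonneg (∫ x, dt (pull φ) (s, x) ^ 2),
    Real.sqrt_nonneg (∫ x, gradSq (pull φ) (s, x)), mul_nonneg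
    (Real.sqrt_nonneg (∫ x, dt (pull φ) (s, x) ^ 2))
    (Real.sqrt_nonneg (∫ x, gradSq (pull φ) (s, x)))]

/-! #### Comparison of the weights -/

theorem hypPoint_fst (s : ℝ) (x : Space) : (hypPoint s x).1 = hypTime (s, x) := rfl

theorem hypPoint_snd (s : ℝ) (x : Space) : (hypPoint s x).2 = x := rfl

theorem sub_mul_add_hypTime (s : ℝ) (x : Space) :
    (hypTime (s, x) - ‖x‖) * (hypTime (s, x) + ‖x‖) = s ^ 2 := by
  have := hypTime_sq (s, x)
  simp only at this
  nlinarith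

theorem bracket_nonneg (y : ℝ) : 0 ≤ bracket y := Real.sqrt_nonneg _

theorem one_le_bracket (y : ℝ) : 1 ≤ bracket y :=
  Real.le_sqrt_of_sq_le (by nlinarith [sq_nonneg y])

theorem abs_le_bracket (y : ℝ) : |y| ≤ bracket y :=
  Real.abs_le_sqrt (by linarith)

theorem bracket_le (y : ℝ) (hy : 0 ≤ y) : bracket y ≤ 1 + y :=
  Real.sqrt_le_iff.2 ⟨by positivity, by nlinarith⟩

theorem sub_norm_le (hs : 0 < s) (x : Space) : hypTime (s, x) - ‖x‖ ≤ s ^ 2 / hypTime (s, x) := by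
  have hT := hypTime_pos (q := (s, x)) hs.ne'
  have h0 := norm_le_hypTime s x
  rw [le_div_iff₀ hT]
  nlinarith [sub_mul_add_hypTime s x, norm_nonneg x]

theorem le_tauPlus (s : ℝ) (x : Space) : s ≤ tauPlus (hypPoint s x) := by
  refine le_trans ?_ ((le_abs_self _).trans (abs_le_bracket _))
  have := le_hypTime s x
  simp only [hypPoint_fst, hypPoint_snd]
  linarith [norm_nonneg x]

theorem retardedWeight_eq (hs : 0 < s) (x : Space) :
    retardedWeight a (s, x) = ((s ^ 2 / hypTime (s, x)) ^ a) ^ 2 := by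
  have hT := hypTime_pos (q := (s, x)) hs.ne'
  rw [retardedWeight, ← Real.rpow_two, ← Real.rpow_mul (by positivity), Real.div_rpow (by positivity)
    hT.le, Real.rpow_neg hT.le, ← Real.rpow_natCast, ← Real.rpow_mul hs.le, mul_comm a 2,
    div_eq_mul_inv]
  push_cast
  ring_nf

/-- Since τ₀ ≤ 1, replacing the exponent max(a, 1/2) by a enlarges the weight to τ₊^a τ₀^a = τ₋^a.
Then τ₋ ≤ 1 + (t - r) ≤ 1 + s²/t, and y ↦ y^a is subadditive for a in [0, 1]. -/
theorem morawetzWeight_le (hs : 0 < s) (ha : a ∈ Set.Icc (0 : ℝ) 1) (x : Space) :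
    morawetzWeight a (hypPoint s x) ≤ 2 + (s ^ 2 / hypTime (s, x)) ^ a := by
  have hT := hypTime_pos (q := (s, x)) hs.ne'
  set p := hypPoint s x
  have hp1 : 1 ≤ tauPlus p := one_le_bracket _
  have hm1 : 1 ≤ tauMinus p := one_le_bracket _
  have h0 : 0 ≤ hypTime (s, x) - ‖x‖ := by linarith [norm_le_hypTime s x]
  have h1 : tauMinus p ≤ tauPlus p := by
    refine Real.sqrt_le_sqrt ?_
    have : p.1 - ‖p.2‖ = hypTime (s, x) - ‖x‖ := rfl
    have : p.1 + ‖p.2‖ = hypTime (s, x) + ‖x‖ := rfl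
    have := norm_nonneg x
    nlinarith
  have h2 : tauZero p ≤ 1 := (div_le_one (by linarith)).2 h1
  have h3 : 0 < tauZero p := div_pos (by linarith) (by linarith)
  have h4 : tauZero p ^ max a (1 / 2) ≤ tauZero p ^ a :=
    Real.rpow_le_rpow_of_exponent_ge h3 h2 (le_max_left _ _)
  have h5 : tauPlus p ^ a * tauZero p ^ a = tauMinus p ^ a := by
    rw [← Real.mul_rpow (by linarith) h3.le, tauZero, mul_div_cancel₀ _ (by linarith)]
  have h6 : tauMinus p ≤ 1 + s ^ 2 / hypTime (s, x) :=
    (bracket_le _ h0).trans (by linarith [sub_norm_le hs x])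
  have h7 : tauMinus p ^ a ≤ 1 + (s ^ 2 / hypTime (s, x)) ^ a := by
    refine (Real.rpow_le_rpow (by linarith) h6 ha.1).trans ?_
    have := Real.rpow_add_le_add_rpow (zero_le_one) (by positivity : 0 ≤ s ^ 2 / hypTime (s, x))
      ha.1 ha.2
    simpa using this
  have h8 : a * tauPlus p ^ a * tauZero p ^ max a (1 / 2) ≤ tauMinus p ^ a := by
    calc a * tauPlus p ^ a * tauZero p ^ max a (1 / 2)
        ≤ 1 * tauPlus p ^ a * tauZero p ^ a := by
          have : 0 ≤ tauPlus p := by linarith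
          have := ha.2
          gcongr
      _ = tauMinus p ^ a := by rw [one_mul, h5]
  unfold morawetzWeight
  linarith

theorem morawetzWeight_nonneg (ha : 0 ≤ a) (p : Spacetime) : 0 ≤ morawetzWeight a p := by
  have h1 : 0 ≤ tauPlus p := bracket_nonneg _
  have h2 : 0 ≤ tauZero p := div_nonneg (bracket_nonneg _) (bracket_nonneg _)
  unfold morawetzWeight
  positivity

/-- The weighted energy norm on `H_s` is controlled by the flat and the combined energies. -/
theorem energyWa_le (h : Admissible 2 φ) (hs : 0 < s) (ha : a ∈ Set.Icc (0 : ℝ) 1) :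
    energyWa a s φ ≤ ENNReal.ofReal (3 * √(flatEnergy (pull φ) s)
      + (2 * energyConst a + 3) * √(combinedEnergy a (pull φ) s)) := by
  have hu := h.contDiff_pull
  have hc := hasCompactSupport_pull h.compact
  have hw := hypWave_pull h
  have i1 := integrable_dt_sq hu hc s
  have i2 := integrable_gradSq hu hc s
  have i3 : Integrable fun x => retardedWeight a (s, x) * dt (pull φ) (s, x) ^ 2 := by
    have hT := (contDiff_dt (n := 1) hu).continuous
    have ck : Continuous fun q => dt (pull φ) q ^ 2 := by fun_prop
    exact integrable_slice_weight (continuous_retardedWeight hs) ck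
      (HasCompactSupport.sq (hasCompactSupport_dt hc)) s
  set A := ∫ x, dt (pull φ) (s, x) ^ 2 with hA
  set B := ∫ x, gradSq (pull φ) (s, x) with hB
  set D := ∫ x, retardedWeight a (s, x) * dt (pull φ) (s, x) ^ 2 with hD
  have hA0 : 0 ≤ A := integral_nonneg fun x => sq_nonneg _
  have hB0 : 0 ≤ B := integral_nonneg fun x => gradSq_nonneg _
  have hD0 : 0 ≤ D := integral_nonneg fun x =>
    mul_nonneg (retardedWeight_nonneg hs x) (sq_nonneg _)
  have t1 : normL2 s (fun p => morawetzWeight a p * (s / p.1 * dt φ p)) ≤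
      ENNReal.ofReal (3 * √A + 2 * √D) := by
    -- Here (2 + y)² ≤ 8 + 2y² with y = (s²/t)^a, whose square is `retardedWeight`.
    refine (eLpNorm_two_le (G := fun x => 8 * dt (pull φ) (s, x) ^ 2
      + 2 * (retardedWeight a (s, x) * dt (pull φ) (s, x) ^ 2)) (fun x => ?_)
      ((i1.const_mul 8).add (i3.const_mul 2))).trans ?_
    · beta_reduce
      rw [weighted_dt_hypPoint h hs, norm_mul, mul_pow, retardedWeight_eq hs,
        Real.norm_of_nonneg (morawetzWeight_nonneg ha.1 _), Real.norm_eq_abs, sq_abs]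
      have h1 := morawetzWeight_le hs ha x
      have h2 := pow_le_pow_left₀ (morawetzWeight_nonneg ha.1 _) h1 2
      have h3 := mul_le_mul_of_nonneg_right h2 (sq_nonneg (dt (pull φ) (s, x)))
      have h4 := mul_nonneg (sq_nonneg ((s ^ 2 / hypTime (s, x)) ^ a - 2))
        (sq_nonneg (dt (pull φ) (s, x)))
      nlinarith
    · rw [integral_add (i1.const_mul 8) (i3.const_mul 2), integral_const_mul, integral_const_mul]
      refine ENNReal.ofReal_le_ofReal (Real.sqrt_le_iff.2 ⟨by positivity, ?_⟩)
      nlinarith [Real.sq_sqrt hA0, Real.sq_sqrt hD0, mul_nonneg (Real.sqrt_nonneg A)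
        (Real.sqrt_nonneg D)]
  have t3 : ENNReal.ofReal a * normL2 s (fun p => s ^ a / p.1 * φ p) ≤
      ENNReal.ofReal (2 * (s ^ a * √B)) := by
    have h1 : normL2 s (fun p => s ^ a / p.1 * φ p) ≤ ENNReal.ofReal (2 * (s ^ a * √B)) := by
      have i4 := (integrable_sq_div_hypTime hu hc hs).const_mul ((s ^ a) ^ 2)
      refine (eLpNorm_two_le (fun x => le_of_eq ?_) i4).trans ?_
      · beta_reduce
        rw [Real.norm_eq_abs, sq_abs, hypPoint_fst, pull_apply]
        ring
      · rw [integral_const_mul]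
        refine ENNReal.ofReal_le_ofReal (Real.sqrt_le_iff.2 ⟨by positivity, ?_⟩)
        have := mul_le_mul_of_nonneg_left (hardy_hypTime hu hc hs) (sq_nonneg (s ^ a))
        rw [mul_pow, mul_pow, Real.sq_sqrt hB0]
        linarith
    calc ENNReal.ofReal a * normL2 s (fun p => s ^ a / p.1 * φ p)
        ≤ 1 * normL2 s (fun p => s ^ a / p.1 * φ p) := by
          gcongr
          exact ENNReal.ofReal_le_one.2 ha.2
      _ ≤ _ := by rwa [one_mul]
  have r1 : √A ≤ √(flatEnergy (pull φ) s) := by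
    refine Real.sqrt_le_sqrt ?_
    rw [flatEnergy, integral_add i1 i2]
    linarith
  have r2 := integral_retardedWeight_dt_le hw hs ha
  have r3 := rpow_mul_sqrt_integral_gradSq_le hw hs ha.2
  have hB1 : 0 ≤ s ^ a * √B := by positivity
  calc energyWa a s φ ≤ ENNReal.ofReal (3 * √A + 2 * √D) + ENNReal.ofReal (s ^ a * √B)
        + ENNReal.ofReal (2 * (s ^ a * √B)) :=
        add_le_add (add_le_add t1 (normL2_smul_tangentialGrad h hs a).le) t3
    _ = ENNReal.ofReal (3 * √A + 2 * √D + s ^ a * √B + 2 * (s ^ a * √B)) := by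
        rw [ENNReal.ofReal_add (p := 3 * √A + 2 * √D + s ^ a * √B) (by positivity) (by positivity),
          ENNReal.ofReal_add (p := 3 * √A + 2 * √D) (by positivity) hB1]
    _ ≤ _ := ENNReal.ofReal_le_ofReal (by linarith)

/-! #### The initial data -/

theorem abs_le_norm_pair (y : ℝ) (v : Space) : |y| ≤ ‖pair y v‖ := by
  exact WithLp.norm_fst_le (p := 2) (x := pair y v)

theorem norm_mul_dr (ψ : Spacetime → ℝ) (p : Spacetime) :
    ‖p.2‖ * dr ψ p = p.2 0 * dx 0 ψ p + p.2 1 * dx 1 ψ p + p.2 2 * dx 2 ψ p := by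
  rw [dr, fderiv_apply_eq]
  by_cases hp : p.2 = 0
  · simp [hp]
  · have := norm_ne_zero_iff.2 hp
    simp only [Fin.sum_univ_three, PiLp.smul_apply, smul_eq_mul]
    field_simp
    ring

theorem hypSq_eq : hypSq = fun p => p.1 ^ 2 - (p.2 0 ^ 2 + p.2 1 ^ 2 + p.2 2 ^ 2) := by
  funext p; rw [hypSq, norm_sq_eq_sum]

theorem differentiableAt_hypSq (p : Spacetime) : DifferentiableAt ℝ hypSq p := by
  rw [hypSq_eq]; fun_prop

theorem dt_hypSq (p : Spacetime) : dt hypSq p = 2 * p.1 := by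
  rw [hypSq_eq]
  simp (disch := fun_prop) only [dt_sub, dt_add, dt_sq, dt_time, dt_coord]
  ring

theorem dx_hypSq (i : Fin 3) (p : Spacetime) : dx i hypSq p = -(2 * p.2 i) := by
  rw [hypSq_eq]
  simp (disch := fun_prop) only [dx_sub, dx_add, dx_sq, dx_time, dx_coord]
  fin_cases i <;> simp

theorem hypSq_hypPoint (s : ℝ) (x : Space) : hypSq (hypPoint s x) = s ^ 2 := by
  have := hypTime_sq (s, x)
  simp only [hypSq, hypPoint_fst, hypPoint_snd] at *
  linarith

theorem bondiU_hypSq_mul (h : Admissible 2 φ) (hs : 0 < s) (x : Space) :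
    bondiU (fun q => hypSq q * φ q) (hypPoint s x) / hypSq (hypPoint s x)
      = pull (dt φ) (s, x) + 2 * hypTime (s, x) / s ^ 2 * pull φ (s, x) := by
  rw [bondiU, dt_mul (differentiableAt_hypSq _) (h.differentiable _), dt_hypSq, hypSq_hypPoint,
    pull_apply, pull_apply, hypPoint_fst]
  field_simp
  ring

/-- The ∂_t φ coefficients match because (t-r)² + 2rt = t² + r², and those of φ because 2(t-r)² +
4r(t-r) = 2s². Thus the conformal energy is expressed through the two Bondi derivatives in the E_II
norm. -/
theorem conformalField_pull (h : Admissible 2 φ) (hs : 0 < s) (x : Space) :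
    conformalField (pull φ) (s, x) =
      (hypTime (s, x) - ‖x‖) ^ 2 / hypTime (s, x) *
        (bondiU (fun q => hypSq q * φ q) (hypPoint s x) / hypSq (hypPoint s x))
      + 2 * ‖x‖ *
        (bondiR (fun q => hypSq q * φ q) (hypPoint s x) / hypSq (hypPoint s x)) := by
  have hT := hypTime_pos (q := (s, x)) hs.ne'
  have hd := h.differentiable (hypPoint s x)
  have hr := norm_mul_dr (fun q => hypSq q * φ q) (hypPoint s x)
  simp only [dx_mul _ (differentiableAt_hypSq _) hd, dx_hypSq, hypSq_hypPoint, hypPoint_snd] at hr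
  have hR : bondiR (fun q => hypSq q * φ q) (hypPoint s x)
      = bondiU (fun q => hypSq q * φ q) (hypPoint s x)
        + dr (fun q => hypSq q * φ q) (hypPoint s x) := rfl
  have e1 : 2 * ‖x‖ * (bondiR (fun q => hypSq q * φ q) (hypPoint s x) / s ^ 2)
      = 2 * ‖x‖ * (bondiU (fun q => hypSq q * φ q) (hypPoint s x) / s ^ 2)
        + 2 * (‖x‖ * dr (fun q => hypSq q * φ q) (hypPoint s x)) / s ^ 2 := by
    rw [hR]; ring
  have hU := bondiU_hypSq_mul h hs x
  rw [hypSq_hypPoint] at hU ⊢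
  rw [e1, hr, hU]
  have hN : conformalField (pull φ) (s, x) = s * dt (pull φ) (s, x)
      + 2 * (x 0 * dx 0 (pull φ) (s, x) + x 1 * dx 1 (pull φ) (s, x) + x 2 * dx 2 (pull φ) (s, x))
      + 2 * pull φ (s, x) := by rw [conformalField_eq]
  rw [hN, dt_pull (q := (s, x)) hd hs.ne', dx_pull (q := (s, x)) 0 hd hs.ne',
    dx_pull (q := (s, x)) 1 hd hs.ne', dx_pull (q := (s, x)) 2 hd hs.ne']
  simp only [pull_apply]
  have hs2 : s ^ 2 = hypTime (s, x) ^ 2 - ‖x‖ ^ 2 := by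
    have := hypTime_sq (s, x)
    simp only at this
    linarith
  have hn := norm_sq_eq_sum x
  set T := hypTime (s, x)
  set r := ‖x‖
  set P := φ (hypPoint s x)
  set Q := dt φ (hypPoint s x)
  have hT0 : T ≠ 0 := hT.ne'
  have hs0 : s ≠ 0 := hs.ne'
  linear_combination (norm := skip) (Q / T + 2 * P / s ^ 2) * hs2 - (2 * Q / T + 4 * P / s ^ 2) * hn
  field_simp
  ring

/-- In the splitting of N, the retarded coefficient satisfies (t-r)²/t ≤ s · (s/t), and the outgoing
one satisfies 2r ≤ τ₊ ≤ s · s^{a-1} τ₊, the last step using s ≥ 1. The gradient part s|∂̲φ| is taken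
from E_W. -/
theorem sqrt_conformalEnergy_le (h : Admissible 2 φ) (hs : 1 ≤ s) (ha : a ∈ Set.Icc (0 : ℝ) 1) :
    ENNReal.ofReal √(conformalEnergy (pull φ) s) ≤
      ENNReal.ofReal s * (energyII a s φ + energyW s φ) := by
  have hp : 0 < s := by linarith
  have hu := h.contDiff_pull
  have hc := hasCompactSupport_pull h.compact
  have hT := fun x => hypTime_pos (q := (s, x)) hp.ne'
  have iN := integrable_conformalField_sq hu hc s
  have iG := integrable_gradSq hu hc s
  set A : Space → ℝ := fun x => bondiU (fun q => hypSq q * φ q) (hypPoint s x) / hypSq (hypPoint s x)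
    with hA
  set B : Space → ℝ := fun x => bondiR (fun q => hypSq q * φ q) (hypPoint s x) / hypSq (hypPoint s x)
    with hB
  set f₁ : Space → ℝ := fun x => (hypTime (s, x) - ‖x‖) ^ 2 / hypTime (s, x) * A x with hf₁
  set f₂ : Space → ℝ := fun x => 2 * ‖x‖ * B x with hf₂
  have hN : (fun x => conformalField (pull φ) (s, x)) = f₁ + f₂ :=
    funext fun x => conformalField_pull h hp x
  have hem : Continuous fun x : Space => ((s, x) : Spacetime) := by fun_prop
  have hTc := continuous_slice_hypTime s
  have c1 : Continuous f₁ := by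
    have hAc : Continuous A := by
      have : A = fun x => pull (dt φ) (s, x) + 2 * hypTime (s, x) / s ^ 2 * pull φ (s, x) :=
        funext fun x => bondiU_hypSq_mul h hp x
      rw [this]
      have d1 : Continuous fun x => pull (dt φ) (s, x) :=
        (Admissible.dt (n := 1) h).contDiff_pull.continuous.comp hem
      have d2 : Continuous fun x => pull φ (s, x) := hu.continuous.comp hem
      fun_prop
    exact ((hTc.sub continuous_norm).pow 2).div hTc (fun x => (hT x).ne') |>.mul hAc
  -- Continuity is read off from N - f₁, since ∂_r, and with it B, may jump on the axis r = 0.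
  have c2 : Continuous f₂ := by
    have : f₂ = (fun x => conformalField (pull φ) (s, x)) - f₁ := by rw [hN]; simp
    rw [this]
    exact ((contDiff_conformalField hu).continuous.comp hem).sub c1
  have b1 : eLpNorm f₁ 2 volume ≤ ENNReal.ofReal s * normL2 s (fun p => (1 + s ^ (a - 1) * tauMinus p) •
      pair (s / p.1 * (bondiU (fun q => hypSq q * φ q) p / hypSq p)) (angularGrad φ p)) := by
    refine eLpNorm_le_mul_eLpNorm_of_ae_le_mul (Filter.Eventually.of_forall fun x => ?_) 2
    have hT := hT x
    have h1 := sub_mul_add_hypTime s x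
    have h2 : 0 ≤ hypTime (s, x) - ‖x‖ := by linarith [norm_le_hypTime s x]
    have h3 : (hypTime (s, x) - ‖x‖) ^ 2 ≤ s ^ 2 := by nlinarith [norm_nonneg x]
    have h4 : 0 ≤ tauMinus (hypPoint s x) := bracket_nonneg _
    have h5 : 1 ≤ 1 + s ^ (a - 1) * tauMinus (hypPoint s x) := by
      have := mul_nonneg (Real.rpow_nonneg hp.le (a - 1)) h4
      linarith
    rw [norm_smul, Real.norm_of_nonneg (zero_le_one.trans h5), hf₁]
    beta_reduce
    rw [Real.norm_eq_abs, abs_mul, abs_of_nonneg (by positivity)]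
    have h6 := abs_le_norm_pair (s / (hypPoint s x).1 * A x) (angularGrad φ (hypPoint s x))
    rw [abs_mul, hypPoint_fst, abs_of_nonneg (by positivity)] at h6
    calc (hypTime (s, x) - ‖x‖) ^ 2 / hypTime (s, x) * |A x|
        ≤ s ^ 2 / hypTime (s, x) * |A x| := by gcongr
      _ = s * (1 * (s / hypTime (s, x) * |A x|)) := by ring
      _ ≤ _ := by
        refine mul_le_mul_of_nonneg_left ?_ hp.le
        exact mul_le_mul h5 h6 (by positivity) (by linarith)
  have b2 : eLpNorm f₂ 2 volume ≤ ENNReal.ofReal s * normL2 s (fun p => (s ^ (a - 1) * tauPlus p) •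
      pair (bondiR (fun q => hypSq q * φ q) p / hypSq p) ((s / p.1) • angularGrad φ p)) := by
    refine eLpNorm_le_mul_eLpNorm_of_ae_le_mul (Filter.Eventually.of_forall fun x => ?_) 2
    have h4 : 2 * ‖x‖ ≤ tauPlus (hypPoint s x) := by
      refine le_trans ?_ ((le_abs_self _).trans (abs_le_bracket _))
      rw [hypPoint_fst, hypPoint_snd]
      linarith [norm_le_hypTime s x]
    have h5 : 0 ≤ tauPlus (hypPoint s x) := bracket_nonneg _
    have h6 := abs_le_norm_pair (B x) ((s / (hypPoint s x).1) • angularGrad φ (hypPoint s x))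
    have h7 : 1 ≤ s * s ^ (a - 1) := by
      have : s * s ^ (a - 1) = s ^ a := by
        rw [Real.rpow_sub_one hp.ne']; field_simp
      rw [this]
      exact Real.one_le_rpow hs ha.1
    have h8 : 0 ≤ s ^ (a - 1) * tauPlus (hypPoint s x) :=
      mul_nonneg (Real.rpow_nonneg hp.le _) h5
    rw [norm_smul, Real.norm_of_nonneg h8, hf₂]
    beta_reduce
    rw [Real.norm_eq_abs, abs_mul, abs_of_nonneg (by positivity)]
    calc 2 * ‖x‖ * |B x| ≤ 1 * tauPlus (hypPoint s x) * |B x| := by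
          rw [one_mul]; gcongr
      _ ≤ (s * s ^ (a - 1)) * tauPlus (hypPoint s x) *
          ‖pair (B x) ((s / (hypPoint s x).1) • angularGrad φ (hypPoint s x))‖ := by gcongr
      _ = _ := by ring
  have hNorm : ENNReal.ofReal √(∫ x, conformalField (pull φ) (s, x) ^ 2)
      ≤ ENNReal.ofReal s * energyII a s φ := by
    rw [← eLpNorm_two_eq (f := fun x => conformalField (pull φ) (s, x))
      (fun x => by rw [Real.norm_eq_abs, sq_abs]) iN, hN, energyII, mul_add]
    exact (eLpNorm_add_le c1.aestronglyMeasurable c2.aestronglyMeasurable (by norm_num)).trans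
      (add_le_add b1 b2)
  have hG : ENNReal.ofReal √(∫ x, gradSq (pull φ) (s, x)) ≤ energyW s φ := by
    rw [energyW, ← normL2_tangentialGrad h hp]
    exact le_add_self
  have hN0 : 0 ≤ ∫ x, conformalField (pull φ) (s, x) ^ 2 := integral_nonneg fun x => sq_nonneg _
  have hG0 : 0 ≤ ∫ x, gradSq (pull φ) (s, x) := integral_nonneg fun x => gradSq_nonneg _
  calc ENNReal.ofReal √(conformalEnergy (pull φ) s)
      ≤ ENNReal.ofReal (√(∫ x, conformalField (pull φ) (s, x) ^ 2)
          + s * √(∫ x, gradSq (pull φ) (s, x))) := by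
        refine ENNReal.ofReal_le_ofReal (Real.sqrt_le_iff.2 ⟨by positivity, ?_⟩)
        rw [conformalEnergy, integral_add iN (iG.const_mul _), integral_const_mul]
        have := mul_nonneg (Real.sqrt_nonneg (∫ x, conformalField (pull φ) (s, x) ^ 2))
          (mul_nonneg hp.le (Real.sqrt_nonneg (∫ x, gradSq (pull φ) (s, x))))
        nlinarith [Real.sq_sqrt hN0, Real.sq_sqrt hG0]
    _ = ENNReal.ofReal √(∫ x, conformalField (pull φ) (s, x) ^ 2)
          + ENNReal.ofReal s * ENNReal.ofReal √(∫ x, gradSq (pull φ) (s, x)) := by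
        rw [ENNReal.ofReal_add (by positivity) (by positivity), ENNReal.ofReal_mul hp.le]
    _ ≤ _ := by
        rw [mul_add]
        exact add_le_add hNorm (by gcongr)

/-! #### The source -/

theorem rpow_mul_sliceNorm_le (hc : HasCompactSupport φ) (hs : 0 < s)
    (h : Continuous (pull φ)) (ha : 0 ≤ a) :
    ENNReal.ofReal (s ^ a * sliceNorm (pull φ) s) ≤ normL2 s (fun p => tauPlus p ^ a * φ p) := by
  have e : ENNReal.ofReal (sliceNorm (pull φ) s) = normL2 s φ :=
    (eLpNorm_two_eq (fun x => by rw [Real.norm_eq_abs, sq_abs]; rfl)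
      (integrable_slice_sq h (hasCompactSupport_pull hc) s)).symm
  have e2 : ENNReal.ofReal (s ^ a * sliceNorm (pull φ) s) = normL2 s (fun p => s ^ a • φ p) := by
    rw [ENNReal.ofReal_mul (by positivity), e, ← Real.enorm_of_nonneg (by positivity)]
    exact (eLpNorm_const_smul (s ^ a) (fun x => φ (hypPoint s x)) 2 volume).symm
  rw [e2]
  refine eLpNorm_mono fun x => ?_
  beta_reduce
  rw [smul_eq_mul, norm_mul, norm_mul]
  refine mul_le_mul_of_nonneg_right ?_ (norm_nonneg _)
  have h0 : 0 ≤ tauPlus (hypPoint s x) := bracket_nonneg _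
  rw [Real.norm_of_nonneg (by positivity), Real.norm_of_nonneg (by positivity)]
  exact Real.rpow_le_rpow hs.le (le_tauPlus s x) ha

theorem integral_sliceNorm_le_sourceNorm (hb : Admissible 0 φ) (hs₀ : 1 ≤ s₀)
    (hs : s ∈ Set.Icc s₀ s₁) (ha : 0 ≤ a) :
    ENNReal.ofReal (∫ r in s₀..s, r ^ a * sliceNorm (pull φ) r) ≤ sourceNorm a s₀ s₁ φ := by
  have hpos : ∀ r ∈ Set.Icc s₀ s, 0 < r := fun r hr => by linarith [hr.1]
  have hc := hb.contDiff_pull.continuous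
  have hcont : ContinuousOn (fun r => r ^ a * sliceNorm (pull φ) r) (Set.Icc s₀ s) :=
    (continuousOn_id.rpow_const fun r hr => Or.inl (hpos r hr).ne').mul
      (continuous_sliceNorm hc (hasCompactSupport_pull hb.compact)).continuousOn
  rw [intervalIntegral.integral_of_le hs.1, ← integral_Icc_eq_integral_Ioc,
    ofReal_integral_eq_lintegral_ofReal hcont.integrableOn_Icc
      ((ae_restrict_iff' measurableSet_Icc).2 (Filter.Eventually.of_forall fun r hr =>
        mul_nonneg (Real.rpow_nonneg (hpos r hr).le _) (sliceNorm_nonneg _ _)))]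
  refine (setLIntegral_mono' measurableSet_Icc fun r hr => ?_).trans
    (lintegral_mono_set (Set.Icc_subset_Icc_right hs.2))
  exact rpow_mul_sliceNorm_le hb.compact (hpos r hr) hc ha

/-- The weighted energy estimate without derivatives. -/
theorem energyWa_estimate (h : Admissible 2 φ) (hs₀ : 1 ≤ s₀) (hs : s ∈ Set.Icc s₀ s₁)
    (ha : a ∈ Set.Icc (0 : ℝ) 1) :
    energyWa a s φ ≤ ENNReal.ofReal (3 + 2 * (2 * energyConst a + 3)) * ENNReal.ofReal (2 * s₀) *
      (energyII a s₀ φ + energyW s₀ φ + sourceNorm a s₀ s₁ (box φ)) := by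
  have hw := hypWave_pull h
  have hb : Admissible 0 (box φ) := Admissible.box (n := 0) h
  have hp0 : 0 < s₀ := by linarith
  have hp : 0 < s := by linarith [hs.1]
  have hE : 0 ≤ energyConst a := by unfold energyConst; split_ifs <;> positivity
  set u := pull φ
  set f := pull (box φ)
  set I := ∫ r in s₀..s, r ^ a * sliceNorm f r with hI
  have hpos : ∀ r ∈ Set.Icc s₀ s, 1 ≤ r := fun r hr => by linarith [hr.1]
  have cf := continuous_sliceNorm hw.source_continuous hw.source_compact
  have hcont : ContinuousOn (fun r => r ^ a * sliceNorm f r) (Set.Icc s₀ s) :=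
    (continuousOn_id.rpow_const fun r hr => Or.inl (by
      have := hpos r hr
      simp only [id]
      linarith)).mul cf.continuousOn
  have hI0 : 0 ≤ I := intervalIntegral.integral_nonneg hs.1 fun r hr =>
    mul_nonneg (Real.rpow_nonneg (by linarith [hpos r hr]) _) (sliceNorm_nonneg _ _)
  have h1 : √(flatEnergy u s) ≤ √(flatEnergy u s₀) + I := by
    refine (sqrt_flatEnergy_le hw hs₀ hs.1).trans (add_le_add_right ?_ _)
    refine intervalIntegral.integral_mono_on hs.1 (cf.intervalIntegrable _ _)
      (hcont.intervalIntegrable_of_Icc hs.1) fun r hr => ?_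
    exact le_mul_of_one_le_left (sliceNorm_nonneg _ _) (Real.one_le_rpow (hpos r hr) ha.1)
  have h2 : √(combinedEnergy a u s) ≤ √(conformalEnergy u s₀) + s₀ * √(flatEnergy u s₀) + 2 * I := by
    have := sqrt_combinedEnergy_le_add hw hs₀ hs.1 ha
    rw [intervalIntegral.integral_const_mul] at this
    linarith [sqrt_combinedEnergy_le hw hs₀ ha]
  set X := √(flatEnergy u s₀) with hX
  set Y := √(conformalEnergy u s₀) with hY
  have hX0 : 0 ≤ X := Real.sqrt_nonneg _
  have hY0 : 0 ≤ Y := Real.sqrt_nonneg _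
  have hXE := sqrt_flatEnergy_le_energyW h hp0
  have hYE := sqrt_conformalEnergy_le h hs₀ ha
  have hIE := integral_sliceNorm_le_sourceNorm hb hs₀ hs ha.1
  have hs1 : 1 ≤ ENNReal.ofReal s₀ := ENNReal.one_le_ofReal.2 hs₀
  calc energyWa a s φ
      ≤ ENNReal.ofReal (3 * √(flatEnergy u s) + (2 * energyConst a + 3) * √(combinedEnergy a u s)) :=
        energyWa_le h hp ha
    _ ≤ ENNReal.ofReal ((3 + 2 * (2 * energyConst a + 3)) * (Y + s₀ * X + I)) := by
        refine ENNReal.ofReal_le_ofReal ?_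
        have k1 := mul_le_mul_of_nonneg_left h2 (by linarith : 0 ≤ 2 * energyConst a + 3)
        have k2 : X ≤ s₀ * X := le_mul_of_one_le_left hX0 hs₀
        have k3 : 0 ≤ (2 * energyConst a + 3) * Y := by positivity
        have k4 : 0 ≤ (2 * energyConst a + 3) * (s₀ * X) := by positivity
        nlinarith
    _ = ENNReal.ofReal (3 + 2 * (2 * energyConst a + 3)) * (ENNReal.ofReal Y
          + ENNReal.ofReal s₀ * ENNReal.ofReal X + ENNReal.ofReal I) := by
        rw [ENNReal.ofReal_mul (by positivity), ENNReal.ofReal_add (by positivity) hI0,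
          ENNReal.ofReal_add hY0 (by positivity), ENNReal.ofReal_mul hp0.le]
    -- The factor 2 arises because E_W is used twice: for the gradient part of the conformal energy
    -- and for the standard energy.
    _ ≤ ENNReal.ofReal (3 + 2 * (2 * energyConst a + 3)) * (ENNReal.ofReal (2 * s₀) *
          (energyII a s₀ φ + energyW s₀ φ + sourceNorm a s₀ s₁ (box φ))) := by
        refine mul_le_mul_right ?_ _
        have e : ENNReal.ofReal (2 * s₀) = ENNReal.ofReal s₀ + ENNReal.ofReal s₀ := by
          rw [← ENNReal.ofReal_add hp0.le hp0.le]; ring_nf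
        set S := ENNReal.ofReal s₀
        set E2 := energyII a s₀ φ
        set EW := energyW s₀ φ
        set N := sourceNorm a s₀ s₁ (box φ)
        have m1 : N ≤ S * N := le_mul_of_one_le_left zero_le hs1
        have m2 : S * ENNReal.ofReal X ≤ S * EW := by gcongr
        calc ENNReal.ofReal Y + S * ENNReal.ofReal X + ENNReal.ofReal I
            ≤ S * (E2 + EW) + S * EW + S * N :=
              add_le_add (add_le_add hYE m2) (hIE.trans m1)
          _ ≤ S * (E2 + EW) + S * EW + S * N + (S * E2 + S * N) := le_self_add
          _ = (S + S) * (E2 + EW + N) := by ring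
          _ = _ := by rw [e]
    _ = _ := by rw [mul_assoc]

end Norms

/-! ### Commutation of the vector fields with the wave operator -/

section Commute

variable {φ : Spacetime → ℝ} {n m : ℕ} (i j : Fin 3)

theorem dx_dt_eq (h : Admissible 2 φ) : dx i (dt φ) = dt (dx i φ) :=
  funext fun _ => dx_dt_comm i h.contDiff.contDiffAt

theorem dx_dx_eq (h : Admissible 2 φ) : dx i (dx j φ) = dx j (dx i φ) :=
  funext fun _ => dx_dx_comm i j h.contDiff.contDiffAt

theorem Admissible.differentiable_succ (h : Admissible (n + 1) φ) : Differentiable ℝ φ :=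
  h.contDiff.differentiable (by norm_cast)

theorem box_dt (h : Admissible 3 φ) : box (dt φ) = dt (box φ) := by
  have h2 : Admissible 2 φ := h.mono (by norm_num)
  have htt := (Admissible.dt (n := 1) h.dt).differentiable_succ
  have hxx := fun i => (Admissible.dx (n := 1) i (h.dx i)).differentiable_succ
  have h0 := hxx 0
  have h1 := hxx 1
  have h3 := hxx 2
  funext p
  rw [box_eq φ]
  simp (disch := fun_prop) only [dt_add, dt_mul, dt_const]
  simp only [box, Fin.sum_univ_three, dx_dt_eq _ h2, dx_dt_eq _ (h.dx _)]
  ring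

theorem box_dx (h : Admissible 3 φ) : box (dx i φ) = dx i (box φ) := by
  have h2 : Admissible 2 φ := h.mono (by norm_num)
  have htt := (Admissible.dt (n := 1) h.dt).differentiable_succ
  have hxx := fun i => (Admissible.dx (n := 1) i (h.dx i)).differentiable_succ
  have h0 := hxx 0
  have h1 := hxx 1
  have h3 := hxx 2
  funext p
  rw [box_eq φ]
  simp (disch := fun_prop) only [dx_add, dx_mul, dx_const]
  simp only [box, Fin.sum_univ_three, ← dx_dt_eq _ h2, ← dx_dt_eq _ h.dt, dx_dx_eq _ i h2,
    dx_dx_eq _ i (h.dx _)]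
  ring

theorem boost_eq (φ : Spacetime → ℝ) :
    boost i φ = fun p => p.1 * dx i φ p + p.2 i * dt φ p := rfl

theorem dt_boost (h : Admissible 2 φ) :
    dt (boost i φ) = fun p => dx i φ p + p.1 * dt (dx i φ) p + p.2 i * dt (dt φ) p := by
  have h0 := (Admissible.dt (n := 1) h).differentiable_succ
  have h1 := (Admissible.dx (n := 1) i h).differentiable_succ
  funext p
  rw [boost_eq]
  simp (disch := fun_prop) only [dt_add, dt_mul, dt_time, dt_coord]
  ring

theorem dx_boost (h : Admissible 2 φ) :
    dx j (boost i φ) = fun p => p.1 * dx j (dx i φ) p + (if j = i then 1 else 0) * dt φ p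
      + p.2 i * dx j (dt φ) p := by
  have h0 := (Admissible.dt (n := 1) h).differentiable_succ
  have h1 := (Admissible.dx (n := 1) i h).differentiable_succ
  funext p
  rw [boost_eq]
  simp (disch := fun_prop) only [dx_add, dx_mul, dx_time, dx_coord]
  ring

/-- The cross terms cancel: -∂_t² applied to t ∂_i φ leaves -2 ∂_t∂_i φ, while Δ applied to x^i ∂_t
φ leaves +2 ∂_i∂_t φ. -/
theorem box_boost (h : Admissible 3 φ) : box (boost i φ) = boost i (box φ) := by
  have h2 : Admissible 2 φ := h.mono (by norm_num)
  have g0 := (Admissible.dt (n := 2) h).differentiable_succ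
  have g1 := (Admissible.dx (n := 2) i h).differentiable_succ
  have g2 := (Admissible.dt (n := 1) h.dt).differentiable_succ
  have g3 := (Admissible.dt (n := 1) (h.dx i)).differentiable_succ
  have g4 := fun j => (Admissible.dx (n := 1) j (h.dx i)).differentiable_succ
  have g5 := fun j => (Admissible.dx (n := 1) j h.dt).differentiable_succ
  funext p
  have e1 : dt (dt (boost i φ)) p = 2 * dt (dx i φ) p + p.1 * dt (dt (dx i φ)) p
      + p.2 i * dt (dt (dt φ)) p := by
    rw [dt_boost i h2]
    simp (disch := fun_prop) only [dt_add, dt_mul, dt_time, dt_coord]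
    ring
  have e2 : ∀ j, dx j (dx j (boost i φ)) p = p.1 * dx j (dx j (dx i φ)) p
      + 2 * ((if j = i then 1 else 0) * dx j (dt φ) p) + p.2 i * dx j (dx j (dt φ)) p := by
    intro j
    have := g4 j
    have := g5 j
    rw [dx_boost i j h2]
    simp (disch := fun_prop) only [dx_add, dx_mul, dx_time, dx_coord, dx_const]
    ring
  have e3 : boost i (box φ) p = p.1 * box (dx i φ) p + p.2 i * box (dt φ) p := by
    rw [box_dx i h, box_dt h]; rfl
  rw [e3]
  simp only [box, e1, e2, Fin.sum_univ_three]
  have e4 : dt (dx i φ) p = dx i (dt φ) p := by rw [dx_dt_eq i h2]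
  rw [e4]
  fin_cases i <;> simp <;> ring

theorem partialD_zero : partialD 0 = dt := rfl

theorem partialD_succ : partialD i.succ = dx i := rfl

theorem Admissible.partialD (h : Admissible (n + 1) φ) (α : Fin 4) :
    Admissible n (partialD α φ) := by
  refine Fin.cases ?_ (fun i => ?_) α
  · exact h.dt
  · exact h.dx i

theorem box_partialD (h : Admissible 3 φ) (α : Fin 4) :
    box (partialD α φ) = partialD α (box φ) := by
  refine Fin.cases ?_ (fun i => ?_) α
  · exact box_dt h
  · exact box_dx i h

theorem partialD_comm (h : Admissible 2 φ) (α β : Fin 4) :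
    partialD α (partialD β φ) = partialD β (partialD α φ) := by
  refine Fin.cases ?_ (fun i => ?_) α <;> refine Fin.cases ?_ (fun j => ?_) β
  · rfl
  · exact (dx_dt_eq j h).symm
  · exact dx_dt_eq i h
  · exact dx_dx_eq i j h

section Iterate

variable {X : (Spacetime → ℝ) → Spacetime → ℝ}

theorem Admissible.iterate (hX : ∀ {n φ}, Admissible (n + 1) φ → Admissible n (X φ)) (m : ℕ) :
    ∀ {n φ}, Admissible (n + m) φ → Admissible n (X^[m] φ) := by
  induction m with
  | zero => exact fun h => h
  | succ m ih => exact fun h => ih (hX h)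

theorem box_iterate (hX : ∀ {n φ}, Admissible (n + 1) φ → Admissible n (X φ))
    (hb : ∀ {φ}, Admissible 3 φ → box (X φ) = X (box φ)) (m : ℕ) :
    ∀ {φ}, Admissible (2 + m) φ → box (X^[m] φ) = X^[m] (box φ) := by
  induction m with
  | zero => exact fun _ => rfl
  | succ m ih =>
    intro φ h
    rw [Function.iterate_succ_apply, Function.iterate_succ_apply, ih (hX h),
      hb (h.mono (by omega))]

end Iterate

theorem Admissible.boostPow {J : Fin 3 → ℕ} (h : Admissible (n + ∑ i, J i) φ) :
    Admissible n (boostPow J φ) := by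
  rw [Fin.sum_univ_three] at h
  have hX := fun (i : Fin 3) {n φ} (h : Admissible (n + 1) φ) => Admissible.boost (φ := φ) i h
  exact Admissible.iterate (hX 0) _ (Admissible.iterate (hX 1) _ (Admissible.iterate (hX 2) _
    (h.mono (by omega))))

theorem Admissible.partialPow {I : Fin 4 → ℕ} (h : Admissible (n + ∑ α, I α) φ) :
    Admissible n (partialPow I φ) := by
  rw [Fin.sum_univ_four] at h
  have hX := fun (α : Fin 4) {n φ} (h : Admissible (n + 1) φ) => Admissible.partialD (φ := φ) h α
  exact Admissible.iterate (hX 0) _ (Admissible.iterate (hX 1) _ (Admissible.iterate (hX 2) _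
    (Admissible.iterate (hX 3) _ (h.mono (by omega)))))

theorem box_boostPow {J : Fin 3 → ℕ} (h : Admissible (2 + ∑ i, J i) φ) :
    box (boostPow J φ) = boostPow J (box φ) := by
  rw [Fin.sum_univ_three] at h
  have hX := fun (i : Fin 3) {n φ} (h : Admissible (n + 1) φ) => Admissible.boost (φ := φ) i h
  have hb := fun (i : Fin 3) {φ} (h : Admissible 3 φ) => box_boost (φ := φ) i h
  have h2 : Admissible (2 + J 0 + J 1) ((boost 2)^[J 2] φ) :=
    Admissible.iterate (hX 2) _ (h.mono (by omega))
  have h1 : Admissible (2 + J 0) ((boost 1)^[J 1] ((boost 2)^[J 2] φ)) :=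
    Admissible.iterate (hX 1) _ (h2.mono (by omega))
  unfold boostPow
  rw [box_iterate (hX 0) (hb 0) _ h1, box_iterate (hX 1) (hb 1) _ (h2.mono (by omega)),
    box_iterate (hX 2) (hb 2) _ (h.mono (by omega))]

theorem box_partialPow {I : Fin 4 → ℕ} (h : Admissible (2 + ∑ α, I α) φ) :
    box (partialPow I φ) = partialPow I (box φ) := by
  rw [Fin.sum_univ_four] at h
  have hX := fun (α : Fin 4) {n φ} (h : Admissible (n + 1) φ) => Admissible.partialD (φ := φ) h α
  have hb := fun (α : Fin 4) {φ} (h : Admissible 3 φ) => box_partialD (φ := φ) h α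
  have h3 : Admissible (2 + I 0 + I 1 + I 2) ((partialD 3)^[I 3] φ) :=
    Admissible.iterate (hX 3) _ (h.mono (by omega))
  have h2 : Admissible (2 + I 0 + I 1) ((partialD 2)^[I 2] ((partialD 3)^[I 3] φ)) :=
    Admissible.iterate (hX 2) _ (h3.mono (by omega))
  have h1 : Admissible (2 + I 0) ((partialD 1)^[I 1] ((partialD 2)^[I 2] ((partialD 3)^[I 3] φ))) :=
    Admissible.iterate (hX 1) _ (h2.mono (by omega))
  unfold partialPow
  rw [box_iterate (hX 0) (hb 0) _ h1, box_iterate (hX 1) (hb 1) _ (h2.mono (by omega)),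
    box_iterate (hX 2) (hb 2) _ (h3.mono (by omega)), box_iterate (hX 3) (hb 3) _ (h.mono (by omega))]

/-- The operator `∂^I L^J`. -/
def fieldPow (IJ : (Fin 4 → ℕ) × (Fin 3 → ℕ)) (φ : Spacetime → ℝ) : Spacetime → ℝ :=
  partialPow IJ.1 (boostPow IJ.2 φ)

/-- The order `|I| + |J|`. -/
def order (IJ : (Fin 4 → ℕ) × (Fin 3 → ℕ)) : ℕ := ∑ α, IJ.1 α + ∑ i, IJ.2 i

variable {IJ : (Fin 4 → ℕ) × (Fin 3 → ℕ)}

theorem mem_multiIndices_iff {k : ℕ} : IJ ∈ multiIndices k ↔ order IJ ≤ k :=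
  mem_multiIndices k IJ.1 IJ.2

theorem Admissible.fieldPow (h : Admissible (n + order IJ) φ) : Admissible n (fieldPow IJ φ) := by
  refine Admissible.partialPow (Admissible.boostPow (h.mono ?_))
  rw [order]
  omega

theorem box_fieldPow (h : Admissible (2 + order IJ) φ) :
    box (fieldPow IJ φ) = fieldPow IJ (box φ) := by
  have h1 : Admissible (2 + ∑ α, IJ.1 α + ∑ i, IJ.2 i) φ := h.mono (by rw [order]; omega)
  rw [Hyperboloidal.fieldPow, box_partialPow (Admissible.boostPow h1),
    box_boostPow (h.mono (by rw [order]; omega))]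
  rfl

end Commute

/-! ### Reordering the vector fields -/

section Reorder

variable {φ : Spacetime → ℝ} {n m : ℕ}

/-- Polynomials in `1 / t` and `x^i / t`. -/
inductive Coef : (Spacetime → ℝ) → Prop
  | const (c : ℝ) : Coef fun _ => c
  | inv : Coef fun p => p.1⁻¹
  | ratio (i : Fin 3) : Coef fun p => p.2 i * p.1⁻¹
  | add {c d : Spacetime → ℝ} : Coef c → Coef d → Coef fun p => c p + d p
  | mul {c d : Spacetime → ℝ} : Coef c → Coef d → Coef fun p => c p * d p

theorem differentiableAt_inv_time {p : Spacetime} (hp : 0 < p.1) :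
    DifferentiableAt ℝ (fun p : Spacetime => p.1⁻¹) p :=
  differentiableAt_fst.inv hp.ne'

theorem Coef.differentiableAt {c : Spacetime → ℝ} (hc : Coef c) {p : Spacetime} (hp : 0 < p.1) :
    DifferentiableAt ℝ c p := by
  have := differentiableAt_inv_time hp
  induction hc with
  | const c => fun_prop
  | inv => exact this
  | ratio i => fun_prop
  | add _ _ h1 h2 => exact h1.add h2
  | mul _ _ h1 h2 => exact h1.mul h2

theorem Coef.bounded {c : Spacetime → ℝ} (hc : Coef c) :
    ∃ M, ∀ p : Spacetime, 1 ≤ p.1 → ‖p.2‖ ≤ p.1 → |c p| ≤ M := by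
  induction hc with
  | const c => exact ⟨|c|, fun p _ _ => le_rfl⟩
  | inv => exact ⟨1, fun p h1 _ => by
      rw [abs_of_nonneg (by positivity)]; exact inv_le_one_of_one_le₀ h1⟩
  | ratio i => exact ⟨1, fun p h1 h2 => by
      have h3 : |p.2 i| ≤ ‖p.2‖ := PiLp.norm_apply_le p.2 i
      rw [abs_mul, abs_of_nonneg (by positivity : 0 ≤ p.1⁻¹), ← div_eq_mul_inv,
        div_le_one (by linarith)]
      exact h3.trans h2⟩
  | @add c d _ _ h1 h2 =>
    obtain ⟨M, hM⟩ := h1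
    obtain ⟨N, hN⟩ := h2
    exact ⟨M + N, fun p h h' => (abs_add_le _ _).trans (add_le_add (hM p h h') (hN p h h'))⟩
  | @mul c d _ _ h1 h2 =>
    obtain ⟨M, hM⟩ := h1
    obtain ⟨N, hN⟩ := h2
    refine ⟨M * N, fun p h h' => ?_⟩
    rw [abs_mul]
    exact mul_le_mul (hM p h h') (hN p h h') (abs_nonneg _) ((abs_nonneg _).trans (hM p h h'))

/-- First-order derivations that preserve the polynomials in `1 / t` and `x^i / t`. -/
structure IsDerivation (X : (Spacetime → ℝ) → Spacetime → ℝ) : Prop where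
  add : ∀ {f g : Spacetime → ℝ} {p : Spacetime}, DifferentiableAt ℝ f p → DifferentiableAt ℝ g p →
    X (fun q => f q + g q) p = X f p + X g p
  mul : ∀ {f g : Spacetime → ℝ} {p : Spacetime}, DifferentiableAt ℝ f p → DifferentiableAt ℝ g p →
    X (fun q => f q * g q) p = X f p * g p + f p * X g p
  congr : ∀ {f g : Spacetime → ℝ} {p : Spacetime}, f =ᶠ[nhds p] g → X f p = X g p
  const : ∀ {c : ℝ} {p : Spacetime}, X (fun _ => c) p = 0
  inv : ∃ c, Coef c ∧ ∀ p : Spacetime, 0 < p.1 → X (fun p => p.1⁻¹) p = c p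
  ratio : ∀ i : Fin 3, ∃ c, Coef c ∧ ∀ p : Spacetime, 0 < p.1 → X (fun p => p.2 i * p.1⁻¹) p = c p

theorem IsDerivation.coef {X : (Spacetime → ℝ) → Spacetime → ℝ} (hX : IsDerivation X)
    {c : Spacetime → ℝ} (hc : Coef c) :
    ∃ d, Coef d ∧ ∀ p : Spacetime, 0 < p.1 → X c p = d p := by
  induction hc with
  | const c => exact ⟨_, Coef.const 0, fun p _ => hX.const⟩
  | inv => exact hX.inv
  | ratio i => exact hX.ratio i
  | @add c d hc hd h1 h2 =>
    obtain ⟨c', hc', e1⟩ := h1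
    obtain ⟨d', hd', e2⟩ := h2
    exact ⟨_, hc'.add hd', fun p hp => by
      rw [hX.add (hc.differentiableAt hp) (hd.differentiableAt hp), e1 p hp, e2 p hp]⟩
  | @mul c d hc hd h1 h2 =>
    obtain ⟨c', hc', e1⟩ := h1
    obtain ⟨d', hd', e2⟩ := h2
    exact ⟨_, (hc'.mul hd).add (hc.mul hd'), fun p hp => by
      rw [hX.mul (hc.differentiableAt hp) (hd.differentiableAt hp), e1 p hp, e2 p hp]⟩

theorem dt_inv_time {p : Spacetime} (hp : 0 < p.1) :
    dt (fun p => p.1⁻¹) p = (-1) * (p.1⁻¹ * p.1⁻¹) := by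
  rw [dt_comp (f := fun p : Spacetime => p.1) (h := fun y => y⁻¹) (hasDerivAt_inv hp.ne')
    (by fun_prop), dt_time]
  field_simp

theorem dx_inv_time (i : Fin 3) {p : Spacetime} (hp : 0 < p.1) :
    dx i (fun p => p.1⁻¹) p = 0 := by
  rw [dx_comp i (f := fun p : Spacetime => p.1) (h := fun y => y⁻¹) (hasDerivAt_inv hp.ne')
    (by fun_prop), dx_time, mul_zero]

theorem dt_ratio (i : Fin 3) {p : Spacetime} (hp : 0 < p.1) :
    dt (fun p => p.2 i * p.1⁻¹) p = (-1) * ((p.2 i * p.1⁻¹) * p.1⁻¹) := by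
  rw [dt_mul (by fun_prop) (differentiableAt_inv_time hp), dt_inv_time hp, dt_coord]
  ring

theorem dx_ratio (i j : Fin 3) {p : Spacetime} (hp : 0 < p.1) :
    dx j (fun p => p.2 i * p.1⁻¹) p = (if j = i then 1 else 0) * p.1⁻¹ := by
  rw [dx_mul j (by fun_prop) (differentiableAt_inv_time hp), dx_inv_time j hp, dx_coord]
  ring

theorem isDerivation_dt : IsDerivation dt where
  add := dt_add
  mul := dt_mul
  congr := dt_congr
  const := dt_const _
  inv := ⟨_, (Coef.const (-1)).mul (Coef.inv.mul Coef.inv), fun _ hp => dt_inv_time hp⟩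
  ratio i := ⟨_, (Coef.const (-1)).mul ((Coef.ratio i).mul Coef.inv), fun _ hp => dt_ratio i hp⟩

theorem isDerivation_dx (j : Fin 3) : IsDerivation (dx j) where
  add := dx_add j
  mul := dx_mul j
  congr := dx_congr j
  const := dx_const j _
  inv := ⟨_, Coef.const 0, fun _ hp => dx_inv_time j hp⟩
  ratio i := ⟨_, (Coef.const (if j = i then 1 else 0)).mul Coef.inv, fun _ hp => dx_ratio i j hp⟩

theorem isDerivation_partialD (α : Fin 4) : IsDerivation (partialD α) := by
  refine Fin.cases ?_ (fun i => ?_) α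
  · exact isDerivation_dt
  · exact isDerivation_dx i

theorem isDerivation_boost (j : Fin 3) : IsDerivation (boost j) where
  add hf hg := by simp only [boost]; rw [dt_add hf hg, dx_add j hf hg]; ring
  mul hf hg := by simp only [boost]; rw [dt_mul hf hg, dx_mul j hf hg]; ring
  congr h := by simp only [boost]; rw [dt_congr h, dx_congr j h]
  const := by simp [boost]
  inv := ⟨_, (Coef.const (-1)).mul ((Coef.ratio j).mul Coef.inv), fun p hp => by
    rw [boost, dt_inv_time hp, dx_inv_time j hp]; ring⟩
  ratio i := ⟨_, (Coef.const (if j = i then 1 else 0)).add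
    ((Coef.const (-1)).mul ((Coef.ratio j).mul (Coef.ratio i))), fun p hp => by
      rw [boost, dt_ratio i hp, dx_ratio i j hp]
      field_simp⟩

end Reorder

/-! ### Moving a boost into an ordered product of vector fields. -/

section Reorder

variable {φ : Spacetime → ℝ} {n m : ℕ}

theorem partialD_iterate (α β : Fin 4) (n : ℕ) : ∀ {φ}, Admissible (n + 1) φ →
    partialD α ((partialD β)^[n] φ) = (partialD β)^[n] (partialD α φ) := by
  induction n with
  | zero => exact fun _ => rfl
  | succ n ih =>
    intro φ h
    rw [Function.iterate_succ_apply, Function.iterate_succ_apply, ih (h.partialD β),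
      partialD_comm (h.mono (by omega))]

theorem partialD_partialPow (α : Fin 4) {I : Fin 4 → ℕ} (h : Admissible (1 + ∑ α, I α) φ) :
    partialD α (partialPow I φ) = partialPow (I + Pi.single α 1) φ := by
  rw [Fin.sum_univ_four] at h
  have hX := fun (α : Fin 4) {n φ} (h : Admissible (n + 1) φ) => Admissible.partialD (φ := φ) h α
  have h3 : Admissible (I 0 + I 1 + I 2 + 1) ((partialD 3)^[I 3] φ) :=
    Admissible.iterate (hX 3) _ (h.mono (by omega))
  have h2 : Admissible (I 0 + I 1 + 1) ((partialD 2)^[I 2] ((partialD 3)^[I 3] φ)) :=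
    Admissible.iterate (hX 2) _ (h3.mono (by omega))
  have h1 : Admissible (I 0 + 1) ((partialD 1)^[I 1] ((partialD 2)^[I 2] ((partialD 3)^[I 3] φ))) :=
    Admissible.iterate (hX 1) _ (h2.mono (by omega))
  unfold partialPow
  match α with
  | 0 => simp [Function.iterate_succ_apply']
  | 1 => rw [partialD_iterate _ _ _ h1]; simp [Function.iterate_succ_apply']
  | 2 =>
    rw [partialD_iterate _ _ _ h1, partialD_iterate _ _ _ (h2.mono (by omega))]
    simp [Function.iterate_succ_apply']
  | 3 =>
    rw [partialD_iterate _ _ _ h1, partialD_iterate _ _ _ (h2.mono (by omega)),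
      partialD_iterate _ _ _ (h3.mono (by omega))]
    simp [Function.iterate_succ_apply']

theorem partialD_fieldPow (α : Fin 4) {I : Fin 4 → ℕ} {J : Fin 3 → ℕ}
    (h : Admissible (1 + order (I, J)) φ) :
    partialD α (fieldPow (I, J) φ) = fieldPow (I + Pi.single α 1, J) φ :=
  partialD_partialPow α (Admissible.boostPow (h.mono (by simp only [order]; omega)))

theorem order_add_partial (α : Fin 4) (I : Fin 4 → ℕ) (J : Fin 3 → ℕ) :
    order (I + Pi.single α 1, J) = order (I, J) + 1 := by
  simp [order, Finset.sum_add_distrib]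
  omega

theorem order_add_boost (j : Fin 3) (I : Fin 4 → ℕ) (J : Fin 3 → ℕ) :
    order (I, J + Pi.single j 1) = order (I, J) + 1 := by
  simp [order, Finset.sum_add_distrib]
  omega

theorem boost_boostPow {j : Fin 3} {J : Fin 3 → ℕ} (hJ : ∀ i < j, J i = 0) (φ : Spacetime → ℝ) :
    boost j (boostPow J φ) = boostPow (J + Pi.single j 1) φ := by
  unfold boostPow
  match j with
  | 0 => simp [Function.iterate_succ_apply']
  | 1 => simp [Function.iterate_succ_apply', hJ 0 (by decide)]
  | 2 => simp [Function.iterate_succ_apply', hJ 0 (by decide), hJ 1 (by decide)]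

/-- The commutator of two boosts is the rotation x^j ∂_i - x^i ∂_j, which equals (x^j/t) L_i -
(x^i/t) L_j. This is why coefficients x^i/t are admitted in `Coef` and no rotation fields are
needed. -/
theorem boost_boost (i j : Fin 3) (h : Admissible 2 φ) {p : Spacetime} (hp : 0 < p.1) :
    boost j (boost i φ) p = boost i (boost j φ) p
      + (p.2 j * p.1⁻¹ * boost i φ p + -1 * (p.2 i * p.1⁻¹ * boost j φ p)) := by
  rw [boost_eq j (boost i φ), boost_eq i (boost j φ), dt_boost i h, dx_boost i j h, dt_boost j h,
    dx_boost j i h, dx_dx_eq i j h, dx_dt_eq i h, dx_dt_eq j h]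
  simp only [boost, eq_comm (a := j) (b := i)]
  field_simp
  ring

theorem boost_partialD (j : Fin 3) (α : Fin 4) (h : Admissible 2 φ) (p : Spacetime) :
    boost j (partialD α φ) p = partialD α (boost j φ) p
      + ((if α = 0 then -1 else 0) * partialD j.succ φ p
        + (if α = j.succ then -1 else 0) * partialD 0 φ p) := by
  refine Fin.cases ?_ (fun i => ?_) α
  · simp only [partialD_zero, partialD_succ]
    rw [dt_boost j h]
    simp only [boost_eq, dx_dt_eq j h, if_neg (Fin.succ_ne_zero j).symm, if_true]
    ring
  · simp only [partialD_zero, partialD_succ]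
    rw [dx_boost j i h, boost_eq, dx_dt_eq i h, dx_dx_eq i j h]
    rw [if_neg (Fin.succ_ne_zero i)]
    simp only [Fin.succ_inj]
    split_ifs <;> ring

/-- Combinations of the operators `∂^I L^J` of order at most `m`, with coefficients that are
polynomials in `1 / t` and `x^i / t`, acting on functions of class `C^{m+1}`. -/
inductive Comb (m : ℕ) : ((Spacetime → ℝ) → Spacetime → ℝ) → Prop
  | op {IJ : (Fin 4 → ℕ) × (Fin 3 → ℕ)} : order IJ ≤ m → Comb m (fieldPow IJ)
  | add {S T : (Spacetime → ℝ) → Spacetime → ℝ} : Comb m S → Comb m T →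
      Comb m fun φ p => S φ p + T φ p
  | mul {c : Spacetime → ℝ} {T : (Spacetime → ℝ) → Spacetime → ℝ} : Coef c → Comb m T →
      Comb m fun φ p => c p * T φ p
  | congr {S T : (Spacetime → ℝ) → Spacetime → ℝ} : Comb m S →
      (∀ φ, Admissible (m + 1) φ → ∀ p : Spacetime, 0 < p.1 → T φ p = S φ p) → Comb m T

variable {S T X : (Spacetime → ℝ) → Spacetime → ℝ}

theorem Comb.mono (hT : Comb n T) (hnm : n ≤ m) : Comb m T := by
  induction hT with
  | op h => exact .op (h.trans hnm)
  | add _ _ h1 h2 => exact .add h1 h2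
  | mul hc _ h => exact .mul hc h
  | congr _ h h' => exact .congr h' fun φ hφ => h φ (hφ.mono (by omega))

theorem eventually_time_pos {p : Spacetime} (hp : 0 < p.1) : ∀ᶠ q : Spacetime in nhds p, 0 < q.1 :=
  continuous_fst.continuousAt.eventually (lt_mem_nhds hp)

theorem Comb.differentiableAt (hT : Comb m T) (hφ : Admissible (m + 1) φ) {p : Spacetime}
    (hp : 0 < p.1) : DifferentiableAt ℝ (T φ) p := by
  induction hT with
  | op h =>
    exact (Admissible.fieldPow (n := 0 + 1) (hφ.mono (by omega))).differentiable_succ p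
  | add _ _ h1 h2 => exact h1.add h2
  | mul hc _ h => exact (hc.differentiableAt hp).mul h
  | congr _ h h' =>
    exact h'.congr_of_eventuallyEq ((eventually_time_pos hp).mono fun q hq => h φ hφ q hq)

/-- By the Leibniz rule a derivation either falls on a coefficient, which stays a polynomial in 1/t
and x^i/t, or reaches a basic operator, where the hypothesis `hop` applies. -/
theorem Comb.map (hX : IsDerivation X)
    (hop : ∀ IJ, order IJ ≤ m → Comb (m + 1) fun φ => X (fieldPow IJ φ)) (hT : Comb m T) :
    Comb (m + 1) fun φ => X (T φ) := by
  induction hT with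
  | op h => exact hop _ h
  | add h1 h2 g1 g2 =>
    refine .congr (.add g1 g2) fun φ hφ p hp => ?_
    have hφ' : Admissible (m + 1) φ := hφ.mono (by omega)
    exact hX.add (h1.differentiableAt hφ' hp) (h2.differentiableAt hφ' hp)
  | @mul c T hc h g =>
    obtain ⟨d, hd, e⟩ := hX.coef hc
    refine .congr (.add (.mul hd (h.mono (Nat.le_succ m))) (.mul hc g)) fun φ hφ p hp => ?_
    rw [hX.mul (hc.differentiableAt hp) (h.differentiableAt (hφ.mono (by omega)) hp), e p hp]
  | congr _ h g =>
    refine .congr g fun φ hφ p hp => hX.congr ?_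
    exact (eventually_time_pos hp).mono fun q hq => h φ (hφ.mono (by omega)) q hq

theorem Comb.partialD (hT : Comb m T) (α : Fin 4) : Comb (m + 1) fun φ => partialD α (T φ) := by
  refine Comb.map (isDerivation_partialD α) (fun IJ h => ?_) hT
  have h' : order (IJ.1 + Pi.single α 1, IJ.2) ≤ m + 1 := by
    rw [order_add_partial]; exact Nat.succ_le_succ h
  refine .congr (.op h') fun φ hφ p _ => ?_
  rw [← partialD_fieldPow α (hφ.mono (by simp only [Prod.mk.eta]; omega))]

theorem exists_add_single {ι : Type*} [DecidableEq ι] {I : ι → ℕ} {i : ι} (h : I i ≠ 0) :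
    ∃ I' : ι → ℕ, I = I' + Pi.single i 1 := by
  refine ⟨I - Pi.single i 1, funext fun k => ?_⟩
  by_cases hk : k = i
  · subst hk
    simp
    omega
  · simp [hk]

/-- Strong induction on the order proves both claims together. The second one, for pure boosts,
records that the remainder has order at most n, one below the leading term. This is what makes the
induction close: applying another boost to the remainder then only calls the first claim at strictly
smaller order. -/
theorem comb_boost_fieldPow_aux (n : ℕ) : ∀ I J, order (I, J) = n → ∀ j,
    (Comb (n + 1) fun φ => boost j (fieldPow (I, J) φ)) ∧
    (I = 0 → ∃ R, Comb n R ∧ ∀ φ, Admissible (n + 1) φ → ∀ p : Spacetime, 0 < p.1 →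
      boost j (boostPow J φ) p = boostPow (J + Pi.single j 1) φ p + R φ p) := by
  induction n using Nat.strong_induction_on with
  | _ n ih =>
  intro I J hn j
  have hop : ∀ m < n, ∀ IJ, order IJ ≤ m → ∀ j, Comb (m + 1) fun φ => boost j (fieldPow IJ φ) :=
    fun m hm IJ h j => (ih _ (h.trans_lt hm) IJ.1 IJ.2 rfl j).1.mono (by simpa using h)
  have hsecond : I = 0 → ∃ R, Comb n R ∧ ∀ φ, Admissible (n + 1) φ → ∀ p : Spacetime, 0 < p.1 →
      boost j (boostPow J φ) p = boostPow (J + Pi.single j 1) φ p + R φ p := by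
    rintro rfl
    by_cases hJ : ∀ i < j, J i = 0
    · refine ⟨_, .mul (.const 0) (.op (IJ := (0, 0)) (by simp [order])), fun φ _ p _ => ?_⟩
      rw [boost_boostPow hJ]
      simp
    push Not at hJ
    have hex : ∃ i : Fin 3, i < j ∧ J i ≠ 0 := hJ
    -- The least index i present in J is the outermost boost of L^J; it is peeled off, and L_j is
    -- moved past it.
    obtain ⟨i, ⟨hij, hi⟩, hmin⟩ : ∃ i : Fin 3, (i < j ∧ J i ≠ 0) ∧ ∀ k < i, J k = 0 := by
      obtain ⟨i, hi, hmin⟩ := WellFounded.has_min (wellFounded_lt (α := Fin 3))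
        {i | i < j ∧ J i ≠ 0} hex
      exact ⟨i, hi, fun k hk => by_contra fun h => hmin k ⟨hk.trans hi.1, h⟩ hk⟩
    obtain ⟨J', rfl⟩ := exists_add_single hi
    have hJ' : ∀ k < i, J' k = 0 := fun k hk => by simpa using (Nat.add_eq_zero_iff.1 (hmin k hk)).1
    rw [order_add_boost] at hn
    obtain ⟨n, rfl⟩ : ∃ n', n = n' + 1 := ⟨n - 1, by omega⟩
    have hn' : order (0, J') = n := by omega
    obtain ⟨R, hR, hR'⟩ := (ih n (Nat.lt_succ_self n) 0 J' hn' j).2 rfl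
    have hmap : Comb (n + 1) fun φ => boost i (R φ) :=
      Comb.map (isDerivation_boost i) (fun IJ h => hop n (Nat.lt_succ_self n) IJ h i) hR
    have hb : ∀ l, Comb (n + 1) fun φ => boost l (fieldPow (0, J') φ) :=
      fun l => hop n (Nat.lt_succ_self n) _ hn'.le l
    refine ⟨_, .add hmap (.add (.mul (.ratio j) (hb i)) (.mul (.const (-1))
      (.mul (.ratio i) (hb j)))), fun φ hφ p hp => ?_⟩
    have h0 : Admissible 2 (boostPow J' φ) :=
      Admissible.boostPow (hφ.mono (by simp [order] at hn'; omega))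
    have hord : order (0, J' + Pi.single j 1) = n + 1 := by rw [order_add_boost, hn']
    have h1 : Admissible 1 (boostPow (J' + Pi.single j 1) φ) :=
      Admissible.boostPow (hφ.mono (by simp only [order] at hord; simp at hord ⊢; omega))
    have e1 : boost i (boost j (boostPow J' φ)) p
        = boost i (boostPow (J' + Pi.single j 1) φ) p + boost i (R φ) p := by
      rw [← (isDerivation_boost i).add (h1.contDiff.differentiable (by norm_num) p)
        (hR.differentiableAt (hφ.mono (by omega)) hp)]
      exact (isDerivation_boost i).congr ((eventually_time_pos hp).mono fun q hq =>
        hR' φ (hφ.mono (by omega)) q hq)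
    -- After the exchange, L_i stands in front of an ordered product with no index below i, so
    -- `boost_boostPow` restores the order.
    rw [← boost_boostPow hJ', boost_boost i j h0 hp, e1, boost_boostPow (j := i) (fun k hk => by
      simp [hJ' k hk, (hk.trans hij).ne]), add_right_comm J']
    change _ = _ + (boost i (R φ) p + (_ * boost i (boostPow J' φ) p
      + _ * (_ * boost j (boostPow J' φ) p)))
    ring
  refine ⟨?_, hsecond⟩
  by_cases hI : I = 0
  · obtain ⟨R, hR, hR'⟩ := hsecond hI
    subst hI
    have h' : order (0, J + Pi.single j 1) ≤ n + 1 := by rw [order_add_boost, hn]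
    exact .congr (.add (.op h') (hR.mono (Nat.le_succ n))) fun φ hφ p hp =>
      hR' φ (hφ.mono (by omega)) p hp
  · obtain ⟨α, hα⟩ := Function.ne_iff.1 hI
    obtain ⟨I', rfl⟩ := exists_add_single hα
    rw [order_add_partial] at hn
    obtain ⟨n, rfl⟩ : ∃ n', n = n' + 1 := ⟨n - 1, by omega⟩
    have hn' : order (I', J) = n := by omega
    have hb : Comb (n + 1) fun φ => boost j (fieldPow (I', J) φ) :=
      hop n (Nat.lt_succ_self n) _ hn'.le j
    have hd : ∀ β, Comb (n + 2) fun φ => partialD β (fieldPow (I', J) φ) := fun β =>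
      ((Comb.op hn'.le).partialD β).mono (Nat.le_succ _)
    refine .congr (.add (hb.partialD α) (.add (.mul (.const (if α = 0 then -1 else 0)) (hd j.succ))
      (.mul (.const (if α = j.succ then -1 else 0)) (hd 0)))) fun φ hφ p hp => ?_
    rw [← partialD_fieldPow α (hφ.mono (by omega)),
      boost_partialD j α (Admissible.fieldPow (hφ.mono (by omega)))]

theorem comb_boost_fieldPow (IJ : (Fin 4 → ℕ) × (Fin 3 → ℕ)) (j : Fin 3) :
    Comb (order IJ + 1) fun φ => boost j (fieldPow IJ φ) :=
  (comb_boost_fieldPow_aux _ IJ.1 IJ.2 rfl j).1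

/-- The sum of the squares of the `∂^I L^J φ`, `|I| + |J| ≤ m`, and of their boosts. -/
def jetSq (m : ℕ) (φ : Spacetime → ℝ) (p : Spacetime) : ℝ :=
  ∑ IJ ∈ multiIndices m, (∑ i, boost i (fieldPow IJ φ) p ^ 2 + fieldPow IJ φ p ^ 2)

theorem jetSq_nonneg (m : ℕ) (φ : Spacetime → ℝ) (p : Spacetime) : 0 ≤ jetSq m φ p :=
  Finset.sum_nonneg fun _ _ => by positivity

/-- Boosts of T φ are included because they give the tangential gradient. When a boost falls on a
coefficient an undifferentiated term remains, hence the squares without boosts in `jetSq`. -/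
theorem Comb.sq_le (hT : Comb m T) : ∃ M, 0 ≤ M ∧ ∀ φ, Admissible (m + 1) φ → ∀ p : Spacetime,
    1 ≤ p.1 → ‖p.2‖ ≤ p.1 →
      T φ p ^ 2 ≤ M * jetSq m φ p ∧ ∀ i, boost i (T φ) p ^ 2 ≤ M * jetSq m φ p := by
  induction hT with
  | @op IJ h =>
    refine ⟨1, zero_le_one, fun φ hφ p hp hp' => ?_⟩
    have h1 : ∑ i, boost i (fieldPow IJ φ) p ^ 2 + fieldPow IJ φ p ^ 2 ≤ jetSq m φ p :=
      Finset.single_le_sum (f := fun IJ => ∑ i, boost i (fieldPow IJ φ) p ^ 2 + fieldPow IJ φ p ^ 2)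
        (fun _ _ => by positivity) (mem_multiIndices_iff.2 h)
    have h2 : 0 ≤ ∑ i, boost i (fieldPow IJ φ) p ^ 2 := by positivity
    have h3 : ∀ i, boost i (fieldPow IJ φ) p ^ 2 ≤ ∑ i, boost i (fieldPow IJ φ) p ^ 2 := fun i =>
      Finset.single_le_sum (f := fun i => boost i (fieldPow IJ φ) p ^ 2)
        (fun _ _ => sq_nonneg _) (Finset.mem_univ i)
    refine ⟨by linarith, fun i => ?_⟩
    nlinarith [h3 i, sq_nonneg (fieldPow IJ φ p)]
  | @add S T hS hT h1 h2 =>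
    obtain ⟨M, hM, h1⟩ := h1
    obtain ⟨N, hN, h2⟩ := h2
    refine ⟨2 * (M + N), by positivity, fun φ hφ p hp hp' => ?_⟩
    obtain ⟨a1, a2⟩ := h1 φ hφ p hp hp'
    obtain ⟨b1, b2⟩ := h2 φ hφ p hp hp'
    have hp0 : 0 < p.1 := by linarith
    refine ⟨by nlinarith [sq_nonneg (S φ p - T φ p)], fun i => ?_⟩
    rw [(isDerivation_boost i).add (hS.differentiableAt hφ hp0) (hT.differentiableAt hφ hp0)]
    nlinarith [a2 i, b2 i, sq_nonneg (boost i (S φ) p - boost i (T φ) p)]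
  | @mul c T hc hT h =>
    obtain ⟨M, hM, h⟩ := h
    obtain ⟨A, hA⟩ := hc.bounded
    choose d hd hdc using fun i => (isDerivation_boost i).coef hc
    choose B hB using fun i => (hd i).bounded
    refine ⟨2 * (A ^ 2 + ∑ i, B i ^ 2) * M, by positivity, fun φ hφ p hp hp' => ?_⟩
    obtain ⟨a1, a2⟩ := h φ hφ p hp hp'
    have hp0 : 0 < p.1 := by linarith
    have hZ := jetSq_nonneg m φ p
    have hc2 : c p ^ 2 ≤ A ^ 2 := sq_le_sq.2 ((hA p hp hp').trans (le_abs_self _))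
    have hd2 : ∀ i, d i p ^ 2 ≤ ∑ i, B i ^ 2 := fun i =>
      (sq_le_sq.2 ((hB i p hp hp').trans (le_abs_self _))).trans
        (Finset.single_le_sum (f := fun i => B i ^ 2) (fun _ _ => sq_nonneg _) (Finset.mem_univ i))
    have hS : 0 ≤ ∑ i, B i ^ 2 := by positivity
    have key : ∀ {x y X Y : ℝ}, 0 ≤ X → x ^ 2 ≤ X → y ^ 2 ≤ Y → (x * y) ^ 2 ≤ X * Y :=
      fun hX hx hy => by rw [mul_pow]; exact mul_le_mul hx hy (sq_nonneg _) hX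
    have k1 := key (sq_nonneg A) hc2 a1
    have hMZ : 0 ≤ M * jetSq m φ p := mul_nonneg hM hZ
    refine ⟨by nlinarith [mul_nonneg (sq_nonneg A) hMZ, mul_nonneg hS hMZ], fun i => ?_⟩
    rw [(isDerivation_boost i).mul (hc.differentiableAt hp0) (hT.differentiableAt hφ hp0),
      hdc i p hp0]
    have k2 := key hS (hd2 i) a1
    have k3 := key (sq_nonneg A) hc2 (a2 i)
    nlinarith [sq_nonneg (d i p * T φ p - c p * boost i (T φ) p)]
  | @congr S T hS h g =>
    obtain ⟨M, hM, g⟩ := g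
    refine ⟨M, hM, fun φ hφ p hp hp' => ?_⟩
    obtain ⟨a1, a2⟩ := g φ hφ p hp hp'
    have hp0 : 0 < p.1 := by linarith
    refine ⟨by rwa [h φ hφ p hp0], fun i => ?_⟩
    rw [(isDerivation_boost i).congr ((eventually_time_pos hp0).mono fun q hq => h φ hφ q hq)]
    exact a2 i

end Reorder

/-! ### Pointwise decay -/

section Pointwise

variable {φ ψ : Spacetime → ℝ} {n m k : ℕ} {a s : ℝ}

/-- This is t ∂̲_i = L_i; it turns the weighted second derivatives in `agmon` into tangential
energies of boosted functions. -/
theorem hypTime_mul_dx_pull (i : Fin 3) {q : Spacetime}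
    (hψ : DifferentiableAt ℝ ψ (hypPoint q.1 q.2)) (hq : q.1 ≠ 0) :
    hypTime q * dx i (pull ψ) q = pull (boost i ψ) q := by
  have hT := (hypTime_pos hq).ne'
  rw [dx_pull i hψ hq, pull, pull, pull, boost]
  change _ = hypTime q * _ + q.2 i * _
  field_simp

theorem gradSq_hypTime_mul_dx_pull (j : Fin 3) (h : Admissible 2 ψ) {q : Spacetime}
    (hq : q.1 ≠ 0) :
    gradSq (fun q => hypTime q * dx j (pull ψ) q) q = gradSq (pull (boost j ψ)) q :=
  Finset.sum_congr rfl fun i _ => by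
    rw [dx_congr i ((eventually_fst_ne_zero hq).mono fun p hp =>
      hypTime_mul_dx_pull j (h.differentiable _) hp)]

theorem gradSq_pull_eq (h : Admissible 2 ψ) (hs : 0 < s) (x : Space) :
    gradSq (pull ψ) (s, x) =
      (∑ i, boost i ψ (hypPoint s x) ^ 2) / hypTime (s, x) ^ 2 := by
  have hT := (hypTime_pos (q := (s, x)) hs.ne').ne'
  rw [gradSq, Finset.sum_div]
  refine Finset.sum_congr rfl fun i _ => ?_
  rw [← pull_apply (boost i ψ), ← hypTime_mul_dx_pull i (q := (s, x)) (h.differentiable _) hs.ne']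
  field_simp

/-- The sum of the tangential energies of the `∂^I L^J φ`, `|I| + |J| ≤ m`. -/
def gradEnergy (m : ℕ) (φ : Spacetime → ℝ) (s : ℝ) : ℝ :=
  ∑ IJ ∈ multiIndices m, ∫ x, gradSq (pull (fieldPow IJ φ)) (s, x)

theorem integral_gradSq_nonneg (f : Spacetime → ℝ) (s : ℝ) : 0 ≤ ∫ x, gradSq f (s, x) :=
  integral_nonneg fun _ => gradSq_nonneg _

theorem integral_gradSq_le_gradEnergy {IJ : (Fin 4 → ℕ) × (Fin 3 → ℕ)} (h : order IJ ≤ m)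
    (φ : Spacetime → ℝ) (s : ℝ) :
    ∫ x, gradSq (pull (fieldPow IJ φ)) (s, x) ≤ gradEnergy m φ s :=
  Finset.single_le_sum (f := fun IJ => ∫ x, gradSq (pull (fieldPow IJ φ)) (s, x))
    (fun _ _ => integral_gradSq_nonneg _ _) (mem_multiIndices_iff.2 h)

/-- The tangential gradient squared is the sum of squared boosts over t². The undifferentiated terms
ψ²/t² are recovered by the Hardy inequality; 15 = 3 · (1 + 4) counts the three directions and the
Hardy constant. -/
theorem Comb.integral_gradSq_le {T : (Spacetime → ℝ) → Spacetime → ℝ} (hT : Comb m T) :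
    ∃ C, 0 ≤ C ∧ ∀ φ, Admissible (m + 2) φ → Admissible 2 (T φ) → ∀ s, 1 ≤ s →
      ∫ x, gradSq (pull (T φ)) (s, x) ≤ C * gradEnergy m φ s := by
  obtain ⟨M, hM, hle⟩ := hT.sq_le
  refine ⟨15 * M, by positivity, fun φ hφ hTφ s hs => ?_⟩
  have hs0 : 0 < s := by linarith
  have hop : ∀ IJ ∈ multiIndices m, Admissible 2 (fieldPow IJ φ) := fun IJ h =>
    Admissible.fieldPow (hφ.mono (by have := mem_multiIndices_iff.1 h; omega))
  have hi1 : ∀ IJ ∈ multiIndices m, Integrable fun x => gradSq (pull (fieldPow IJ φ)) (s, x) :=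
    fun IJ h => integrable_gradSq (hop IJ h).contDiff_pull (hasCompactSupport_pull (hop IJ h).compact) s
  have hi2 : ∀ IJ ∈ multiIndices m,
      Integrable fun x => pull (fieldPow IJ φ) (s, x) ^ 2 / hypTime (s, x) ^ 2 := fun IJ h =>
    integrable_sq_div_hypTime (hop IJ h).contDiff_pull (hasCompactSupport_pull (hop IJ h).compact) hs0
  have hsum : Integrable fun x => ∑ IJ ∈ multiIndices m, (gradSq (pull (fieldPow IJ φ)) (s, x)
      + pull (fieldPow IJ φ) (s, x) ^ 2 / hypTime (s, x) ^ 2) :=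
    integrable_finsetSum _ fun IJ h => (hi1 IJ h).add (hi2 IJ h)
  calc ∫ x, gradSq (pull (T φ)) (s, x)
      ≤ ∫ x, 3 * M * ∑ IJ ∈ multiIndices m, (gradSq (pull (fieldPow IJ φ)) (s, x)
          + pull (fieldPow IJ φ) (s, x) ^ 2 / hypTime (s, x) ^ 2) := by
        refine integral_mono (integrable_gradSq hTφ.contDiff_pull
          (hasCompactSupport_pull hTφ.compact) s) (hsum.const_mul _) fun x => ?_
        have hpos := hypTime_pos (q := (s, x)) hs0.ne'
        have h1 : 1 ≤ (hypPoint s x).1 := hs.trans (le_hypTime s x)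
        have h2 : ‖(hypPoint s x).2‖ ≤ (hypPoint s x).1 := norm_le_hypTime s x
        have h3 := (hle φ (hφ.mono (by omega)) _ h1 h2).2
        have e : ∑ IJ ∈ multiIndices m, (gradSq (pull (fieldPow IJ φ)) (s, x)
            + pull (fieldPow IJ φ) (s, x) ^ 2 / hypTime (s, x) ^ 2)
            = jetSq m φ (hypPoint s x) / hypTime (s, x) ^ 2 := by
          rw [jetSq, Finset.sum_div]
          refine Finset.sum_congr rfl fun IJ h => ?_
          rw [gradSq_pull_eq (hop IJ h) hs0, pull_apply, add_div]
        beta_reduce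
        rw [e, gradSq_pull_eq hTφ hs0, ← mul_div_assoc]
        refine div_le_div_of_nonneg_right ?_ (by positivity)
        rw [Fin.sum_univ_three]
        linarith [h3 0, h3 1, h3 2]
    _ = 3 * M * ∑ IJ ∈ multiIndices m, ((∫ x, gradSq (pull (fieldPow IJ φ)) (s, x))
          + ∫ x, pull (fieldPow IJ φ) (s, x) ^ 2 / hypTime (s, x) ^ 2) := by
        rw [integral_const_mul]
        congr 1
        refine (integral_finsetSum _ fun IJ h => (hi1 IJ h).add (hi2 IJ h)).trans ?_
        exact Finset.sum_congr rfl fun IJ h => integral_add (hi1 IJ h) (hi2 IJ h)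
    _ ≤ 3 * M * ∑ IJ ∈ multiIndices m, (5 * ∫ x, gradSq (pull (fieldPow IJ φ)) (s, x)) := by
        refine mul_le_mul_of_nonneg_left (Finset.sum_le_sum fun IJ h => ?_) (by positivity)
        have := hardy_hypTime (hop IJ h).contDiff_pull (hasCompactSupport_pull (hop IJ h).compact) hs0
        linarith
    _ = 15 * M * gradEnergy m φ s := by
        rw [gradEnergy, ← Finset.mul_sum]
        ring

/-- `agmon` requires one additional boost, so energies of order k + 1 suffice. The regularity k + 3
makes that boosted function of class C². -/
theorem time_mul_sq_fieldPow_le {IJ : (Fin 4 → ℕ) × (Fin 3 → ℕ)} (hk : order IJ ≤ k) :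
    ∃ C, 0 ≤ C ∧ ∀ φ, Admissible (k + 3) φ → ∀ s, 1 ≤ s → ∀ x,
      hypTime (s, x) * fieldPow IJ φ (hypPoint s x) ^ 2 ≤ C * gradEnergy (k + 1) φ s := by
  choose C hC0 hC using fun j =>
    ((comb_boost_fieldPow IJ j).mono (Nat.succ_le_succ hk)).integral_gradSq_le
  refine ⟨256 * (1 + ∑ j, C j), mul_nonneg (by norm_num)
    (add_nonneg zero_le_one (Finset.sum_nonneg fun j _ => hC0 j)), fun φ hφ s hs x => ?_⟩
  have hs0 : 0 < s := by linarith
  have h3 : Admissible 3 (fieldPow IJ φ) := Admissible.fieldPow (hφ.mono (by omega))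
  have h2 : Admissible 2 (fieldPow IJ φ) := h3.mono (by norm_num)
  have h := agmon x h2.contDiff_pull (hasCompactSupport_pull h2.compact) h2.fst_ne_zero hs0
  have e : ∀ j, ∫ y, gradSq (fun q => hypTime q * dx j (pull (fieldPow IJ φ)) q) (s, y)
      ≤ C j * gradEnergy (k + 1) φ s := fun j => by
    refine le_trans (le_of_eq ?_) (hC j φ hφ (h3.boost j) s hs)
    exact integral_congr_ae (Filter.Eventually.of_forall fun y =>
      gradSq_hypTime_mul_dx_pull j h2 (q := (s, y)) hs0.ne')
  have e0 := integral_gradSq_le_gradEnergy (m := k + 1) (IJ := IJ) (by omega) φ s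
  have e1 := Finset.sum_le_sum fun j (_ : j ∈ Finset.univ) => e j
  rw [← Finset.sum_mul] at e1
  rw [pull_apply] at h
  refine h.trans ?_
  rw [mul_assoc]
  refine mul_le_mul_of_nonneg_left ?_ (by norm_num)
  rw [add_mul, one_mul]
  exact add_le_add e0 e1

theorem tauPlus_le (hs : 1 ≤ s) (x : Space) : tauPlus (hypPoint s x) ≤ 3 * hypTime (s, x) := by
  have h1 := le_hypTime s x
  have h2 := norm_le_hypTime s x
  have h3 := bracket_le (hypTime (s, x) + ‖x‖) (by linarith [norm_nonneg x])
  rw [tauPlus, hypPoint_fst, hypPoint_snd]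
  linarith

theorem sqrt_sum_le {ι : Type*} (A : Finset ι) {f : ι → ℝ} (hf : ∀ i, 0 ≤ f i) :
    √(∑ i ∈ A, f i) ≤ ∑ i ∈ A, √(f i) := by
  classical
  induction A using Finset.induction_on with
  | empty => simp
  | insert i A hi ih =>
    rw [Finset.sum_insert hi, Finset.sum_insert hi]
    have h0 := Finset.sum_nonneg fun i (_ : i ∈ A) => hf i
    refine le_trans (Real.sqrt_le_iff.2 ⟨by positivity, ?_⟩) (add_le_add_right ih _)
    nlinarith [Real.sq_sqrt (hf i), Real.sq_sqrt h0,
      mul_nonneg (Real.sqrt_nonneg (f i)) (Real.sqrt_nonneg (∑ i ∈ A, f i))]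

theorem sqrt_gradEnergy_le (hφ : Admissible (m + 2) φ) (hs : 0 < s) (a : ℝ) :
    ENNReal.ofReal (s ^ a * √(gradEnergy m φ s)) ≤ highOrder m (energyWa a s) φ := by
  have h : s ^ a * √(gradEnergy m φ s) ≤
      ∑ IJ ∈ multiIndices m, s ^ a * √(∫ x, gradSq (pull (fieldPow IJ φ)) (s, x)) := by
    rw [← Finset.mul_sum]
    exact mul_le_mul_of_nonneg_left (sqrt_sum_le _ fun _ => integral_gradSq_nonneg _ _) (by positivity)
  refine (ENNReal.ofReal_le_ofReal h).trans ?_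
  rw [ENNReal.ofReal_sum_of_nonneg fun _ _ => by positivity]
  refine Finset.sum_le_sum fun IJ hIJ => ?_
  rw [← normL2_smul_tangentialGrad (Admissible.fieldPow
    (hφ.mono (by have := mem_multiIndices_iff.1 hIJ; omega))) hs a]
  exact le_add_right le_add_self

theorem normLinf_fieldPow_le {IJ : (Fin 4 → ℕ) × (Fin 3 → ℕ)} (hk : order IJ ≤ k) :
    ∃ C : ℝ≥0, ∀ φ, Admissible (k + 3) φ → ∀ a s, 1 ≤ s →
      normLinf s (fun p => s ^ a * tauPlus p ^ (1 / 2 : ℝ) * fieldPow IJ φ p) ≤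
        C * highOrder (k + 1) (energyWa a s) φ := by
  obtain ⟨C, hC0, hC⟩ := time_mul_sq_fieldPow_le hk
  refine ⟨(√(3 * C)).toNNReal, fun φ hφ a s hs => ?_⟩
  have hs0 : 0 < s := by linarith
  refine le_trans ?_ (mul_le_mul_right (sqrt_gradEnergy_le (m := k + 1) hφ hs0 a) _)
  change _ ≤ ENNReal.ofReal _ * _
  rw [← ENNReal.ofReal_mul (Real.sqrt_nonneg _), normLinf, eLpNorm_exponent_top]
  refine eLpNormEssSup_le_of_ae_bound (Filter.Eventually.of_forall fun x => ?_)
  have hτ0 : 0 ≤ tauPlus (hypPoint s x) := zero_le_one.trans (one_le_bracket _)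
  have hτ := tauPlus_le hs x
  rw [Real.norm_eq_abs, abs_mul, abs_mul, abs_of_nonneg (Real.rpow_nonneg hs0.le a),
    abs_of_nonneg (Real.rpow_nonneg hτ0 _), ← Real.sqrt_eq_rpow, mul_left_comm, mul_assoc]
  refine mul_le_mul_of_nonneg_left ?_ (by positivity)
  rw [← Real.sqrt_sq_eq_abs, ← Real.sqrt_mul hτ0, ← Real.sqrt_mul (by positivity)]
  refine Real.sqrt_le_sqrt ?_
  have := hC φ hφ s hs x
  nlinarith [mul_le_mul_of_nonneg_right hτ (sq_nonneg (fieldPow IJ φ (hypPoint s x)))]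

theorem highOrder_normLinf_le (k : ℕ) :
    ∃ C : ℝ≥0, ∀ φ, Admissible (k + 3) φ → ∀ a s, 1 ≤ s →
      highOrder k (fun ψ => normLinf s (fun p => s ^ a * tauPlus p ^ (1 / 2 : ℝ) * ψ p)) φ ≤
        C * highOrder (k + 1) (energyWa a s) φ := by
  have h : ∀ IJ, ∃ C : ℝ≥0, IJ ∈ multiIndices k → ∀ φ, Admissible (k + 3) φ → ∀ a s, 1 ≤ s →
      normLinf s (fun p => s ^ a * tauPlus p ^ (1 / 2 : ℝ) * fieldPow IJ φ p) ≤
        C * highOrder (k + 1) (energyWa a s) φ := fun IJ => by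
    by_cases hIJ : IJ ∈ multiIndices k
    · obtain ⟨C, hC⟩ := normLinf_fieldPow_le (mem_multiIndices_iff.1 hIJ)
      exact ⟨C, fun _ => hC⟩
    · exact ⟨0, fun h => absurd h hIJ⟩
  choose C hC using h
  refine ⟨∑ IJ ∈ multiIndices k, C IJ, fun φ hφ a s hs => ?_⟩
  push_cast
  rw [Finset.sum_mul]
  exact Finset.sum_le_sum fun IJ hIJ => hC IJ hIJ φ hφ a s hs

/-- The energy estimate of order `k`, for functions with compact support in the light cone. -/
theorem highOrder_energyWa_le {s₀ s₁ : ℝ} (hs₀ : 1 ≤ s₀) (ha : a ∈ Set.Icc (0 : ℝ) 1) (k : ℕ)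
    (hφ : Admissible (k + 2) φ) (hs : s ∈ Set.Icc s₀ s₁) :
    highOrder k (energyWa a s) φ ≤
      ENNReal.ofReal (3 + 2 * (2 * energyConst a + 3)) * ENNReal.ofReal (2 * s₀) *
        (highOrder k (energyII a s₀) φ + highOrder k (energyW s₀) φ
          + highOrder k (sourceNorm a s₀ s₁) (box φ)) := by
  simp only [highOrder, ← Finset.sum_add_distrib]
  rw [Finset.mul_sum]
  refine Finset.sum_le_sum fun IJ hIJ => ?_
  have hle := mem_multiIndices_iff.1 hIJ
  have h := energyWa_estimate (φ := fieldPow IJ φ)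
    (Admissible.fieldPow (hφ.mono (by omega))) hs₀ hs ha
  rwa [box_fieldPow (hφ.mono (by omega))] at h

end Pointwise

/-! ### From solutions on the slab to compactly supported functions. -/

/-! ### Localization of a solution to the slab -/

section Localize

open Topology

variable {f g φ F : Spacetime → ℝ} {n k : ℕ} {a s s₀ s₁ : ℝ} {p : Spacetime}

theorem hypPoint_mem_slab (hs₀ : 0 < s₀) (hs : s ∈ Set.Icc s₀ s₁) (x : Space) :
    hypPoint s x ∈ slab s₀ s₁ := by
  have h0 : 0 < s := hs₀.trans_le hs.1
  refine ⟨hypTime_pos (q := (s, x)) h0.ne', ?_, ?_⟩ <;> rw [hypSq_hypPoint]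
  · exact pow_le_pow_left₀ hs₀.le hs.1 2
  · exact pow_le_pow_left₀ h0.le hs.2 2

theorem hypPoint_sqrt_hypSq (hp : 0 < p.1) (h : 0 ≤ hypSq p) : hypPoint √(hypSq p) p.2 = p := by
  rw [hypPoint, Real.sq_sqrt h]
  refine Prod.ext ?_ rfl
  simp [hypSq, Real.sqrt_sq hp.le]

theorem continuous_hypSq : Continuous hypSq :=
  (continuous_fst.pow 2).sub (continuous_snd.norm.pow 2)

/-- The open region between two hyperboloids. -/
def openSlab (s₀ s₁ : ℝ) : Set Spacetime := {p | 0 < p.1 ∧ s₀ ^ 2 < hypSq p ∧ hypSq p < s₁ ^ 2}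

theorem isOpen_openSlab (s₀ s₁ : ℝ) : IsOpen (openSlab s₀ s₁) :=
  (isOpen_lt continuous_const continuous_fst).inter
    ((isOpen_lt continuous_const continuous_hypSq).inter
      (isOpen_lt continuous_hypSq continuous_const))

theorem openSlab_subset_slab : openSlab s₀ s₁ ⊆ slab s₀ s₁ := fun _ hp =>
  ⟨hp.1, hp.2.1.le, hp.2.2.le⟩

theorem hypPoint_mem_openSlab (hs₀ : 0 < s₀) (hs : s ∈ Set.Ioo s₀ s₁) (x : Space) :
    hypPoint s x ∈ openSlab s₀ s₁ := by
  have h0 : 0 < s := hs₀.trans hs.1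
  refine ⟨hypTime_pos (q := (s, x)) h0.ne', ?_, ?_⟩ <;> rw [hypSq_hypPoint]
  · exact pow_lt_pow_left₀ hs.1 hs₀.le two_ne_zero
  · exact pow_lt_pow_left₀ hs.2 h0.le two_ne_zero

theorem isClosed_slab (hs₀ : 0 < s₀) : IsClosed (slab s₀ s₁) := by
  have e : slab s₀ s₁ = {p | 0 ≤ p.1 ∧ s₀ ^ 2 ≤ hypSq p ∧ hypSq p ≤ s₁ ^ 2} := by
    ext p
    refine ⟨fun h => ⟨h.1.le, h.2⟩, fun h => ⟨lt_of_le_of_ne h.1 fun h0 => ?_, h.2⟩⟩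
    have h1 := h.2.1
    rw [hypSq, ← h0] at h1
    nlinarith [sq_nonneg ‖p.2‖]
  rw [e]
  exact (isClosed_le continuous_const continuous_fst).inter
    ((isClosed_le continuous_const continuous_hypSq).inter
      (isClosed_le continuous_hypSq continuous_const))

theorem norm_lt_of_mem_slab (hs₀ : 0 < s₀) (hp : p ∈ slab s₀ s₁) : ‖p.2‖ < p.1 := by
  have h := hp.2.1
  rw [hypSq] at h
  exact lt_of_pow_lt_pow_left₀ 2 hp.1.le (by nlinarith)

/-- Keep x fixed and vary s: the closure of the interval (s₀, s₁) is [s₀, s₁], and `hypPoint` is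
continuous in s. -/
theorem slab_subset_closure (hs₀ : 0 < s₀) (hs : s₀ < s₁) :
    slab s₀ s₁ ⊆ closure (openSlab s₀ s₁) := by
  intro p hp
  have h0 : 0 ≤ hypSq p := (sq_nonneg s₀).trans hp.2.1
  have hmem : √(hypSq p) ∈ closure (Set.Ioo s₀ s₁) := by
    rw [closure_Ioo hs.ne]
    exact ⟨Real.le_sqrt_of_sq_le hp.2.1, Real.sqrt_le_iff.2 ⟨(hs₀.trans hs).le, hp.2.2⟩⟩
  rw [← hypPoint_sqrt_hypSq hp.1 h0]
  have hc : Continuous fun s => hypPoint s p.2 :=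
    continuous_hypPoint.comp (by fun_prop : Continuous fun s => (s, p.2))
  exact map_mem_closure (f := fun s => hypPoint s p.2) hc hmem fun s hs => hypPoint_mem_openSlab hs₀ hs p.2

/-- Two functions that are of class `C^n` up to the boundary of the slab and agree there. -/
def SlabEq (s₀ s₁ : ℝ) (n : ℕ) (f g : Spacetime → ℝ) : Prop :=
  ∀ p ∈ slab s₀ s₁, ContDiffAt ℝ n f p ∧ ContDiffAt ℝ n g p ∧ f p = g p

theorem SlabEq.mono {m : ℕ} (h : SlabEq s₀ s₁ n f g) (hm : m ≤ n) : SlabEq s₀ s₁ m f g :=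
  fun p hp => ⟨(h p hp).1.of_le (by exact_mod_cast hm), (h p hp).2.1.of_le (by exact_mod_cast hm),
    (h p hp).2.2⟩

/-- On the open slab the functions agree near each point, hence so do their derivatives. These are
continuous up to the bounding hyperboloids, in which the open slab accumulates, so the equality
passes to the boundary. -/
theorem SlabEq.fderiv_eq (hs₀ : 0 < s₀) (hs : s₀ < s₁) (h : SlabEq s₀ s₁ (n + 1) f g)
    (hp : p ∈ slab s₀ s₁) : fderiv ℝ f p = fderiv ℝ g p := by
  have hc : ∀ {f : Spacetime → ℝ}, ContDiffAt ℝ (n + 1 : ℕ) f p → ContinuousAt (fderiv ℝ f) p :=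
    fun hf => (hf.fderiv_right (m := 0) (by norm_cast; omega)).continuousAt
  have : (𝓝[openSlab s₀ s₁] p).NeBot :=
    mem_closure_iff_nhdsWithin_neBot.1 (slab_subset_closure hs₀ hs hp)
  refine tendsto_nhds_unique ((hc (h p hp).1).mono_left (nhdsWithin_le_nhds (s := openSlab s₀ s₁)))
    (((hc (h p hp).2.1).mono_left (nhdsWithin_le_nhds (s := openSlab s₀ s₁))).congr' ?_)
  filter_upwards [self_mem_nhdsWithin] with q hq
  refine (Filter.EventuallyEq.fderiv_eq ?_).symm
  filter_upwards [(isOpen_openSlab s₀ s₁).mem_nhds hq] with r hr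
  exact (h r (openSlab_subset_slab hr)).2.2

theorem SlabEq.partialD (hs₀ : 0 < s₀) (hs : s₀ < s₁) (α : Fin 4)
    (h : SlabEq s₀ s₁ (n + 1) f g) : SlabEq s₀ s₁ n (partialD α f) (partialD α g) := by
  intro p hp
  obtain ⟨h1, h2, -⟩ := h p hp
  have e := h.fderiv_eq hs₀ hs hp
  refine Fin.cases ?_ (fun i => ?_) α
  · exact ⟨contDiffAt_dt h1, contDiffAt_dt h2, by simp only [partialD_zero, dt, e]⟩
  · exact ⟨contDiffAt_dx i h1, contDiffAt_dx i h2, by simp only [partialD_succ, dx, e]⟩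

theorem SlabEq.boost (hs₀ : 0 < s₀) (hs : s₀ < s₁) (i : Fin 3)
    (h : SlabEq s₀ s₁ (n + 1) f g) : SlabEq s₀ s₁ n (boost i f) (boost i g) := by
  intro p hp
  obtain ⟨h1, h2, -⟩ := h p hp
  have e := h.fderiv_eq hs₀ hs hp
  have hb : ∀ {f : Spacetime → ℝ}, ContDiffAt ℝ (n + 1 : ℕ) f p →
      ContDiffAt ℝ n (Hyperboloidal.boost i f) p := fun hf =>
    (contDiffAt_fst.mul (contDiffAt_dx i hf)).add
      ((contDiff_coord i).contDiffAt.mul (contDiffAt_dt hf))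
  exact ⟨hb h1, hb h2, by simp only [Hyperboloidal.boost, dt, dx, e]⟩

theorem SlabEq.iterate {X : (Spacetime → ℝ) → Spacetime → ℝ}
    (hX : ∀ {n f g}, SlabEq s₀ s₁ (n + 1) f g → SlabEq s₀ s₁ n (X f) (X g)) (m : ℕ) :
    ∀ {n f g}, SlabEq s₀ s₁ (n + m) f g → SlabEq s₀ s₁ n (X^[m] f) (X^[m] g) := by
  induction m with
  | zero => exact fun h => h
  | succ m ih => exact fun h => ih (hX h)

theorem SlabEq.fieldPow (hs₀ : 0 < s₀) (hs : s₀ < s₁) {IJ : (Fin 4 → ℕ) × (Fin 3 → ℕ)}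
    (h : SlabEq s₀ s₁ (n + order IJ) f g) :
    SlabEq s₀ s₁ n (fieldPow IJ f) (fieldPow IJ g) := by
  rw [order, Fin.sum_univ_three, Fin.sum_univ_four] at h
  have hX := fun (i : Fin 3) {n f g} (h : SlabEq s₀ s₁ (n + 1) f g) => h.boost hs₀ hs i
  have hY := fun (α : Fin 4) {n f g} (h : SlabEq s₀ s₁ (n + 1) f g) => h.partialD hs₀ hs α
  exact SlabEq.iterate (hY 0) _ (SlabEq.iterate (hY 1) _ (SlabEq.iterate (hY 2) _
    (SlabEq.iterate (hY 3) _ (SlabEq.iterate (hX 0) _ (SlabEq.iterate (hX 1) _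
      (SlabEq.iterate (hX 2) _ (h.mono (by omega))))))))

theorem normL2_congr {V : Type*} [NormedAddCommGroup V] {f g : Spacetime → V}
    (h : ∀ x, f (hypPoint s x) = g (hypPoint s x)) : normL2 s f = normL2 s g := by
  simp only [normL2, h]

theorem SlabEq.fderiv_hypPoint (h : SlabEq s₀ s₁ 1 f g) (hs₀ : 0 < s₀) (hs' : s₀ < s₁)
    (hs : s ∈ Set.Icc s₀ s₁) (x : Space) :
    fderiv ℝ f (hypPoint s x) = fderiv ℝ g (hypPoint s x) :=
  SlabEq.fderiv_eq (n := 0) hs₀ hs' h (hypPoint_mem_slab hs₀ hs x)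

theorem SlabEq.energyW_eq (h : SlabEq s₀ s₁ 1 f g) (hs₀ : 0 < s₀) (hs' : s₀ < s₁)
    (hs : s ∈ Set.Icc s₀ s₁) : energyW s f = energyW s g := by
  have e := h.fderiv_hypPoint hs₀ hs' hs
  refine congrArg₂ (· + ·) (normL2_congr fun x => ?_) (normL2_congr fun x => ?_)
  · simp only [dt, e]
  · simp only [tangentialGrad, dt, dx, e]

theorem SlabEq.energyWa_eq (h : SlabEq s₀ s₁ 1 f g) (hs₀ : 0 < s₀) (hs' : s₀ < s₁)
    (hs : s ∈ Set.Icc s₀ s₁) : energyWa a s f = energyWa a s g := by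
  have e := h.fderiv_hypPoint hs₀ hs' hs
  refine congrArg₂ (· + ·) (congrArg₂ (· + ·) (normL2_congr fun x => ?_) (normL2_congr fun x => ?_))
    (congrArg (_ * ·) (normL2_congr fun x => ?_))
  · simp only [dt, e]
  · simp only [tangentialGrad, dt, dx, e]
  · rw [(h _ (hypPoint_mem_slab hs₀ hs x)).2.2]

theorem SlabEq.energyII_eq (h : SlabEq s₀ s₁ 1 f g) (hs₀ : 0 < s₀) (hs' : s₀ < s₁)
    (hs : s ∈ Set.Icc s₀ s₁) : energyII a s f = energyII a s g := by
  have e := h.fderiv_hypPoint hs₀ hs' hs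
  have hq : ContDiff ℝ (1 : ℕ) hypSq := by
    rw [hypSq_eq]
    fun_prop
  have h' : SlabEq s₀ s₁ 1 (fun q => hypSq q * f q) (fun q => hypSq q * g q) := fun p hp => by
    obtain ⟨h1, h2, h3⟩ := h p hp
    exact ⟨hq.contDiffAt.mul h1, hq.contDiffAt.mul h2, by beta_reduce; rw [h3]⟩
  have e' := h'.fderiv_hypPoint hs₀ hs' hs
  refine congrArg₂ (· + ·) (normL2_congr fun x => ?_) (normL2_congr fun x => ?_)
  · simp only [bondiU, angularGrad, dr, dt, dx, e, e']
  · simp only [bondiR, angularGrad, dr, dt, dx, e, e']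

theorem SlabEq.highOrder_eq {ν : (Spacetime → ℝ) → ℝ≥0∞} (hs₀ : 0 < s₀) (hs : s₀ < s₁)
    (h : SlabEq s₀ s₁ (k + n) f g) (hν : ∀ {f g}, SlabEq s₀ s₁ n f g → ν f = ν g) :
    highOrder k ν f = highOrder k ν g :=
  Finset.sum_congr rfl fun IJ hIJ => hν (SlabEq.fieldPow hs₀ hs (IJ := IJ) (h.mono (by
    have := mem_multiIndices_iff.1 hIJ
    omega)))

theorem IsDerivation.iterate_congr {X : (Spacetime → ℝ) → Spacetime → ℝ} (hX : IsDerivation X)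
    (m : ℕ) : ∀ {f g}, f =ᶠ[𝓝 p] g → X^[m] f =ᶠ[𝓝 p] X^[m] g := by
  induction m with
  | zero => exact fun h => h
  | succ m ih => exact fun h => ih (h.eventually_nhds.mono fun _ hq => hX.congr hq)

theorem fieldPow_congr (IJ : (Fin 4 → ℕ) × (Fin 3 → ℕ)) (h : f =ᶠ[𝓝 p] g) :
    fieldPow IJ f p = fieldPow IJ g p :=
  (((isDerivation_partialD 0).iterate_congr _ ((isDerivation_partialD 1).iterate_congr _
    ((isDerivation_partialD 2).iterate_congr _ ((isDerivation_partialD 3).iterate_congr _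
      ((isDerivation_boost 0).iterate_congr _ ((isDerivation_boost 1).iterate_congr _
        ((isDerivation_boost 2).iterate_congr _ h)))))))).eq_of_nhds

theorem box_congr (h : f =ᶠ[𝓝 p] g) : box f p = box g p := by
  have h1 : dt f =ᶠ[𝓝 p] dt g := h.eventually_nhds.mono fun _ hq => dt_congr hq
  have h2 : ∀ i, dx i f =ᶠ[𝓝 p] dx i g := fun i =>
    h.eventually_nhds.mono fun _ hq => dx_congr i hq
  simp only [box, dt_congr h1, fun i => dx_congr i (h2 i)]

/-- The source is prescribed only on the slab, so its derivatives on the two bounding hyperboloids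
depend on values outside. Those two values of s have measure zero in the integral. -/
theorem highOrder_sourceNorm_congr (hs₀ : 0 < s₀)
    (h : ∀ p ∈ openSlab s₀ s₁, f =ᶠ[𝓝 p] g) :
    highOrder k (sourceNorm a s₀ s₁) f = highOrder k (sourceNorm a s₀ s₁) g := by
  refine Finset.sum_congr rfl fun IJ _ => ?_
  simp only [sourceNorm, ← setLIntegral_congr (μ := volume) (Ioo_ae_eq_Icc (a := s₀) (b := s₁))]
  refine setLIntegral_congr_fun measurableSet_Ioo fun s hs => normL2_congr fun x => ?_
  rw [show partialPow IJ.1 (boostPow IJ.2 f) (hypPoint s x)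
    = partialPow IJ.1 (boostPow IJ.2 g) (hypPoint s x) from
    fieldPow_congr IJ (h _ (hypPoint_mem_openSlab hs₀ hs x))]

theorem exists_cutoff {A U : Set Spacetime} (hA : IsCompact A) (hU : IsOpen U) (hAU : A ⊆ U) :
    ∃ χ : Spacetime → ℝ, ContDiff ℝ n χ ∧ HasCompactSupport χ ∧ tsupport χ ⊆ U ∧
      ∀ p ∈ A, χ p = 1 := by
  obtain ⟨L, hL, hAL, hLU⟩ := exists_compact_between hA hU hAU
  obtain ⟨χ, h1, h0, -⟩ := exists_contMDiffMap_one_nhds_of_subset_interior (n := (n : ℕ∞))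
    (modelWithCornersSelf ℝ Spacetime) hA.isClosed hAL
  have hsub : tsupport χ ⊆ L := closure_minimal (fun p hp => by_contra fun h => hp (h0 p h))
    hL.isClosed
  exact ⟨χ, χ.contMDiff.contDiff, hL.of_isClosed_subset (isClosed_tsupport _) hsub,
    hsub.trans hLU, fun p hp => h1.self_of_nhdsSet p hp⟩

/-- Multiply φ by a cutoff equal to 1 on the compact part of the slab that meets `K`, and supported
where φ is C^n and |x| < t. Elsewhere on the slab φ already vanishes, so nothing changes there. -/
theorem exists_admissible_slabEq (hs₀ : 0 < s₀) (hreg : ∀ p ∈ slab s₀ s₁, ContDiffAt ℝ n φ p)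
    (hcomp : ∃ K : Set Spacetime, IsCompact K ∧ ∀ p ∈ slab s₀ s₁, p ∉ K → φ p = 0) :
    ∃ ψ, Admissible n ψ ∧ SlabEq s₀ s₁ n φ ψ := by
  obtain ⟨K, hK, hφK⟩ := hcomp
  have hU : IsOpen ({p | ContDiffAt ℝ n φ p} ∩ {p : Spacetime | ‖p.2‖ < p.1}) :=
    (isOpen_iff_mem_nhds.2 fun p hp => ContDiffAt.eventually hp (by simp)).inter
      (isOpen_lt continuous_snd.norm continuous_fst)
  obtain ⟨χ, h1, h2, h3, h4⟩ := exists_cutoff (n := n) (hK.inter_right (isClosed_slab hs₀)) hU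
    fun p hp => ⟨hreg p hp.2, norm_lt_of_mem_slab hs₀ hp.2⟩
  have hψ : Admissible n fun p => χ p * φ p :=
    ⟨contDiff_of_tsupport fun q hq =>
        h1.contDiffAt.mul (h3 (tsupport_mul_subset_left hq)).1,
      h2.mul_right, fun q hq => (h3 (tsupport_mul_subset_left hq)).2⟩
  refine ⟨_, hψ, fun p hp => ⟨hreg p hp, hψ.contDiff.contDiffAt, ?_⟩⟩
  by_cases hpK : p ∈ K
  · simp [h4 p ⟨hpK, hp⟩]
  · simp [hφK p hp hpK]

theorem IsCauchySolution.source_eventuallyEq {φ₀ φ₁ : Space → ℝ} {ψ : Spacetime → ℝ}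
    (h : IsCauchySolution n s₀ s₁ φ F φ₀ φ₁) (hψ : SlabEq s₀ s₁ n φ ψ) :
    ∀ p ∈ openSlab s₀ s₁, F =ᶠ[𝓝 p] box ψ := by
  intro p hp
  filter_upwards [(isOpen_openSlab s₀ s₁).mem_nhds hp] with q hq
  rw [← h.wave q (openSlab_subset_slab hq)]
  refine box_congr ?_
  filter_upwards [(isOpen_openSlab s₀ s₁).mem_nhds hq] with r hr
  exact (hψ r (openSlab_subset_slab hr)).2.2

theorem IsCauchySolution.highOrder_energyWa_le {φ₀ φ₁ : Space → ℝ} (hs₀ : 1 < s₀) (hs₁ : s₀ < s₁)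
    (ha : a ∈ Set.Icc (0 : ℝ) 1) {ψ : Spacetime → ℝ}
    (h : IsCauchySolution (k + 2) s₀ s₁ φ F φ₀ φ₁) (hψ : Admissible (k + 2) ψ)
    (hφψ : SlabEq s₀ s₁ (k + 2) φ ψ) (hs : s ∈ Set.Icc s₀ s₁) :
    highOrder k (energyWa a s) ψ ≤
      ENNReal.ofReal (3 + 2 * (2 * energyConst a + 3)) * ENNReal.ofReal (2 * s₀) *
        (highOrder k (energyI a s₀) φ + highOrder k (energyII a s₀) φ + highOrder k (energyW s₀) φ
          + highOrder k (sourceNorm a s₀ s₁) F) := by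
  have h0 : 0 < s₀ := by linarith
  have hm : s₀ ∈ Set.Icc s₀ s₁ := ⟨le_rfl, hs₁.le⟩
  have h1 : SlabEq s₀ s₁ (k + 1) φ ψ := hφψ.mono (by omega)
  rw [h1.highOrder_eq h0 hs₁ fun h => h.energyII_eq h0 hs₁ hm,
    h1.highOrder_eq h0 hs₁ fun h => h.energyW_eq h0 hs₁ hm,
    highOrder_sourceNorm_congr h0 (h.source_eventuallyEq hφψ)]
  -- E_II, E_W and the source norm already suffice; the nonnegative E_I term only enlarges the
  -- right-hand side.
  refine (Hyperboloidal.highOrder_energyWa_le hs₀.le ha k hψ hs).trans (mul_le_mul_right ?_ _)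
  gcongr
  exact le_add_self

end Localize

end Hyperboloidal

end

/-! ### The two estimates assembled. -/

open Hyperboloidal

theorem corollary2p3 (s₀ : ℝ) (hs₀ : 1 < s₀) (a : ℝ) (ha : a ∈ Set.Icc (0 : ℝ) 1) (k : ℕ) :
    ∃ C : ℝ≥0, ∀ s₁ : ℝ, s₀ < s₁ →
      ∀ (φ F : Hyperboloidal.Spacetime → ℝ) (φ₀ φ₁ : Hyperboloidal.Space → ℝ),
        (Hyperboloidal.IsCauchySolution (k + 2) s₀ s₁ φ F φ₀ φ₁ →
          ∀ s ∈ Set.Icc s₀ s₁,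
            Hyperboloidal.highOrder k (Hyperboloidal.energyWa a s) φ ≤
              C * (Hyperboloidal.highOrder k (Hyperboloidal.energyI a s₀) φ
                + Hyperboloidal.highOrder k (Hyperboloidal.energyII a s₀) φ
                + Hyperboloidal.highOrder k (Hyperboloidal.energyW s₀) φ
                + Hyperboloidal.highOrder k (Hyperboloidal.sourceNorm a s₀ s₁) F)) ∧
        (Hyperboloidal.IsCauchySolution (k + 4) s₀ s₁ φ F φ₀ φ₁ →
          ∀ s ∈ Set.Icc s₀ s₁,
            Hyperboloidal.highOrder k
                (fun ψ => Hyperboloidal.normLinf s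
                  (fun p => s ^ a * Hyperboloidal.tauPlus p ^ (1 / 2 : ℝ) * ψ p)) φ ≤
              C * (Hyperboloidal.highOrder (k + 2) (Hyperboloidal.energyI a s₀) φ
                + Hyperboloidal.highOrder (k + 2) (Hyperboloidal.energyII a s₀) φ
                + Hyperboloidal.highOrder (k + 2) (Hyperboloidal.energyW s₀) φ
                + Hyperboloidal.highOrder (k + 2) (Hyperboloidal.sourceNorm a s₀ s₁) F)) := by
  have h0 : 0 < s₀ := by linarith
  obtain ⟨B, hB⟩ := highOrder_normLinf_le k
  set A : ℝ≥0 := (3 + 2 * (2 * energyConst a + 3)).toNNReal * (2 * s₀).toNNReal with hA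
  have hA' : (A : ℝ≥0∞) =
      ENNReal.ofReal (3 + 2 * (2 * energyConst a + 3)) * ENNReal.ofReal (2 * s₀) :=
    ENNReal.coe_mul _ _
  -- A is the energy constant and B the Sobolev constant; the sum serves both claims and is
  -- independent of s₁.
  refine ⟨A + B * A, fun s₁ hs₁ φ F φ₀ φ₁ => ⟨fun h s hs => ?_, fun h s hs => ?_⟩⟩
  · obtain ⟨ψ, hψ, hφψ⟩ := exists_admissible_slabEq h0 h.regular h.compact
    rw [(hφψ.mono (m := k + 1) (by omega)).highOrder_eq h0 hs₁ fun h => h.energyWa_eq h0 hs₁ hs]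
    refine (h.highOrder_energyWa_le hs₀ hs₁ ha hψ hφψ hs).trans (mul_le_mul_left ?_ _)
    rw [← hA']
    exact_mod_cast le_self_add
  · obtain ⟨ψ, hψ, hφψ⟩ := exists_admissible_slabEq h0 h.regular h.compact
    -- The form `k + 0` lets `highOrder_eq` be used with n = 0: the sup norm involves only values,
    -- while the energies above need one derivative.
    rw [(hφψ.mono (m := k + 0) (by omega)).highOrder_eq h0 hs₁ fun {f g} h => by
      have e : ∀ x, f (hypPoint s x) = g (hypPoint s x) := fun x =>
        (h _ (hypPoint_mem_slab h0 hs x)).2.2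
      simp only [normLinf, e]]
    refine (hB ψ (hψ.mono (by omega)) a s (hs₀.le.trans hs.1)).trans ?_
    -- The decay estimate needs energies of order k + 1 only; they are among those of order k + 2,
    -- which class C^{k+4} = C^{(k+2)+2} permits.
    have hmono : highOrder (k + 1) (energyWa a s) ψ ≤ highOrder (k + 2) (energyWa a s) ψ :=
      Finset.sum_le_sum_of_subset fun IJ hIJ =>
        mem_multiIndices_iff.2 ((mem_multiIndices_iff.1 hIJ).trans (by omega))
    refine (mul_le_mul_right (hmono.trans
      (h.highOrder_energyWa_le (k := k + 2) hs₀ hs₁ ha hψ hφψ hs)) _).trans ?_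
    rw [← hA', ← mul_assoc]
    refine mul_le_mul_left ?_ _
    push_cast
    exact le_add_self
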